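/- Stochastic block model with side information. Let $a=a(n)>0$ and $b=b(n)>0$ with $a/b=\Theta(1)$ and $a=n^{o(1)}$, and let $\alpha\in[0,1/2)$ be fixed. The labels $\sigma_i\in\{\pm\}$, $i=1,\dots,n$, are independent and uniform; given $\sigma$, the edges of the random graph $G=G_n$ on $\{1,\dots,n\}$ are independent, $\{i,j\}$ being an edge with probability $a/n$ if $\sigma_i=\sigma_j$ and $b/n$ otherwise; independently for each vertex, $\tilde\sigma_i=\sigma_i$ with probability $1-\alpha$ and $\tilde\sigma_i=-\sigma_i$ with probability $\alpha$. The accuracy of an estimator $\hat\sigma=\hat\sigma(G,\tilde\sigma)$ is $p_{G_n}(\hat\sigma)=\frac1n\sum_{i=1}^n\mathbb P(\sigma_i=\hat\sigma_i)$, and $p^*_{G_n}$ is its maximum over all estimators. Belief propagation. Let $\beta=\frac12\log\frac ab$, $\gamma=\frac12\log\frac{1-\alpha}{\alpha}$ ($=+\infty$ if $\alpha=0$), $h_i=\tilde\sigma_i\gamma$ and $F(x)=\tanh^{-1}(\tanh\beta\,\tanh x)$, with $\tanh(\pm\infty)=\pm1$. Put $R^0_{i\to j}=h_i$, $R^{s}_{i\to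 j}=h_i+\sum_{\ell\in\partial i\setminus\{j\}}F(R^{s-1}_{\ell\to i})$ for $s\ge1$, and $R^t_u=h_u+\sum_{\ell\in\partial u}F(R^{t-1}_{\ell\to u})$ for $t\ge 1$, $R^0_u=h_u$, where $\partial i$ is the set of neighbours of $i$ in $G$. The estimator $\hat\sigma^t_{\rm BP}$ labels $u$ by $+$ if $R^t_u\ge0$ and by $-$ otherwise. Tree model. Let $T$ be the random tree whose root has a uniform label $\tau_{\rm root}\in\{\pm\}$ and in which every vertex with label $s$ has, independently, $\mathrm{Pois}(a/2)$ children with label $s$ and $\mathrm{Pois}(b/2)$ children with label $-s$; the noisy label $\tilde\tau_i$ of each vertex equals $\tau_i$ with probability $1-\alpha$ and $-\tau_i$ with probability $\alpha$, independently. Let $T^t$ be the tree cut at depth $t$ (as a rooted tree, without any ordering of children) and $\partial T^t$ the set of its vertices at depth exactly $t$. Let $p^*_{T^t}$ (respectively $q^*_{T^t}$) be the maximum of $\frac12\mathbb P(\hat\tau=+\mid\tau_{\rm root}=+)+\frac12\mathbb P(\hat\tau=-\mid\tau_{\rm root}=-)$ over all estimators $\hat\tau$ that are functions of $(T^t,\tilde\tau_{T^t},\tau_{\partial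 T^t})$ (respectively of $(T^t,\tilde\tau_{T^t})$). Claim. Let $t=t(n)\in\mathbb N$ be such that $\max(a,b)^t=n^{o(1)}$ (for $a\ge b$ this says $a^t=n^{o(1)}$). Here $f(n)=n^{o(1)}$ is understood as an upper bound: for every $\varepsilon>0$, $f(n)\le n^{\varepsilon}$ for all large $n$. Then $$\limsup_{n\to\infty}\bigl(p^*_{G_n}-p^*_{T^t}\bigr)\le 0,\qquad \lim_{n\to\infty}\bigl|p_{G_n}(\hat\sigma^t_{\rm BP})-q^*_{T^t}\bigr|=0,$$ $$\limsup_{n\to\infty}\bigl(p^*_{G_n}-p_{G_n}(\hat\sigma^t_{\rm BP})\bigr)\le\limsup_{n\to\infty}\bigl(p^*_{T^t}-q^*_{T^t}\bigr).$$ -/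

import Mathlib

open Filter Topology
open scoped BigOperators

noncomputable section

/-! Labels `+` and `-` are the Booleans `true` and `false`. -/

namespace SideInfo

/-- `f ≤ n^{o(1)}`: the sequence `f` is eventually smaller than every positive power of `n`. -/
def IsSubpolynomial (f : ℕ → ℝ) : Prop :=
  ∀ ε : ℝ, 0 < ε → ∀ᶠ n : ℕ in atTop, f n ≤ (n : ℝ) ^ ε

/-! ### The stochastic block model with side information -/

/-- Probability of a noisy label `y` when the true label is `x`. -/
def noiseProb (α : unitInterval) (x y : Bool) : ℝ :=
  if y = x then 1 - (α : ℝ) else (α : ℝ)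

/-- Probability of an edge between vertices with labels `x` and `y`. -/
def edgeProb (n : ℕ) (a b : ℝ) (x y : Bool) : ℝ :=
  if x = y then a / n else b / n

open Classical in
/-- Joint probability of `(σ, G, σ')` (true labels, graph, noisy labels) in the block model on
`n` vertices: uniform independent labels, independent edges given the labels, independent noise.
These are the masses of a probability distribution as soon as `0 ≤ a, b ≤ n`. -/
def sbmProb (n : ℕ) (a b : ℝ) (α : unitInterval)
    (σ : Fin n → Bool) (G : SimpleGraph (Fin n)) (σ' : Fin n → Bool) : ℝ :=
  (1 / 2 : ℝ) ^ n
    * (∏ i : Fin n, ∏ j ∈ Finset.Ioi i,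
        if G.Adj i j then edgeProb n a b (σ i) (σ j) else 1 - edgeProb n a b (σ i) (σ j))
    * ∏ i : Fin n, noiseProb α (σ i) (σ' i)

/-- An estimator of all the labels from the graph and the noisy labels. -/
abbrev Estimator (n : ℕ) : Type :=
  SimpleGraph (Fin n) → (Fin n → Bool) → Fin n → Bool

/-- The probability that vertex `i` is labelled correctly by the estimator. -/
def vertexAccuracy (n : ℕ) (a b : ℝ) (α : unitInterval) (est : Estimator n) (i : Fin n) : ℝ :=
  ∑ σ : Fin n → Bool, ∑ G : SimpleGraph (Fin n), ∑ σ' : Fin n → Bool,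
    if est G σ' i = σ i then sbmProb n a b α σ G σ' else 0

/-- `p_{G_n}(est)`: expected fraction of vertices labelled correctly. -/
def graphAccuracy (n : ℕ) (a b : ℝ) (α : unitInterval) (est : Estimator n) : ℝ :=
  (1 / (n : ℝ)) * ∑ i : Fin n, vertexAccuracy n a b α est i

/-- `p*_{G_n}`: the optimal accuracy over all estimators (a maximum over a finite set). -/
def optGraphAccuracy (n : ℕ) (a b : ℝ) (α : unitInterval) : ℝ :=
  ⨆ est : Estimator n, graphAccuracy n a b α est

/-! ### Local belief propagation -/

/-- `γ = (1/2) log ((1-α)/α)`, which is `+∞` for `α = 0`. -/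
def gammaField (α : unitInterval) : EReal :=
  if (α : ℝ) = 0 then ⊤ else (((1 / 2) * Real.log ((1 - (α : ℝ)) / (α : ℝ)) : ℝ) : EReal)

/-- The external field `h_i = ± γ`, with the sign of the noisy label of `i`. -/
def extField (α : unitInterval) (y : Bool) : EReal :=
  if y then gammaField α else - gammaField α

/-- `tanh` on the extended reals. -/
def tanhE : EReal → ℝ
  | ⊤ => 1
  | ⊥ => -1
  | (x : ℝ) => Real.tanh x

/-- `F(x) = tanh⁻¹ (tanh β * tanh x)` with `β = (1/2) log (a/b)`. -/
def bpF (a b : ℝ) (x : EReal) : ℝ :=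
  Real.artanh (Real.tanh ((1 / 2) * Real.log (a / b)) * tanhE x)

open Classical in
/-- The message `R^t_{i → j}`, initialised at `± γ` according to the noisy label of `i`. -/
def bpMessage {n : ℕ} (a b : ℝ) (α : unitInterval) (G : SimpleGraph (Fin n))
    (σ' : Fin n → Bool) : ℕ → Fin n → Fin n → EReal
  | 0, i, _ => extField α (σ' i)
  | t + 1, i, j => extField α (σ' i) +
      ((∑ l ∈ Finset.univ.filter (fun l => G.Adj i l ∧ l ≠ j),
        bpF a b (bpMessage a b α G σ' t l i) : ℝ) : EReal)

open Classical in
/-- The belief `R^t_u`; for `t = 0` it is the external field alone. -/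
def bpBelief {n : ℕ} (a b : ℝ) (α : unitInterval) (G : SimpleGraph (Fin n))
    (σ' : Fin n → Bool) : ℕ → Fin n → EReal
  | 0, u => extField α (σ' u)
  | t + 1, u => extField α (σ' u) +
      ((∑ l ∈ Finset.univ.filter (fun l => G.Adj u l),
        bpF a b (bpMessage a b α G σ' t l u) : ℝ) : EReal)

open Classical in
/-- The belief propagation estimator after `t` iterations: `+` exactly when `R^t_u ≥ 0`. -/
def bpEstimator (n : ℕ) (a b : ℝ) (α : unitInterval) (t : ℕ) : Estimator n :=
  fun G σ' u => decide (0 ≤ bpBelief a b α G σ' t u)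

/-! ### The two-type Poisson Galton-Watson tree -/

/-- Rooted trees of depth at most `t`, up to isomorphism (the children form a multiset), every
vertex carrying the pair (true label, noisy label). The vertices of level `t` are those at which
the recursion reaches `0`. -/
def LabelledTree : ℕ → Type
  | 0 => Bool × Bool
  | t + 1 => (Bool × Bool) × Multiset (LabelledTree t)

/-- Rooted trees of depth at most `t` with noisy labels at all vertices and, in addition, exact
labels at the vertices of level `t`, stored as pairs (true label, noisy label). -/
def ExactBoundaryTree : ℕ → Type
  | 0 => Bool × Bool
  | t + 1 => Bool × Multiset (ExactBoundaryTree t)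

/-- Rooted trees of depth at most `t` with noisy labels at all vertices. -/
def NoisyTree : ℕ → Type
  | 0 => Bool
  | t + 1 => Bool × Multiset (NoisyTree t)

/-- Forget the true labels of the vertices of level less than `t`. -/
def LabelledTree.observeExact : (t : ℕ) → LabelledTree t → ExactBoundaryTree t
  | 0, x => x
  | t + 1, x => (x.1.2, Multiset.map (LabelledTree.observeExact t) x.2)

/-- Forget all the true labels. -/
def LabelledTree.observeNoisy : (t : ℕ) → LabelledTree t → NoisyTree t
  | 0, x => x.2
  | t + 1, x => (x.1.2, Multiset.map (LabelledTree.observeNoisy t) x.2)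

/-- Law of the noisy label of a vertex whose true label is `x`. -/
def noiseLaw (α : unitInterval) (x : Bool) : PMF Bool :=
  PMF.ofFintype (fun y => ENNReal.ofReal (noiseProb α x y)) (by
    have h0 := α.2.1
    have h1 := α.2.2
    cases x <;> simp [noiseProb, ← ENNReal.ofReal_add, h0, h1])

/-- The Poisson law of mean `r`. -/
def poissonLaw (r : ℝ) : PMF ℕ :=
  (ProbabilityTheory.poissonMeasure r.toNNReal).toPMF

/-- The law of the multiset of `k` independent samples of `p`. -/
def iidMultiset {X : Type} (p : PMF X) : ℕ → PMF (Multiset X)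
  | 0 => PMF.pure 0
  | k + 1 => p.bind fun x => (iidMultiset p k).map fun s => x ::ₘ s

/-- The law of the tree `T^t` with its true and noisy labels, given that the root has label `x`:
the root has `Poisson(a/2)` children of label `x` and `Poisson(b/2)` children of label `-x`,
each of which starts an independent tree. -/
def treeLaw (a b : ℝ) (α : unitInterval) : (t : ℕ) → Bool → PMF (LabelledTree t)
  | 0, x => (noiseLaw α x).map fun y => ((x, y) : Bool × Bool)
  | t + 1, x =>
      (noiseLaw α x).bind fun y =>
      (poissonLaw (a / 2)).bind fun L =>
      (poissonLaw (b / 2)).bind fun M =>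
      (iidMultiset (treeLaw a b α t x) L).bind fun C =>
      (iidMultiset (treeLaw a b α t (!x)) M).map fun D =>
        (((x, y), C + D) : (Bool × Bool) × Multiset (LabelledTree t))

/-- Success probability `P(est = + | root = +) / 2 + P(est = - | root = -) / 2` of an estimator of
the root label from the observation `obs` of the tree of depth `t`. -/
def treeAccuracy (a b : ℝ) (α : unitInterval) (t : ℕ) {Y : Type} (obs : LabelledTree t → Y)
    (est : Y → Bool) : ℝ :=
  (1 / 2) * (((treeLaw a b α t true).map fun T => est (obs T)) true).toReal
    + (1 / 2) * (((treeLaw a b α t false).map fun T => est (obs T)) false).toReal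

/-- `p*_{T^t}`: the optimal success probability given the tree, the noisy labels and the exact
labels at level `t`. -/
def optTreeAccuracyExact (a b : ℝ) (α : unitInterval) (t : ℕ) : ℝ :=
  ⨆ est : ExactBoundaryTree t → Bool, treeAccuracy a b α t (LabelledTree.observeExact t) est

/-- `q*_{T^t}`: the optimal success probability given the tree and the noisy labels. -/
def optTreeAccuracyNoisy (a b : ℝ) (α : unitInterval) (t : ℕ) : ℝ :=
  ⨆ est : NoisyTree t → Bool, treeAccuracy a b α t (LabelledTree.observeNoisy t) est

end SideInfo

end

/-! Up to distance `t` a vertex of the graph sees n^{o(1)} other vertices, and its neighbourhood is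
close in law to the Galton-Watson tree. The two models are compared through an explicit finite
measure on named trees, whose vertices carry names in `Fin n`. The weight `treeWeight` multiplies
the noise probabilities, a factor (edge probability)/2 for each child, and exp(-(a+b)/2) for each
vertex above the last level.

Each comparison is one-sided. Forgetting the names, the weight is dominated by the tree law, because
C(n,k) n^{-k} ≤ 1/k! (`weight_le_treeLaw`). For a good tree (distinct names, at most K vertices),
the graph outcomes that show this tree around `r` have at least its weight times a residual weight
(`treeWeight_mul_residual_le`), and the residual weights sum to 1 - o(1) (`sum_residual_ge`). Good
trees carry total weight 1 - o(1) (`weight_lower_bound`). Since "correct" and "wrong" are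
complementary and all masses are close to 1, lower bounds for each of them yield two-sided
estimates.

For the optimal accuracy: the residual weight does not involve the true labels of the interior
vertices. The conditional chance that a graph estimator answers `+` is therefore a function of the
tree, its noisy labels and the exact boundary labels (`matchMass_eq_of_observation_eq`). The
estimator thus acts as a randomized decision on the tree with exact boundary, and errs at least as
often as the likelihood decision there (`sum_outcomeProb_error_ge`).

For belief propagation: its belief at `u` is the belief at the root of the tree of non-backtracking
walks from `u` (`bpBelief_eq`). On outcomes showing a good tree this walk tree is that tree
(`unfolding_eq`), where tanh of the belief is the normalized difference of the two likelihoods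
(`obsWeight_sub_eq`). So belief propagation makes the likelihood decision.

The hypothesis on max(a,b)^t leaves `t` unbounded by n^{o(1)} when max(a,b) is below or very near 1.
Named trees are therefore cut off after `h` levels. If `t` exceeds the cut-off, the mean offspring
is at most barely above 1 and the tree rarely has that many levels (`mass_ge_of_near_critical`). -/

noncomputable section

namespace SideInfo

/-! ### Sums over families of optional objects -/

section OptionFamilies

variable {ι X : Type} [Fintype ι] [DecidableEq ι] [Fintype X]

/-- Distributivity. Since every name independently carries a subtree or none, sums over all possible
offspring factor over the names. -/
lemma sum_pi_option_prod (g : ι → Option X → ℝ) :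
    ∑ c : ι → Option X, ∏ v, g v (c v) = ∏ v, (g v none + ∑ s, g v (some s)) := by
  have h := Finset.prod_univ_sum (fun _ : ι => (Finset.univ : Finset (Option X))) g
  rw [Fintype.piFinset_univ] at h
  rw [← h]
  exact Finset.prod_congr rfl fun v _ => Fintype.sum_option _

lemma sum_pi_option_elim (w : ι → X → ℝ) :
    ∑ c : ι → Option X, ∏ v, (c v).elim 1 (w v) = ∏ v, (1 + ∑ s, w v s) :=
  sum_pi_option_prod fun v o => o.elim 1 (w v)

/-- The factor at `v` becomes ∑ w g in place of 1 + ∑ w. Restoring that missing factor, which is at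
least 1, gives the uniform power on the right. -/
lemma first_moment_le (w : X → ℝ) (hw : ∀ s, 0 ≤ w s) (v : ι) (g : X → ℝ)
    (hg : ∀ s, 0 ≤ g s) :
    ∑ c : ι → Option X, (∏ u, (c u).elim 1 w) * (c v).elim 0 g
      ≤ (∑ s, w s * g s) * (1 + ∑ s, w s) ^ Fintype.card ι := by
  have hq : 0 ≤ ∑ s, w s := Finset.sum_nonneg fun s _ => hw s
  have hG : 0 ≤ ∑ s, w s * g s := Finset.sum_nonneg fun s _ => mul_nonneg (hw s) (hg s)
  have h1 : ∀ c : ι → Option X, (∏ u, (c u).elim 1 w) * (c v).elim 0 g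
      = ∏ u, (c u).elim 1 w * (if u = v then (c u).elim 0 g else 1) := by
    intro c
    rw [Finset.prod_mul_distrib, Finset.prod_ite_eq']
    simp
  simp_rw [h1]
  rw [sum_pi_option_prod fun u o => o.elim 1 w * (if u = v then o.elim 0 g else 1)]
  calc _ ≤ ∏ u, (if u = v then ∑ s, w s * g s else 1) * (1 + ∑ s, w s) := by
        refine Finset.prod_le_prod (fun u _ => ?_) (fun u _ => ?_)
        · split_ifs with h
          · simpa [h] using hG
          · simpa [h] using by positivity
        · split_ifs with h
          · simpa [h] using by nlinarith
          · simp
    _ = _ := by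
        rw [Finset.prod_mul_distrib, Finset.prod_ite_eq']
        simp

lemma second_moment_le (w : X → ℝ) (hw : ∀ s, 0 ≤ w s) {v v' : ι} (hv : v ≠ v') (g k : X → ℝ)
    (hg : ∀ s, 0 ≤ g s) (hk : ∀ s, 0 ≤ k s) :
    ∑ c : ι → Option X, (∏ u, (c u).elim 1 w) * ((c v).elim 0 g * (c v').elim 0 k)
      ≤ (∑ s, w s * g s) * (∑ s, w s * k s) * (1 + ∑ s, w s) ^ Fintype.card ι := by
  have hq : 0 ≤ ∑ s, w s := Finset.sum_nonneg fun s _ => hw s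
  have hG : 0 ≤ ∑ s, w s * g s := Finset.sum_nonneg fun s _ => mul_nonneg (hw s) (hg s)
  have hK : 0 ≤ ∑ s, w s * k s := Finset.sum_nonneg fun s _ => mul_nonneg (hw s) (hk s)
  have h1 : ∀ c : ι → Option X, (∏ u, (c u).elim 1 w) * ((c v).elim 0 g * (c v').elim 0 k)
      = ∏ u, (c u).elim 1 w * ((if u = v then (c u).elim 0 g else 1)
          * (if u = v' then (c u).elim 0 k else 1)) := by
    intro c
    rw [Finset.prod_mul_distrib, Finset.prod_mul_distrib, Finset.prod_ite_eq',
      Finset.prod_ite_eq']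
    simp
  simp_rw [h1]
  rw [sum_pi_option_prod fun u o => o.elim 1 w * ((if u = v then o.elim 0 g else 1)
          * (if u = v' then o.elim 0 k else 1))]
  calc _ ≤ ∏ u, ((if u = v then ∑ s, w s * g s else 1) *
          (if u = v' then ∑ s, w s * k s else 1)) * (1 + ∑ s, w s) := by
        refine Finset.prod_le_prod (fun u _ => ?_) (fun u _ => ?_)
        · by_cases h : u = v
          · have : u ≠ v' := fun e => hv (h.symm.trans e)
            subst h
            simpa [hv] using hG
          · by_cases h' : u = v'
            · subst h'
              simpa [h] using hK
            · simpa [h, h'] using by positivity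
        · by_cases h : u = v
          · subst h
            simpa [hv] using by nlinarith
          · by_cases h' : u = v'
            · subst h'
              simpa [h] using by nlinarith
            · simp [h, h']
    _ = _ := by
        rw [Finset.prod_mul_distrib, Finset.prod_mul_distrib, Finset.prod_ite_eq',
          Finset.prod_ite_eq']
        simp

end OptionFamilies

/-! ### Trees whose vertices carry names in `Fin n` -/

/-- Trees of depth at most `t`: the children of a vertex are named by distinct elements of
`Fin n`; data of type `L` at level `t`, of type `I` at the other levels. -/
def NamedTree (n : ℕ) (I L : Type) : ℕ → Type
  | 0 => L
  | t + 1 => I × (Fin n → Option (NamedTree n I L t))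

namespace NamedTree

variable {n : ℕ} {I L I' L' : Type}

instance instFintype [Fintype I] [Fintype L] : ∀ t, Fintype (NamedTree n I L t)
  | 0 => inferInstanceAs (Fintype L)
  | t + 1 =>
    haveI := instFintype t
    inferInstanceAs (Fintype (I × (Fin n → Option (NamedTree n I L t))))

lemma sum_succ [Fintype I] [Fintype L] (t : ℕ) (f : NamedTree n I L (t + 1) → ℝ) :
    ∑ s, f s = ∑ i : I, ∑ c : Fin n → Option (NamedTree n I L t), f (i, c) :=
  Fintype.sum_prod_type (f := fun p : I × (Fin n → Option (NamedTree n I L t)) => f p)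

/-- The names in a tree whose root is named `r`. -/
def verts : (t : ℕ) → NamedTree n I L t → Fin n → Finset (Fin n)
  | 0, _, r => {r}
  | t + 1, x, r => insert r (Finset.univ.biUnion fun v => (x.2 v).elim ∅ fun s => verts t s v)

/-- The names of the vertices of level less than `t`. -/
def interior : (t : ℕ) → NamedTree n I L t → Fin n → Finset (Fin n)
  | 0, _, _ => ∅
  | t + 1, x, r =>
    insert r (Finset.univ.biUnion fun v => (x.2 v).elim ∅ fun s => interior t s v)

/-- The pair `{u, v}` with its elements in increasing order. -/
def sortedPair (u v : Fin n) : Fin n × Fin n := if u < v then (u, v) else (v, u)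

/-- The edges, as increasing pairs of names. -/
def edges : (t : ℕ) → NamedTree n I L t → Fin n → Finset (Fin n × Fin n)
  | 0, _, _ => ∅
  | t + 1, x, r => Finset.univ.biUnion fun v =>
      (x.2 v).elim ∅ fun s => insert (sortedPair r v) (edges t s v)

/-- All the names are distinct. -/
def Distinct : (t : ℕ) → NamedTree n I L t → Fin n → Prop
  | 0, _, _ => True
  | t + 1, x, r =>
    (∀ v s, x.2 v = some s → Distinct t s v ∧ r ∉ verts t s v) ∧
      ∀ v v' s s', v ≠ v' → x.2 v = some s → x.2 v' = some s' →
        Disjoint (verts t s v) (verts t s' v')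

/-- Change the data. -/
def map (f : I → I') (g : L → L') : (t : ℕ) → NamedTree n I L t → NamedTree n I' L' t
  | 0, x => g x
  | t + 1, x => (f x.1, fun v => (x.2 v).map (map f g t))

lemma mem_verts_succ {t : ℕ} {x : NamedTree n I L (t + 1)} {r u : Fin n} :
    u ∈ verts (t + 1) x r ↔ u = r ∨ ∃ v s, x.2 v = some s ∧ u ∈ verts t s v := by
  simp only [verts, Finset.mem_insert, Finset.mem_biUnion, Finset.mem_univ, true_and]
  refine or_congr Iff.rfl (exists_congr fun v => ?_)
  cases h : x.2 v <;> simp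

lemma mem_interior_succ {t : ℕ} {x : NamedTree n I L (t + 1)} {r u : Fin n} :
    u ∈ interior (t + 1) x r ↔ u = r ∨ ∃ v s, x.2 v = some s ∧ u ∈ interior t s v := by
  simp only [interior, Finset.mem_insert, Finset.mem_biUnion, Finset.mem_univ, true_and]
  refine or_congr Iff.rfl (exists_congr fun v => ?_)
  cases h : x.2 v <;> simp

lemma mem_edges_succ {t : ℕ} {x : NamedTree n I L (t + 1)} {r : Fin n} {e : Fin n × Fin n} :
    e ∈ edges (t + 1) x r ↔
      ∃ v s, x.2 v = some s ∧ (e = sortedPair r v ∨ e ∈ edges t s v) := by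
  simp only [edges, Finset.mem_biUnion, Finset.mem_univ, true_and]
  refine exists_congr fun v => ?_
  cases h : x.2 v <;> simp

lemma root_mem_verts : ∀ (t : ℕ) (x : NamedTree n I L t) (r : Fin n), r ∈ verts t x r
  | 0, _, r => Finset.mem_singleton_self r
  | _ + 1, _, _ => Finset.mem_insert_self _ _

lemma interior_subset_verts : ∀ (t : ℕ) (x : NamedTree n I L t) (r : Fin n),
    interior t x r ⊆ verts t x r
  | 0, _, _ => Finset.empty_subset _
  | t + 1, x, r => by
    intro u hu
    rw [mem_interior_succ] at hu
    rw [mem_verts_succ]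
    exact hu.imp_right fun ⟨v, s, h, h'⟩ => ⟨v, s, h, interior_subset_verts t s v h'⟩

lemma verts_map (f : I → I') (g : L → L') : ∀ (t : ℕ) (x : NamedTree n I L t) (r : Fin n),
    verts t (map f g t x) r = verts t x r
  | 0, _, _ => rfl
  | t + 1, x, r => by
    simp only [verts, map]
    congr 2
    funext v
    cases x.2 v <;> simp [verts_map f g t]

lemma interior_map (f : I → I') (g : L → L') : ∀ (t : ℕ) (x : NamedTree n I L t) (r : Fin n),
    interior t (map f g t x) r = interior t x r
  | 0, _, _ => rfl
  | t + 1, x, r => by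
    simp only [interior, map]
    congr 2
    funext v
    cases x.2 v <;> simp [interior_map f g t]

lemma edges_map (f : I → I') (g : L → L') : ∀ (t : ℕ) (x : NamedTree n I L t) (r : Fin n),
    edges t (map f g t x) r = edges t x r
  | 0, _, _ => rfl
  | t + 1, x, r => by
    simp only [edges, map]
    congr 1
    funext v
    cases x.2 v <;> simp [edges_map f g t]

lemma distinct_map (f : I → I') (g : L → L') : ∀ (t : ℕ) (x : NamedTree n I L t) (r : Fin n),
    Distinct t (map f g t x) r ↔ Distinct t x r
  | 0, _, _ => Iff.rfl
  | t + 1, x, r => by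
    simp only [Distinct, map, Option.map_eq_some_iff]
    constructor
    · rintro ⟨h1, h2⟩
      refine ⟨fun v s hs => ?_, fun v v' s s' hv hs hs' => ?_⟩
      · have := h1 v _ ⟨s, hs, rfl⟩
        rwa [distinct_map f g t, verts_map] at this
      · have := h2 v v' _ _ hv ⟨s, hs, rfl⟩ ⟨s', hs', rfl⟩
        rwa [verts_map, verts_map] at this
    · rintro ⟨h1, h2⟩
      refine ⟨?_, ?_⟩
      · rintro v _ ⟨s, hs, rfl⟩
        rw [distinct_map f g t, verts_map]
        exact h1 v s hs
      · rintro v v' _ _ hv ⟨s, hs, rfl⟩ ⟨s', hs', rfl⟩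
        rw [verts_map, verts_map]
        exact h2 v v' s s' hv hs hs'

end NamedTree

open NamedTree

/-! ### The weight of a named tree -/

/-- Named trees with pairs (true label, noisy label). -/
abbrev LNamedTree (n t : ℕ) : Type := NamedTree n (Bool × Bool) (Bool × Bool) t

/-- The true label of the root. -/
def rootLabel {n : ℕ} : (t : ℕ) → LNamedTree n t → Bool
  | 0, x => x.1
  | _ + 1, x => x.1.1

/-- The weight of a named tree given the label of its root, set to `0` if the tree has at least
`h` levels. -/
def treeWeight (n : ℕ) (a b : ℝ) (α : unitInterval) : (t h : ℕ) → LNamedTree n t → ℝ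
  -- The fuel drops by one per level, so the weight vanishes as soon as some vertex lies at distance
  -- `h` from the root.
  | _, 0, _ => 0
  | 0, _ + 1, x => noiseProb α x.1 x.2
  -- The exponential is the normalization of the two Poisson offspring laws together. In the graph
  -- it stands for the non-edges at this vertex.
  | t + 1, h + 1, x => noiseProb α x.1.1 x.1.2 * Real.exp (-((a + b) / 2)) *
      ∏ v, (x.2 v).elim 1 fun s =>
        edgeProb n a b x.1.1 (rootLabel t s) / 2 * treeWeight n a b α t h s

lemma noiseProb_nonneg (α : unitInterval) (x y : Bool) : 0 ≤ noiseProb α x y := by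
  have h0 := α.2.1
  have h1 := α.2.2
  unfold noiseProb
  split_ifs <;> linarith

lemma sum_noiseProb (α : unitInterval) (x : Bool) : ∑ y, noiseProb α x y = 1 := by
  cases x <;> simp [noiseProb]

lemma edgeProb_nonneg (n : ℕ) {a b : ℝ} (ha : 0 ≤ a) (hb : 0 ≤ b) (x y : Bool) :
    0 ≤ edgeProb n a b x y := by
  unfold edgeProb
  split_ifs <;> positivity

lemma sum_edgeProb_half (n : ℕ) (a b : ℝ) (x : Bool) :
    ∑ y, edgeProb n a b x y / 2 = (a + b) / 2 / n := by
  cases x <;> simp [edgeProb] <;> ring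

section Weight

variable {n : ℕ} {a b : ℝ} {α : unitInterval}

lemma treeWeight_zero_fuel (t : ℕ) (s : LNamedTree n t) : treeWeight n a b α t 0 s = 0 := by
  cases t <;> rfl

lemma treeWeight_nonneg (ha : 0 ≤ a) (hb : 0 ≤ b) : ∀ (t h : ℕ) (s : LNamedTree n t),
    0 ≤ treeWeight n a b α t h s
  | t, 0, s => by rw [treeWeight_zero_fuel]
  | 0, _ + 1, _ => noiseProb_nonneg _ _ _
  | t + 1, h + 1, x => by
    refine mul_nonneg (mul_nonneg (noiseProb_nonneg _ _ _) (Real.exp_pos _).le)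
      (Finset.prod_nonneg fun v _ => ?_)
    cases x.2 v with
    | none => exact zero_le_one
    | some s =>
      exact mul_nonneg (div_nonneg (edgeProb_nonneg n ha hb _ _) zero_le_two)
        (treeWeight_nonneg ha hb t h s)

/-- Total weight of a function on the trees with root label `x`. -/
def weightSum (n : ℕ) (a b : ℝ) (α : unitInterval) (t h : ℕ) (x : Bool)
    (g : LNamedTree n t → ℝ) : ℝ :=
  ∑ s, if rootLabel t s = x then treeWeight n a b α t h s * g s else 0

/-- The weight of a child below a vertex of label `x`. -/
def childWeight (n : ℕ) (a b : ℝ) (α : unitInterval) (t h : ℕ) (x : Bool)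
    (s : LNamedTree n t) : ℝ :=
  edgeProb n a b x (rootLabel t s) / 2 * treeWeight n a b α t h s

lemma childWeight_nonneg (ha : 0 ≤ a) (hb : 0 ≤ b) (t h : ℕ) (x : Bool) (s : LNamedTree n t) :
    0 ≤ childWeight n a b α t h x s :=
  mul_nonneg (div_nonneg (edgeProb_nonneg n ha hb _ _) zero_le_two)
        (treeWeight_nonneg ha hb t h s)

lemma sum_childWeight_mul (t h : ℕ) (x : Bool) (g : LNamedTree n t → ℝ) :
    ∑ s, childWeight n a b α t h x s * g s
      = ∑ y, edgeProb n a b x y / 2 * weightSum n a b α t h y g := by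
  simp only [weightSum, Finset.mul_sum]
  rw [Finset.sum_comm]
  refine Finset.sum_congr rfl fun s _ => ?_
  simp only [mul_ite, mul_zero]
  rw [Finset.sum_ite_eq]
  simp [childWeight, mul_assoc]

lemma sum_childWeight_mul_le (ha : 0 ≤ a) (hb : 0 ≤ b) (t h : ℕ) (x : Bool)
    (g : LNamedTree n t → ℝ) (C : ℝ) (hC : ∀ y, weightSum n a b α t h y g ≤ C) :
    ∑ s, childWeight n a b α t h x s * g s ≤ (a + b) / 2 / n * C := by
  rw [sum_childWeight_mul, ← sum_edgeProb_half n a b x, Finset.sum_mul]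
  exact Finset.sum_le_sum fun y _ => mul_le_mul_of_nonneg_left (hC y)
    (div_nonneg (edgeProb_nonneg n ha hb _ _) zero_le_two)

lemma weightSum_zero_fuel (t : ℕ) (x : Bool) (g : LNamedTree n t → ℝ) :
    weightSum n a b α t 0 x g = 0 := by
  simp [weightSum, treeWeight_zero_fuel]

lemma weightSum_zero (h : ℕ) (x : Bool) (g : LNamedTree n 0 → ℝ) :
    weightSum n a b α 0 (h + 1) x g = ∑ y, noiseProb α x y * g (x, y) := by
  have := Fintype.sum_prod_type (f := fun s : Bool × Bool =>
    if rootLabel (n := n) 0 s = x then treeWeight n a b α 0 (h + 1) s * g s else 0)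
  refine this.trans ?_
  rw [Finset.sum_comm]
  refine Finset.sum_congr rfl fun y _ => ?_
  exact (Finset.sum_ite_eq' Finset.univ x fun z => noiseProb α z y * g (z, y)).trans
    (if_pos (Finset.mem_univ _))

lemma weightSum_succ (t h : ℕ) (x : Bool) (g : LNamedTree n (t + 1) → ℝ) :
    weightSum n a b α (t + 1) (h + 1) x g = ∑ y, noiseProb α x y *
      (Real.exp (-((a + b) / 2)) * ∑ c : Fin n → Option (LNamedTree n t),
        (∏ v, (c v).elim 1 (childWeight n a b α t h x)) * g ((x, y), c)) := by
  unfold weightSum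
  rw [NamedTree.sum_succ, Fintype.sum_prod_type, Finset.sum_comm]
  refine Finset.sum_congr rfl fun y _ => ?_
  rw [Finset.sum_comm]
  simp only [Finset.mul_sum]
  refine Finset.sum_congr rfl fun c _ => ?_
  refine (Finset.sum_ite_eq' Finset.univ x fun z =>
    treeWeight n a b α (t + 1) (h + 1) ((z, y), c) * g ((z, y), c)).trans
    ((if_pos (Finset.mem_univ _)).trans ?_)
  change noiseProb α x y * Real.exp (-((a + b) / 2)) *
    (∏ v, (c v).elim 1 (childWeight n a b α t h x)) * g ((x, y), c) = _
  ring

lemma weightSum_succ_le (t h : ℕ) (x : Bool) (g : LNamedTree n (t + 1) → ℝ) (C : ℝ)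
    (hC : ∀ y, Real.exp (-((a + b) / 2)) * ∑ c : Fin n → Option (LNamedTree n t),
        (∏ v, (c v).elim 1 (childWeight n a b α t h x)) * g ((x, y), c) ≤ C) :
    weightSum n a b α (t + 1) (h + 1) x g ≤ C := by
  rw [weightSum_succ]
  calc _ ≤ ∑ y, noiseProb α x y * C :=
        Finset.sum_le_sum fun y _ => mul_le_mul_of_nonneg_left (hC y) (noiseProb_nonneg _ _ _)
    _ = C := by rw [← Finset.sum_mul, sum_noiseProb, one_mul]

lemma weightSum_mono (ha : 0 ≤ a) (hb : 0 ≤ b) {t h : ℕ} {x : Bool} {g g' : LNamedTree n t → ℝ}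
    (hg : ∀ s, g s ≤ g' s) : weightSum n a b α t h x g ≤ weightSum n a b α t h x g' := by
  refine Finset.sum_le_sum fun s _ => ?_
  split_ifs
  · exact mul_le_mul_of_nonneg_left (hg s) (treeWeight_nonneg ha hb t h s)
  · exact le_rfl

lemma weightSum_nonneg (ha : 0 ≤ a) (hb : 0 ≤ b) {t h : ℕ} {x : Bool} {g : LNamedTree n t → ℝ}
    (hg : ∀ s, 0 ≤ g s) : 0 ≤ weightSum n a b α t h x g := by
  refine Finset.sum_nonneg fun s _ => ?_
  split_ifs
  · exact mul_nonneg (treeWeight_nonneg ha hb t h s) (hg s)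
  · exact le_rfl

/-! ### Total mass at most one, and moments of the offspring -/

lemma exp_mul_one_add_pow_le_one (hn : 0 < n) {d q : ℝ} (hq0 : 0 ≤ q) (hq : q ≤ d / n) :
    Real.exp (-d) * (1 + q) ^ n ≤ 1 := by
  have hn' : (0 : ℝ) < n := by exact_mod_cast hn
  have h1 : (1 + q) ^ n ≤ Real.exp d := by
    calc (1 + q) ^ n ≤ (Real.exp q) ^ n :=
          pow_le_pow_left₀ (by linarith) (by linarith [Real.add_one_le_exp q]) n
      _ = Real.exp (n * q) := (Real.exp_nat_mul q n).symm
      _ ≤ Real.exp d := Real.exp_le_exp.mpr (by rw [le_div_iff₀ hn'] at hq; linarith)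
  calc Real.exp (-d) * (1 + q) ^ n ≤ Real.exp (-d) * Real.exp d :=
        mul_le_mul_of_nonneg_left h1 (Real.exp_pos _).le
    _ = 1 := by rw [← Real.exp_add]; simp

/-- If the subtrees have mass at most 1, each name contributes q ≤ d/n with d = (a+b)/2, and the
offspring of a vertex has mass e^{-d}(1+q)^n ≤ 1. -/
lemma weightSum_one_le (hn : 0 < n) (ha : 0 ≤ a) (hb : 0 ≤ b) : ∀ (t h : ℕ) (x : Bool),
    weightSum n a b α t h x (fun _ => 1) ≤ 1
  | t, 0, x => by rw [weightSum_zero_fuel]; exact zero_le_one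
  | 0, h + 1, x => by
    rw [weightSum_zero]
    simp only [mul_one]
    exact (sum_noiseProb α x).le
  | t + 1, h + 1, x => by
    refine weightSum_succ_le t h x _ 1 fun y => ?_
    simp only [mul_one]
    rw [sum_pi_option_elim, Finset.prod_const, Finset.card_univ, Fintype.card_fin]
    refine exp_mul_one_add_pow_le_one hn
      (Finset.sum_nonneg fun s _ => childWeight_nonneg ha hb t h x s) ?_
    have := sum_childWeight_mul_le (n := n) (α := α) ha hb t h x (fun _ => 1) 1
      (fun y => weightSum_one_le hn ha hb t h y)
    simpa using this

lemma exp_mul_childWeight_pow_le (hn : 0 < n) (ha : 0 ≤ a) (hb : 0 ≤ b) (t h : ℕ) (x : Bool) :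
    Real.exp (-((a + b) / 2)) * (1 + ∑ s, childWeight n a b α t h x s) ^ Fintype.card (Fin n)
      ≤ 1 := by
  rw [Fintype.card_fin]
  refine exp_mul_one_add_pow_le_one hn
      (Finset.sum_nonneg fun s _ => childWeight_nonneg ha hb t h x s) ?_
  have := sum_childWeight_mul_le (n := n) (α := α) ha hb t h x (fun _ => 1) 1
      (fun y => weightSum_one_le hn ha hb t h y)
  simpa using this

/-- Expectation of a function of the children. -/
def childSum (n : ℕ) (a b : ℝ) (α : unitInterval) (t h : ℕ) (x : Bool)
    (g : (Fin n → Option (LNamedTree n t)) → ℝ) : ℝ :=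
  Real.exp (-((a + b) / 2)) * ∑ c : Fin n → Option (LNamedTree n t),
        (∏ v, (c v).elim 1 (childWeight n a b α t h x)) * g c

lemma childSum_mono (ha : 0 ≤ a) (hb : 0 ≤ b) {t h : ℕ} {x : Bool}
    {g g' : (Fin n → Option (LNamedTree n t)) → ℝ} (hg : ∀ c, g c ≤ g' c) :
    childSum n a b α t h x g ≤ childSum n a b α t h x g' := by
  refine mul_le_mul_of_nonneg_left (Finset.sum_le_sum fun c _ =>
    mul_le_mul_of_nonneg_left (hg c) (Finset.prod_nonneg fun v _ => ?_)) (Real.exp_pos _).le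
  cases c v with
  | none => exact zero_le_one
  | some s => exact childWeight_nonneg ha hb t h x s

lemma childSum_add (t h : ℕ) (x : Bool) (g g' : (Fin n → Option (LNamedTree n t)) → ℝ) :
    childSum n a b α t h x (fun c => g c + g' c)
      = childSum n a b α t h x g + childSum n a b α t h x g' := by
  simp only [childSum, mul_add, Finset.sum_add_distrib]

lemma childSum_finsetSum {κ : Type} (S : Finset κ) (t h : ℕ) (x : Bool)
    (g : κ → (Fin n → Option (LNamedTree n t)) → ℝ) :
    childSum n a b α t h x (fun c => ∑ i ∈ S, g i c)
      = ∑ i ∈ S, childSum n a b α t h x (g i) := by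
  simp only [childSum, Finset.mul_sum]
  rw [Finset.sum_comm]

lemma childSum_one_le (hn : 0 < n) (ha : 0 ≤ a) (hb : 0 ≤ b) (t h : ℕ) (x : Bool) :
    childSum n a b α t h x (fun _ => 1) ≤ 1 := by
  simp only [childSum, mul_one]
  rw [sum_pi_option_elim, Finset.prod_const, Finset.card_univ]
  exact exp_mul_childWeight_pow_le hn ha hb t h x

lemma childSum_first_le (hn : 0 < n) (ha : 0 ≤ a) (hb : 0 ≤ b) (t h : ℕ) (x : Bool) (v : Fin n)
    (g : LNamedTree n t → ℝ) (hg : ∀ s, 0 ≤ g s) :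
    childSum n a b α t h x (fun c => (c v).elim 0 g)
      ≤ ∑ s, childWeight n a b α t h x s * g s := by
  have h0 := childWeight_nonneg (n := n) (α := α) ha hb t h x
  have h1 := first_moment_le _ h0 v g hg
  have h2 := exp_mul_childWeight_pow_le (α := α) hn ha hb t h x
  have h3 : 0 ≤ ∑ s, childWeight n a b α t h x s * g s :=
    Finset.sum_nonneg fun s _ => mul_nonneg (h0 s) (hg s)
  calc _ ≤ Real.exp (-((a + b) / 2)) * ((∑ s, childWeight n a b α t h x s * g s) *
        (1 + ∑ s, childWeight n a b α t h x s) ^ Fintype.card (Fin n)) :=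
        mul_le_mul_of_nonneg_left h1 (Real.exp_pos _).le
    _ = (∑ s, childWeight n a b α t h x s * g s) * (Real.exp (-((a + b) / 2)) *
        (1 + ∑ s, childWeight n a b α t h x s) ^ Fintype.card (Fin n)) := by ring
    _ ≤ _ := mul_le_of_le_one_right h3 h2

lemma childSum_second_le (hn : 0 < n) (ha : 0 ≤ a) (hb : 0 ≤ b) (t h : ℕ) (x : Bool)
    {v v' : Fin n} (hv : v ≠ v')
    (g k : LNamedTree n t → ℝ) (hg : ∀ s, 0 ≤ g s) (hk : ∀ s, 0 ≤ k s) :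
    childSum n a b α t h x (fun c => (c v).elim 0 g * (c v').elim 0 k)
      ≤ (∑ s, childWeight n a b α t h x s * g s) * ∑ s, childWeight n a b α t h x s * k s := by
  have h0 := childWeight_nonneg (n := n) (α := α) ha hb t h x
  have h1 := second_moment_le _ h0 hv g k hg hk
  have h2 := exp_mul_childWeight_pow_le (α := α) hn ha hb t h x
  have h3 : 0 ≤ (∑ s, childWeight n a b α t h x s * g s) *
      ∑ s, childWeight n a b α t h x s * k s :=
    mul_nonneg (Finset.sum_nonneg fun s _ => mul_nonneg (h0 s) (hg s))
      (Finset.sum_nonneg fun s _ => mul_nonneg (h0 s) (hk s))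
  calc _ ≤ Real.exp (-((a + b) / 2)) * ((∑ s, childWeight n a b α t h x s * g s) *
        (∑ s, childWeight n a b α t h x s * k s) *
        (1 + ∑ s, childWeight n a b α t h x s) ^ Fintype.card (Fin n)) :=
        mul_le_mul_of_nonneg_left h1 (Real.exp_pos _).le
    _ = ((∑ s, childWeight n a b α t h x s * g s) *
        ∑ s, childWeight n a b α t h x s * k s) * (Real.exp (-((a + b) / 2)) *
        (1 + ∑ s, childWeight n a b α t h x s) ^ Fintype.card (Fin n)) := by ring
    _ ≤ _ := mul_le_of_le_one_right h3 h2

end Weight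

end SideInfo

end

noncomputable section

namespace SideInfo

open NamedTree

/-! ### Moments of the weight -/

/-- `1 + d + ⋯ + d^(h-1)`. -/
def geomSum (d : ℝ) (h : ℕ) : ℝ := ∑ s ∈ Finset.range h, d ^ s

lemma geomSum_succ (d : ℝ) (h : ℕ) : geomSum d (h + 1) = 1 + d * geomSum d h := by
  unfold geomSum
  rw [Finset.sum_range_succ', Finset.mul_sum]
  simp only [pow_succ', pow_zero]
  ring

lemma geomSum_nonneg {d : ℝ} (hd : 0 ≤ d) (h : ℕ) : 0 ≤ geomSum d h :=
  Finset.sum_nonneg fun _ _ => pow_nonneg hd _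

lemma geomSum_mono {d : ℝ} (hd : 0 ≤ d) {h h' : ℕ} (hh : h ≤ h') :
    geomSum d h ≤ geomSum d h' :=
  Finset.sum_le_sum_of_subset_of_nonneg (Finset.range_mono hh) fun _ _ _ => pow_nonneg hd _

section Moments

open Classical

variable {n : ℕ} {a b : ℝ} {α : unitInterval}

lemma sum_child_visits_le (ha : 0 ≤ a) (hb : 0 ≤ b) (t h : ℕ) (x : Bool)
    (z : Fin n) (C : ℝ)
    (hC : ∀ y, ∑ r, weightSum n a b α t h y (fun s => if z ∈ verts t s r then 1 else 0) ≤ C) :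
    ∑ v, ∑ s, childWeight n a b α t h x s * (if z ∈ verts t s v then 1 else 0)
      ≤ (a + b) / 2 / n * C := by
  simp_rw [sum_childWeight_mul]
  rw [Finset.sum_comm, ← sum_edgeProb_half n a b x, Finset.sum_mul]
  refine Finset.sum_le_sum fun y _ => ?_
  rw [← Finset.mul_sum]
  exact mul_le_mul_of_nonneg_left (hC y) (div_nonneg (edgeProb_nonneg n ha hb _ _) zero_le_two)

lemma childSum_visits_le (hn : 0 < n) (ha : 0 ≤ a) (hb : 0 ≤ b) (t h : ℕ) (x : Bool)
    (z : Fin n) (C : ℝ)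
    (hC : ∀ y, ∑ r, weightSum n a b α t h y (fun s => if z ∈ verts t s r then 1 else 0) ≤ C) :
    childSum n a b α t h x
      (fun c => ∑ v, (c v).elim 0 fun s => if z ∈ verts t s v then 1 else 0)
      ≤ (a + b) / 2 / n * C := by
  rw [childSum_finsetSum]
  refine le_trans (Finset.sum_le_sum fun v _ => ?_) (sum_child_visits_le ha hb t h x z C hC)
  exact childSum_first_le hn ha hb t h x v _ fun s => by split_ifs <;> norm_num

/-- Summing over the root name makes all names equivalent, so this is the expected size of the tree.
The root hits `z` for a single `r`. The children, whose names already range over `Fin n`, hit it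
with weight at most (d/n)·`geomSum d h`, and the `n` choices of `r` turn d/n into d. -/
lemma weightSum_visits_le (hn : 0 < n) (ha : 0 ≤ a) (hb : 0 ≤ b) : ∀ (t h : ℕ) (x : Bool)
    (z : Fin n), ∑ r, weightSum n a b α t h x (fun s => if z ∈ verts t s r then 1 else 0)
      ≤ geomSum ((a + b) / 2) h
  | t, 0, x, z => by simp [weightSum_zero_fuel, geomSum]
  | 0, h + 1, x, z => by
    simp only [weightSum_zero, verts, Finset.mem_singleton]
    rw [Finset.sum_comm]
    simp only [mul_ite, mul_one, mul_zero, Finset.sum_ite_eq, Finset.mem_univ, if_true]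
    rw [sum_noiseProb, geomSum_succ]
    have := geomSum_nonneg (d := (a + b) / 2) (by positivity) h
    nlinarith
  | t + 1, h + 1, x, z => by
    have hn' : (0 : ℝ) < n := by exact_mod_cast hn
    have key : ∀ r, weightSum n a b α (t + 1) (h + 1) x
        (fun s => if z ∈ verts (t + 1) s r then 1 else 0)
        ≤ (if z = r then 1 else 0) + (a + b) / 2 / n * geomSum ((a + b) / 2) h := by
      intro r
      refine weightSum_succ_le t h x _ _ fun y => ?_
      calc _ ≤ childSum n a b α t h x (fun c => (if z = r then 1 else 0) +
            ∑ v, (c v).elim 0 fun s => if z ∈ verts t s v then 1 else 0) := by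
            refine childSum_mono ha hb fun c => ?_
            have h0 : ∀ v, (0 : ℝ) ≤ (c v).elim 0 fun s => if z ∈ verts t s v then 1 else 0 := by
              intro v
              cases c v with
              | none => exact le_rfl
              | some s => simp only [Option.elim]; split_ifs <;> norm_num
            have h1 := Finset.sum_nonneg fun v (_ : v ∈ Finset.univ) => h0 v
            by_cases hz : z = r
            · rw [if_pos hz]
              split_ifs <;> linarith
            · rw [if_neg hz]
              split_ifs with hm
              · obtain hm | ⟨v, s, hs, hm⟩ := mem_verts_succ.mp hm
                · exact absurd hm hz
                · have h2 := Finset.single_le_sum (fun v _ => h0 v) (Finset.mem_univ v)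
                  have hs' : c v = some s := hs
                  rw [hs'] at h2
                  simp only [Option.elim, if_pos hm] at h2
                  rw [zero_add]
                  exact h2
              · linarith
        _ ≤ _ := by
            rw [childSum_add]
            refine add_le_add ?_ (childSum_visits_le hn ha hb t h x z _
              fun y => weightSum_visits_le hn ha hb t h y z)
            split_ifs
            · exact childSum_one_le hn ha hb t h x
            · simp [childSum]
    calc _ ≤ ∑ r, ((if z = r then 1 else 0) + (a + b) / 2 / n * geomSum ((a + b) / 2) h) :=
          Finset.sum_le_sum fun r _ => key r
      _ = _ := by
          rw [Finset.sum_add_distrib, Finset.sum_const, Finset.card_univ, Fintype.card_fin,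
            geomSum_succ, nsmul_eq_mul]
          simp only [Finset.sum_ite_eq, Finset.mem_univ, if_true]
          field_simp

lemma weightSum_card_verts_le (hn : 0 < n) (ha : 0 ≤ a) (hb : 0 ≤ b) : ∀ (t h : ℕ) (x : Bool)
    (r : Fin n), weightSum n a b α t h x (fun s => ((verts t s r).card : ℝ))
      ≤ geomSum ((a + b) / 2) h
  | t, 0, x, r => by simp [weightSum_zero_fuel, geomSum]
  | 0, h + 1, x, r => by
    simp only [weightSum_zero, verts, Finset.card_singleton, Nat.cast_one, mul_one]
    rw [sum_noiseProb, geomSum_succ]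
    have := geomSum_nonneg (d := (a + b) / 2) (by positivity) h
    nlinarith
  | t + 1, h + 1, x, r => by
    have hn' : (0 : ℝ) < n := by exact_mod_cast hn
    refine weightSum_succ_le t h x _ _ fun y => ?_
    calc _ ≤ childSum n a b α t h x (fun c => 1 +
          ∑ v, (c v).elim 0 fun s => ((verts t s v).card : ℝ)) := by
          refine childSum_mono ha hb fun c => ?_
          have h1 : (verts (t + 1) (((x, y), c) : LNamedTree n (t + 1)) r).card
              ≤ 1 + ∑ v, (c v).elim 0 fun s => (verts t s v).card := by
            refine (Finset.card_insert_le _ _).trans ?_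
            rw [add_comm]
            refine Nat.add_le_add_left (Finset.card_biUnion_le.trans
              (Finset.sum_le_sum fun v _ => ?_)) _
            change (Option.elim (c v) (∅ : Finset (Fin n)) fun s => verts t s v).card ≤ _
            cases c v <;> simp
          have h2 : ((1 + ∑ v, (c v).elim 0 fun s => (verts t s v).card : ℕ) : ℝ)
              = 1 + ∑ v, (c v).elim 0 fun s => ((verts t s v).card : ℝ) := by
            push_cast
            congr 1
            refine Finset.sum_congr rfl fun v _ => ?_
            cases c v <;> simp
          rw [← h2]
          exact_mod_cast h1
      _ ≤ 1 + ∑ _v : Fin n, (a + b) / 2 / n * geomSum ((a + b) / 2) h := by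
          rw [childSum_add, childSum_finsetSum]
          refine add_le_add (childSum_one_le hn ha hb t h x) (Finset.sum_le_sum fun v _ => ?_)
          refine (childSum_first_le hn ha hb t h x v _ fun s => Nat.cast_nonneg _).trans ?_
          exact sum_childWeight_mul_le ha hb t h x _ _
            fun y => weightSum_card_verts_le hn ha hb t h y v
      _ = _ := by
          rw [Finset.sum_const, Finset.card_univ, Fintype.card_fin, geomSum_succ, nsmul_eq_mul]
          field_simp

/-! ### Coincidences between names -/

lemma elim_indicator_nonneg {X : Type} (o : Option X) (p : X → Prop) [DecidablePred p] :
    (0 : ℝ) ≤ o.elim 0 fun s => if p s then 1 else 0 := by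
  cases o with
  | none => exact le_rfl
  | some s => simp only [Option.elim]; split_ifs <;> norm_num

/-- Union bound: names repeat because they repeat inside one child subtree, because such a subtree
contains the root name, or because two child subtrees share some name `z`. -/
lemma not_distinct_succ_le (t : ℕ) (i : Bool × Bool) (c : Fin n → Option (LNamedTree n t))
    (r : Fin n) :
    (if ¬ Distinct (t + 1) ((i, c) : LNamedTree n (t + 1)) r then (1 : ℝ) else 0)
      ≤ (∑ v, (c v).elim 0 fun s => if ¬ Distinct t s v then 1 else 0)
        + (∑ v, (c v).elim 0 fun s => if r ∈ verts t s v then 1 else 0)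
        + ∑ z, ∑ v, ∑ v', if v ≠ v' then ((c v).elim 0 fun s => if z ∈ verts t s v then 1 else 0)
            * ((c v').elim 0 fun s => if z ∈ verts t s v' then 1 else 0) else 0 := by
  set A := ∑ v, (c v).elim (0 : ℝ) fun s => if ¬ Distinct t s v then 1 else 0
  set B := ∑ v, (c v).elim (0 : ℝ) fun s => if r ∈ verts t s v then 1 else 0
  set f : Fin n → Fin n → Fin n → ℝ := fun z v v' => if v ≠ v' then
    ((c v).elim 0 fun s => if z ∈ verts t s v then 1 else 0)
            * ((c v').elim 0 fun s => if z ∈ verts t s v' then 1 else 0) else 0 with hf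
  have hA0 : ∀ v, (0 : ℝ) ≤ (c v).elim (0 : ℝ) fun s => if ¬ Distinct t s v then 1 else 0 :=
    fun v => elim_indicator_nonneg _ _
  have hB0 : ∀ v, (0 : ℝ) ≤ (c v).elim (0 : ℝ) fun s => if r ∈ verts t s v then 1 else 0 :=
    fun v => elim_indicator_nonneg _ _
  have hf0 : ∀ z v v', 0 ≤ f z v v' := by
    intro z v v'
    simp only [hf]
    split_ifs
    · exact mul_nonneg (elim_indicator_nonneg _ _) (elim_indicator_nonneg _ _)
    · exact le_rfl
  have hA : 0 ≤ A := Finset.sum_nonneg fun v _ => hA0 v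
  have hB : 0 ≤ B := Finset.sum_nonneg fun v _ => hB0 v
  have hC1 : ∀ z v, 0 ≤ ∑ v', f z v v' := fun z v => Finset.sum_nonneg fun v' _ => hf0 z v v'
  have hC2 : ∀ z, 0 ≤ ∑ v, ∑ v', f z v v' := fun z => Finset.sum_nonneg fun v _ => hC1 z v
  have hC : 0 ≤ ∑ z, ∑ v, ∑ v', f z v v' := Finset.sum_nonneg fun z _ => hC2 z
  change _ ≤ A + B + ∑ z, ∑ v, ∑ v', f z v v'
  by_cases hD : Distinct (t + 1) ((i, c) : LNamedTree n (t + 1)) r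
  · rw [if_neg (not_not_intro hD)]
    positivity
  · rw [if_pos hD]
    have hD' : ¬ ((∀ v s, c v = some s → Distinct t s v ∧ r ∉ verts t s v) ∧
      ∀ v v' s s', v ≠ v' → c v = some s → c v' = some s' →
        Disjoint (verts t s v) (verts t s' v')) := hD
    rw [not_and_or] at hD'
    rcases hD' with h1 | h1
    · push Not at h1
      obtain ⟨v, s, hs, h1⟩ := h1
      by_cases h2 : Distinct t s v
      · have h3 := Finset.single_le_sum (fun v _ => hB0 v) (Finset.mem_univ v)
        rw [hs] at h3
        simp only [Option.elim, if_pos (h1 h2)] at h3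
        change 1 ≤ B at h3
        linarith
      · have h3 := Finset.single_le_sum (fun v _ => hA0 v) (Finset.mem_univ v)
        rw [hs] at h3
        simp only [Option.elim, if_pos h2] at h3
        change 1 ≤ A at h3
        linarith
    · push Not at h1
      obtain ⟨v, v', s, s', hv, hs, hs', h1⟩ := h1
      obtain ⟨z, hz, hz'⟩ := Finset.not_disjoint_iff.mp h1
      have h2 : f z v v' = 1 := by simp [hf, hv, hs, hs', hz, hz']
      have h3 := Finset.single_le_sum (fun v' _ => hf0 z v v') (Finset.mem_univ v')
      have h4 := Finset.single_le_sum (fun v _ => hC1 z v) (Finset.mem_univ v)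
      have h5 := Finset.single_le_sum (fun z _ => hC2 z) (Finset.mem_univ z)
      linarith

/-- A single vertex creates a new coincidence with weight at most `κ`: one term for hitting its own
name, one for two of its subtrees meeting. The expected number of vertices is at most `geomSum d h`.
Keeping `H` fixed makes `κ` the same at all levels of the induction. -/
lemma weightSum_not_distinct_le (hn : 0 < n) (ha : 0 ≤ a) (hb : 0 ≤ b) (H : ℕ) (κ : ℝ)
    (hκ : (a + b) / 2 / n * geomSum ((a + b) / 2) H
      + n * ((a + b) / 2 / n * geomSum ((a + b) / 2) H) ^ 2 ≤ κ) :
    ∀ (t h : ℕ) (x : Bool) (r : Fin n), h ≤ H →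
      weightSum n a b α t h x (fun s => if ¬ Distinct t s r then 1 else 0)
      ≤ geomSum ((a + b) / 2) h * κ
  | t, 0, x, r, _ => by simp [weightSum_zero_fuel, geomSum]
  | 0, h + 1, x, r, _ => by
    have hn' : (0 : ℝ) < n := by exact_mod_cast hn
    have hY := geomSum_nonneg (d := (a + b) / 2) (by positivity) H
    have hκ0 : 0 ≤ κ := le_trans (by positivity) hκ
    simp only [weightSum_zero, Distinct, not_true_eq_false, if_false, mul_zero,
      Finset.sum_const_zero]
    exact mul_nonneg (geomSum_nonneg (by positivity) _) hκ0
  | t + 1, h + 1, x, r, hH => by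
    have hn' : (0 : ℝ) < n := by exact_mod_cast hn
    have hd : 0 ≤ (a + b) / 2 := by positivity
    have hY := geomSum_nonneg hd H
    set Y := geomSum ((a + b) / 2) H with hYdef
    have hvis : ∀ y z, ∑ r, weightSum n a b α t h y (fun s => if z ∈ verts t s r then 1 else 0)
        ≤ Y := fun y z =>
      (weightSum_visits_le hn ha hb t h y z).trans (geomSum_mono hd (by omega))
    have h0 := childWeight_nonneg (n := n) (α := α) ha hb t h x
    refine weightSum_succ_le t h x _ _ fun y => ?_
    refine le_trans (childSum_mono ha hb fun c => not_distinct_succ_le t (x, y) c r) ?_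
    rw [childSum_add, childSum_add]
    have h1 : childSum n a b α t h x (fun c => ∑ v, (c v).elim 0
        fun s => if ¬ Distinct t s v then 1 else 0)
        ≤ (a + b) / 2 * (geomSum ((a + b) / 2) h * κ) := by
      rw [childSum_finsetSum]
      calc _ ≤ ∑ _v : Fin n, (a + b) / 2 / n * (geomSum ((a + b) / 2) h * κ) := by
            refine Finset.sum_le_sum fun v _ => ?_
            refine (childSum_first_le hn ha hb t h x v _
              fun s => by split_ifs <;> norm_num).trans ?_
            exact sum_childWeight_mul_le ha hb t h x _ _
              fun y => weightSum_not_distinct_le hn ha hb H κ hκ t h y v (by omega)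
        _ = _ := by
            rw [Finset.sum_const, Finset.card_univ, Fintype.card_fin, nsmul_eq_mul]
            field_simp
    have h2 := childSum_visits_le (α := α) hn ha hb t h x r Y fun y => hvis y r
    have h3 : childSum n a b α t h x (fun c => ∑ z, ∑ v, ∑ v', if v ≠ v' then
        ((c v).elim 0 fun s => if z ∈ verts t s v then 1 else 0)
            * ((c v').elim 0 fun s => if z ∈ verts t s v' then 1 else 0) else 0)
        ≤ n * ((a + b) / 2 / n * Y) ^ 2 := by
      rw [childSum_finsetSum]
      calc _ ≤ ∑ _z : Fin n, ((a + b) / 2 / n * Y) ^ 2 := by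
            refine Finset.sum_le_sum fun z _ => ?_
            have hψ := sum_child_visits_le (α := α) ha hb t h x z Y fun y => hvis y z
            set F : Fin n → ℝ :=
              fun v => ∑ s, childWeight n a b α t h x s * (if z ∈ verts t s v then 1 else 0)
              with hF
            have hF0 : ∀ v, 0 ≤ F v := fun v => Finset.sum_nonneg fun s _ =>
              mul_nonneg (h0 s) (by split_ifs <;> norm_num)
            rw [childSum_finsetSum]
            -- Distinct children are independent, so their joint visits to `z` cost a product. The
            -- diagonal, absent on the left, is added to complete a square.
            calc _ ≤ ∑ v, ∑ v', F v * F v' := by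
                  refine Finset.sum_le_sum fun v _ => ?_
                  rw [childSum_finsetSum]
                  refine Finset.sum_le_sum fun v' _ => ?_
                  by_cases hv : v = v'
                  · simp only [hv, ne_eq, not_true_eq_false, if_false]
                    simp only [childSum, mul_zero, Finset.sum_const_zero]
                    exact mul_nonneg (hF0 _) (hF0 _)
                  · simp only [ne_eq, hv, not_false_eq_true, if_true]
                    exact childSum_second_le hn ha hb t h x hv _ _
                      (fun s => by split_ifs <;> norm_num) (fun s => by split_ifs <;> norm_num)
              _ = (∑ v, F v) ^ 2 := by rw [sq, Finset.sum_mul_sum]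
              _ ≤ _ := pow_le_pow_left₀ (Finset.sum_nonneg fun v _ => hF0 v) hψ 2
        _ = _ := by
            rw [Finset.sum_const, Finset.card_univ, Fintype.card_fin, nsmul_eq_mul]
    rw [geomSum_succ]
    linarith

/-! ### Lower bounds for the total mass -/

lemma one_add_pow_ge {y : ℝ} (hy : 0 ≤ y) :
    Real.exp (n * (y - y ^ 2 / 2)) ≤ (1 + y) ^ n := by
  have h1 : Real.exp (y - y ^ 2 / 2) ≤ 1 + y := by
    rw [← Real.le_log_iff_exp_le (by linarith)]
    refine le_trans ?_ (Real.le_log_one_add_of_nonneg hy)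
    rw [le_div_iff₀ (by linarith)]
    nlinarith [pow_nonneg hy 3]
  rw [Real.exp_nat_mul]
  exact pow_le_pow_left₀ (Real.exp_pos _).le h1 n

/-- With d = (a+b)/2, the mass is at least e^{-d}(1 + d(1-u)/n)^n. The exponent d·u is what the
exact Poisson recursion gives for the defect `u`; d²/(2n) is the price of having binomial instead of
Poisson offspring. -/
lemma mass_succ_ge (hn : 0 < n) (ha : 0 ≤ a) (hb : 0 ≤ b) {t h : ℕ} {u : ℝ} (hu0 : 0 ≤ u)
    (hu1 : u ≤ 1) (hu : ∀ y, 1 - u ≤ weightSum n a b α t h y fun _ => 1) (x : Bool) :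
    Real.exp (-((a + b) / 2 * u + ((a + b) / 2) ^ 2 / (2 * n)))
      ≤ weightSum n a b α (t + 1) (h + 1) x fun _ => 1 := by
  have hn' : (0 : ℝ) < n := by exact_mod_cast hn
  set d := (a + b) / 2 with hd
  have hd0 : 0 ≤ d := by positivity
  have hq : d * (1 - u) / n ≤ ∑ s, childWeight n a b α t h x s := by
    have h1 := sum_childWeight_mul (n := n) (a := a) (b := b) (α := α) t h x fun _ => 1
    simp only [mul_one] at h1
    rw [h1]
    have h2 := sum_edgeProb_half n a b x
    calc d * (1 - u) / n = ∑ y, edgeProb n a b x y / 2 * (1 - u) := by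
          rw [← Finset.sum_mul, h2]; ring
      _ ≤ _ := Finset.sum_le_sum fun y _ => mul_le_mul_of_nonneg_left (hu y)
          (div_nonneg (edgeProb_nonneg n ha hb _ _) zero_le_two)
  have hy0 : 0 ≤ d * (1 - u) / n := by
    have : 0 ≤ 1 - u := by linarith
    positivity
  rw [weightSum_succ]
  simp only [mul_one]
  rw [sum_pi_option_elim, Finset.prod_const, Finset.card_univ, Fintype.card_fin,
    ← Finset.sum_mul, sum_noiseProb, one_mul]
  calc _ ≤ Real.exp (-d) * Real.exp (n * (d * (1 - u) / n - (d * (1 - u) / n) ^ 2 / 2)) := by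
        rw [← Real.exp_add, Real.exp_le_exp]
        have h1 : (n : ℝ) * (d * (1 - u) / n - (d * (1 - u) / n) ^ 2 / 2)
            = d * (1 - u) - d ^ 2 * (1 - u) ^ 2 / (2 * n) := by field_simp
        rw [h1]
        have h2 : d ^ 2 * (1 - u) ^ 2 / (2 * n) ≤ d ^ 2 / (2 * n) := by
          refine div_le_div_of_nonneg_right ?_ (by positivity)
          have : (1 - u) ^ 2 ≤ 1 := by nlinarith
          nlinarith [sq_nonneg d]
        linarith
    _ ≤ Real.exp (-d) * (1 + d * (1 - u) / n) ^ n :=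
        mul_le_mul_of_nonneg_left (one_add_pow_ge hy0) (Real.exp_pos _).le
    _ ≤ _ := mul_le_mul_of_nonneg_left (pow_le_pow_left₀ (by linarith) (by linarith) n)
        (Real.exp_pos _).le

/-- Without truncation, hardly any mass is lost. -/
lemma mass_ge_of_lt (hn : 0 < n) (ha : 0 ≤ a) (hb : 0 ≤ b) : ∀ (t h : ℕ) (x : Bool), t < h →
    1 - ((a + b) / 2) ^ 2 / (2 * n) * geomSum ((a + b) / 2) h
      ≤ weightSum n a b α t h x fun _ => 1
  | t, 0, x, hh => by omega
  | 0, h + 1, x, _ => by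
    have hn' : (0 : ℝ) < n := by exact_mod_cast hn
    have := geomSum_nonneg (d := (a + b) / 2) (by positivity) (h + 1)
    rw [weightSum_zero]
    simp only [mul_one]
    rw [sum_noiseProb]
    have : 0 ≤ ((a + b) / 2) ^ 2 / (2 * n) * geomSum ((a + b) / 2) (h + 1) := by positivity
    linarith
  | t + 1, h + 1, x, hh => by
    have hn' : (0 : ℝ) < n := by exact_mod_cast hn
    have hd : 0 ≤ (a + b) / 2 := by positivity
    have hY := geomSum_nonneg hd h
    have h0 : ∀ y, 0 ≤ weightSum n a b α t h y fun _ => 1 :=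
      fun y => weightSum_nonneg ha hb fun _ => zero_le_one
    set κ := ((a + b) / 2) ^ 2 / (2 * n) with hκ
    have hκ0 : 0 ≤ κ := by positivity
    -- The defect is capped at 1, as `mass_succ_ge` requires. When the cap is active the claim is
    -- only that the mass is nonnegative.
    have hu : ∀ y, 1 - min 1 (κ * geomSum ((a + b) / 2) h)
        ≤ weightSum n a b α t h y fun _ => 1 := by
      intro y
      have := mass_ge_of_lt hn ha hb t h y (by omega)
      rcases min_choice 1 (κ * geomSum ((a + b) / 2) h) with h1 | h1 <;> rw [h1]
      · linarith [h0 y]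
      · exact this
    refine le_trans ?_ (mass_succ_ge hn ha hb (by positivity) (min_le_left _ _) hu x)
    rw [geomSum_succ]
    refine le_trans ?_ (Real.add_one_le_exp _)
    have h2 := min_le_right 1 (κ * geomSum ((a + b) / 2) h)
    have h3 := mul_le_mul_of_nonneg_left h2 hd
    rw [← hκ]
    nlinarith

lemma one_sub_exp_neg_le {y : ℝ} (hy : y ≤ 2) : 1 - Real.exp (-y) ≤ y - y ^ 2 / 4 := by
  have h1 : 1 - y / 2 ≤ Real.exp (-(y / 2)) := by linarith [Real.add_one_le_exp (-(y / 2))]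
  have h2 : Real.exp (-y) = Real.exp (-(y / 2)) ^ 2 := by
    rw [← Real.exp_nat_mul]; congr 1; push_cast; ring
  have h3 := pow_le_pow_left₀ (by linarith) h1 2
  rw [h2]
  nlinarith

/-- In a nearly critical tree few trees have many levels. -/
lemma mass_ge_of_near_critical (hn : 0 < n) (ha : 0 ≤ a) (hb : 0 ≤ b) {δ η : ℝ} (hδ : 0 < δ)
    (hδ1 : δ ≤ 1) (hη : η ≤ δ ^ 2 / 16) (hd : (a + b) / 2 ≤ 1 + η)
    (hκ : ((a + b) / 2) ^ 2 / (2 * n) ≤ η) : ∀ (t h : ℕ) (x : Bool),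
    1 - max δ (1 - h * (δ ^ 2 / 8)) ≤ weightSum n a b α t h x fun _ => 1
  | t, 0, x => by
    rw [weightSum_zero_fuel]
    simp [hδ1]
  | 0, h + 1, x => by
    rw [weightSum_zero]
    simp only [mul_one]
    rw [sum_noiseProb]
    linarith [le_max_left δ (1 - ((h + 1 : ℕ) : ℝ) * (δ ^ 2 / 8))]
  | t + 1, h + 1, x => by
    have hn' : (0 : ℝ) < n := by exact_mod_cast hn
    have hκ0 : 0 ≤ ((a + b) / 2) ^ 2 / (2 * n) := by positivity
    have hη0 : 0 ≤ η := hκ0.trans hκ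
    set u := max δ (1 - h * (δ ^ 2 / 8)) with hu
    have hu0 : δ ≤ u := le_max_left _ _
    have hu1 : u ≤ 1 := by
      refine max_le hδ1 ?_
      have : (0 : ℝ) ≤ h * (δ ^ 2 / 8) := by positivity
      linarith
    refine le_trans ?_ (mass_succ_ge hn ha hb (by linarith) hu1
      (fun y => mass_ge_of_near_critical hn ha hb hδ hδ1 hη hd hκ t h y) x)
    -- An upper bound for the exponent in `mass_succ_ge`, so that the new defect is at most 1 -
    -- e^{-y}.
    set y := (1 + η) * u + η with hy
    have h1 : Real.exp (-y) ≤ Real.exp (-((a + b) / 2 * u + ((a + b) / 2) ^ 2 / (2 * n))) := by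
      rw [Real.exp_le_exp]
      have := mul_le_mul_of_nonneg_right hd (by linarith : 0 ≤ u)
      linarith
    have hη1 : η ≤ 1 / 16 := by nlinarith
    have hyu : u ≤ y := by nlinarith
    have hyu' : y ≤ u + 2 * η := by nlinarith
    -- While the defect is at least δ, the quadratic gain y²/4 ≥ δ²/4 beats the drift y - u ≤ 2η ≤
    -- δ²/8. The defect therefore decreases by at least δ²/8 per level until it reaches δ.
    have h2 := one_sub_exp_neg_le (y := y) (by linarith)
    have h3 : δ ^ 2 ≤ y ^ 2 := pow_le_pow_left₀ hδ.le (by linarith) 2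
    have h4 : u - δ ^ 2 / 8 ≤ max δ (1 - ((h + 1 : ℕ) : ℝ) * (δ ^ 2 / 8)) := by
      have h5 : u - δ ^ 2 / 8 = max (δ - δ ^ 2 / 8) (1 - h * (δ ^ 2 / 8) - δ ^ 2 / 8) := by
        rw [hu, max_sub_sub_right]
      rw [h5]
      refine max_le_max (by nlinarith) ?_
      push_cast
      linarith
    linarith

/-- Total weight of the trees with distinct names and at most `K` vertices. -/
lemma weightSum_good_ge (hn : 0 < n) (ha : 0 ≤ a) (hb : 0 ≤ b) (t h K : ℕ) (hK : 0 < K)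
    (x : Bool) (r : Fin n) :
    (weightSum n a b α t h x fun _ => 1)
      - geomSum ((a + b) / 2) h * ((a + b) / 2 / n * geomSum ((a + b) / 2) h
          + n * ((a + b) / 2 / n * geomSum ((a + b) / 2) h) ^ 2)
      - geomSum ((a + b) / 2) h / K
      ≤ weightSum n a b α t h x
          fun s => if Distinct t s r ∧ (verts t s r).card ≤ K then 1 else 0 := by
  have hK' : (0 : ℝ) < K := by exact_mod_cast hK
  have h1 := weightSum_not_distinct_le (α := α) hn ha hb h _ le_rfl t h x r le_rfl
  have h2 := weightSum_card_verts_le (α := α) hn ha hb t h x r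
  have h3 : (weightSum n a b α t h x fun s => ((verts t s r).card : ℝ) / K)
      = (weightSum n a b α t h x fun s => ((verts t s r).card : ℝ)) / K := by
    simp only [weightSum, Finset.sum_div]
    refine Finset.sum_congr rfl fun s _ => ?_
    split_ifs <;> ring
  have h4 : (weightSum n a b α t h x fun _ => 1) ≤ weightSum n a b α t h x
      (fun s => (if Distinct t s r ∧ (verts t s r).card ≤ K then 1 else 0)
        + ((if ¬ Distinct t s r then 1 else 0) + ((verts t s r).card : ℝ) / K)) := by
    refine weightSum_mono ha hb fun s => ?_
    have h0 : (0 : ℝ) ≤ ((verts t s r).card : ℝ) / K := by positivity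
    by_cases hD : Distinct t s r
    · by_cases hc : (verts t s r).card ≤ K
      · simp only [hD, hc, and_self, if_true, not_true_eq_false, if_false]
        linarith
      · have : (1 : ℝ) ≤ ((verts t s r).card : ℝ) / K := by
          rw [le_div_iff₀ hK']
          have : K ≤ (verts t s r).card := by omega
          rw [one_mul]
          exact_mod_cast this
        simp only [hc, and_false, if_false, hD, not_true_eq_false]
        linarith
    · simp only [hD, false_and, if_false, not_false_eq_true, if_true]
      linarith
  have h5 : ∀ g g' : LNamedTree n t → ℝ, weightSum n a b α t h x (fun s => g s + g' s)
      = weightSum n a b α t h x g + weightSum n a b α t h x g' := by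
    intro g g'
    simp only [weightSum]
    rw [← Finset.sum_add_distrib]
    refine Finset.sum_congr rfl fun s _ => ?_
    split_ifs <;> ring
  rw [h5, h5, h3] at h4
  have h6 := div_le_div_of_nonneg_right h2 hK'.le
  linarith

end Moments

end SideInfo

end

noncomputable section

namespace SideInfo

open NamedTree
open scoped ENNReal

/-! ### Expectations with respect to a `PMF` -/

/-- The expectation of a nonnegative function. -/
def expect {X : Type} (p : PMF X) (Φ : X → ℝ≥0∞) : ℝ≥0∞ := ∑' x, p x * Φ x

section Expect

variable {X Y : Type}

lemma expect_bind (p : PMF X) (f : X → PMF Y) (Φ : Y → ℝ≥0∞) :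
    expect (p.bind f) Φ = expect p fun x => expect (f x) Φ := by
  simp only [expect, PMF.bind_apply, ← ENNReal.tsum_mul_left, ← ENNReal.tsum_mul_right]
  rw [ENNReal.tsum_comm]
  simp only [mul_assoc]

lemma expect_pure (x : X) (Φ : X → ℝ≥0∞) : expect (PMF.pure x) Φ = Φ x := by
  unfold expect
  rw [tsum_eq_single x]
  · simp
  · intro y hy
    simp [hy]

lemma expect_map (p : PMF X) (f : X → Y) (Φ : Y → ℝ≥0∞) :
    expect (p.map f) Φ = expect p fun x => Φ (f x) := by
  rw [← PMF.bind_pure_comp, expect_bind]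
  simp only [Function.comp, expect_pure]

lemma expect_mono (p : PMF X) {Φ Ψ : X → ℝ≥0∞} (h : ∀ x, Φ x ≤ Ψ x) :
    expect p Φ ≤ expect p Ψ :=
  ENNReal.tsum_le_tsum fun x => mul_le_mul_right (h x) _

end Expect

/-! ### Operators that add an element to a multiset -/

section ConsOp

variable {Y : Type}

/-- Adding an element of law `p`. -/
def consOp (p : PMF Y) : Module.End ℝ≥0∞ (Multiset Y → ℝ≥0∞) where
  toFun Ψ m := expect p fun τ => Ψ (τ ::ₘ m)
  map_add' Ψ Ψ' := by
    funext m
    simp only [expect, Pi.add_apply, mul_add]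
    exact ENNReal.tsum_add
  map_smul' r Ψ := by
    funext m
    simp only [expect, Pi.smul_apply, smul_eq_mul, RingHom.id_apply]
    rw [← ENNReal.tsum_mul_left]
    exact tsum_congr fun τ => by ring

lemma consOp_apply (p : PMF Y) (Ψ : Multiset Y → ℝ≥0∞) (m : Multiset Y) :
    consOp p Ψ m = expect p fun τ => Ψ (τ ::ₘ m) := rfl

/-- Multisets forget the order of insertion. Commutation is what makes the binomial theorem
available for offspring of two types. -/
lemma consOp_commute (p q : PMF Y) : Commute (consOp p) (consOp q) := by
  refine LinearMap.ext fun Ψ => ?_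
  funext m
  simp only [Module.End.mul_apply, consOp_apply, expect, ← ENNReal.tsum_mul_left]
  rw [ENNReal.tsum_comm]
  refine tsum_congr fun x => tsum_congr fun y => ?_
  rw [Multiset.cons_swap]
  ring

lemma consOp_pow_apply (p : PMF Y) (Ψ : Multiset Y → ℝ≥0∞) : ∀ (k : ℕ) (m : Multiset Y),
    (consOp p ^ k) Ψ m = expect (iidMultiset p k) fun C => Ψ (C + m)
  | 0, m => by simp [iidMultiset, expect_pure]
  | k + 1, m => by
    rw [pow_succ', Module.End.mul_apply, consOp_apply, iidMultiset, expect_bind]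
    congr 1
    funext τ
    rw [consOp_pow_apply p Ψ k, expect_map]
    congr 1
    funext C
    rw [Multiset.add_cons, Multiset.cons_add]

/-- Adding the image of an element of a finite type, weighted by `w`. -/
def finConsOp {X : Type} [Fintype X] (w : X → ℝ≥0∞) (f : X → Y) :
    Module.End ℝ≥0∞ (Multiset Y → ℝ≥0∞) where
  toFun Ψ m := ∑ s, w s * Ψ (f s ::ₘ m)
  map_add' Ψ Ψ' := by
    funext m
    simp only [Pi.add_apply, mul_add, Finset.sum_add_distrib]
  map_smul' r Ψ := by
    funext m
    simp only [Pi.smul_apply, smul_eq_mul, RingHom.id_apply, Finset.mul_sum]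
    exact Finset.sum_congr rfl fun τ _ => by ring

/-- The multiset of the images of the elements of a family of optional objects. -/
def imageMultiset {ι X : Type} [Fintype ι] (f : X → Y) (c : ι → Option X) : Multiset Y :=
  ∑ v, (c v).elim 0 fun s => {f s}

/-- The names are treated one after the other: each adds nothing (the summand `1`) or one weighted
child. Named offspring thus becomes the power of a single operator. -/
lemma sum_pi_option_image {X : Type} [Fintype X] (w : X → ℝ≥0∞) (f : X → Y)
    (Ψ : Multiset Y → ℝ≥0∞) : ∀ (k : ℕ) (m : Multiset Y),
    ∑ c : Fin k → Option X, (∏ v, (c v).elim 1 w) * Ψ (imageMultiset f c + m)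
      = ((1 + finConsOp w f) ^ k) Ψ m
  | 0, m => by simp [imageMultiset]
  | k + 1, m => by
    rw [← (Fin.consEquiv fun _ => Option X).sum_comp, Fintype.sum_prod_type,
      Fintype.sum_option, pow_succ', Module.End.mul_apply]
    simp only [LinearMap.add_apply, Module.End.one_apply, Pi.add_apply]
    congr 1
    · rw [← sum_pi_option_image w f Ψ k m]
      refine Finset.sum_congr rfl fun c _ => ?_
      simp [Fin.consEquiv, Fin.prod_univ_succ, imageMultiset, Fin.sum_univ_succ]
    · change _ = ∑ s, w s * _
      refine Finset.sum_congr rfl fun s _ => ?_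
      rw [← sum_pi_option_image w f Ψ k _, Finset.mul_sum]
      refine Finset.sum_congr rfl fun c _ => ?_
      simp only [Fin.consEquiv, Fin.prod_univ_succ, imageMultiset, Fin.sum_univ_succ,
        Equiv.coe_fn_mk, Fin.cons_zero, Fin.cons_succ, Option.elim]
      rw [mul_assoc, Multiset.add_cons, Multiset.singleton_add, Multiset.cons_add]

lemma pow_apply_le_pow_apply {A B : Module.End ℝ≥0∞ (Multiset Y → ℝ≥0∞)}
    (hAB : ∀ Ψ, A Ψ ≤ B Ψ) (hB : ∀ Ψ Ψ', Ψ ≤ Ψ' → B Ψ ≤ B Ψ') (Ψ : Multiset Y → ℝ≥0∞) :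
    ∀ k : ℕ, (A ^ k) Ψ ≤ (B ^ k) Ψ
  | 0 => le_rfl
  | k + 1 => by
    rw [pow_succ', pow_succ', Module.End.mul_apply, Module.End.mul_apply]
    exact (hAB _).trans (hB _ _ (pow_apply_le_pow_apply hAB hB Ψ k))

/-! ### Binomial offspring dominated by Poisson offspring -/

lemma choose_mul_choose_mul_le (n i j : ℕ) :
    n.choose (i + j) * (i + j).choose i * (i.factorial * j.factorial) ≤ n ^ (i + j) := by
  have h1 : (i + j).choose i * (i.factorial * j.factorial) = (i + j).factorial := by
    have := Nat.choose_mul_factorial_mul_factorial (Nat.le_add_right i j)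
    rw [Nat.add_sub_cancel_left] at this
    rw [← this, mul_assoc]
  rw [mul_assoc, h1, mul_comm, ← Nat.descFactorial_eq_factorial_mul_choose]
  exact Nat.descFactorial_le_pow n (i + j)

lemma poissonLaw_apply {r : ℝ} (hr : 0 ≤ r) (k : ℕ) :
    poissonLaw r k = ENNReal.ofReal (Real.exp (-r) * r ^ k / k.factorial) := by
  rw [poissonLaw, MeasureTheory.Measure.toPMF_apply,
    ProbabilityTheory.poissonMeasure_singleton, Real.coe_toNNReal r hr]

lemma binomial_coeff_le_poisson {n : ℕ} (hn : 0 < n) {a b : ℝ} (ha : 0 ≤ a) (hb : 0 ≤ b)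
    (i j : ℕ) :
    ENNReal.ofReal (Real.exp (-((a + b) / 2))) * (n.choose (i + j) * ((i + j).choose i *
      (ENNReal.ofReal (a / n / 2) ^ i * ENNReal.ofReal (b / n / 2) ^ j)))
      ≤ poissonLaw (a / 2) i * poissonLaw (b / 2) j := by
  have hn' : (0 : ℝ) < n := by exact_mod_cast hn
  rw [poissonLaw_apply (by positivity), poissonLaw_apply (by positivity),
    ← ENNReal.ofReal_mul (by positivity), ← ENNReal.ofReal_pow (by positivity),
    ← ENNReal.ofReal_pow (by positivity), ← ENNReal.ofReal_mul (by positivity),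
    ← ENNReal.ofReal_natCast, ← ENNReal.ofReal_natCast, ← ENNReal.ofReal_mul (by positivity),
    ← ENNReal.ofReal_mul (by positivity), ← ENNReal.ofReal_mul (by positivity)]
  refine ENNReal.ofReal_le_ofReal ?_
  have h1 : ((n.choose (i + j) * (i + j).choose i * (i.factorial * j.factorial) : ℕ) : ℝ)
      ≤ ((n ^ (i + j) : ℕ) : ℝ) := by exact_mod_cast choose_mul_choose_mul_le n i j
  push_cast at h1
  have hi : (0 : ℝ) < i.factorial := by exact_mod_cast i.factorial_pos
  have hj : (0 : ℝ) < j.factorial := by exact_mod_cast j.factorial_pos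
  have hE : Real.exp (-((a + b) / 2)) = Real.exp (-(a / 2)) * Real.exp (-(b / 2)) := by
    rw [← Real.exp_add]; congr 1; ring
  rw [hE]
  have h2 : Real.exp (-(a / 2)) * Real.exp (-(b / 2)) * ((n.choose (i + j) : ℝ) *
      (((i + j).choose i : ℝ) * ((a / n / 2) ^ i * (b / n / 2) ^ j)))
      = Real.exp (-(a / 2)) * Real.exp (-(b / 2)) * (a / 2) ^ i * (b / 2) ^ j *
        (((n.choose (i + j) : ℝ) * ((i + j).choose i : ℝ)) / (n : ℝ) ^ (i + j)) := by
    rw [div_right_comm a, div_right_comm b, div_pow (a / 2), div_pow (b / 2), pow_add]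
    field_simp
  have h3 : Real.exp (-(a / 2)) * (a / 2) ^ i / i.factorial *
      (Real.exp (-(b / 2)) * (b / 2) ^ j / j.factorial)
      = Real.exp (-(a / 2)) * Real.exp (-(b / 2)) * (a / 2) ^ i * (b / 2) ^ j *
        (1 / ((i.factorial : ℝ) * j.factorial)) := by
    field_simp
  rw [h2, h3]
  refine mul_le_mul_of_nonneg_left ?_ (by positivity)
  rw [div_le_div_iff₀ (by positivity) (by positivity), one_mul]
  exact h1

/-- Binomial numbers of independent children are dominated by Poisson numbers. -/
lemma binomial_le_poisson {n : ℕ} (hn : 0 < n) {a b : ℝ} (ha : 0 ≤ a) (hb : 0 ≤ b)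
    (p q : PMF Y) (Ψ : Multiset Y → ℝ≥0∞) :
    ENNReal.ofReal (Real.exp (-((a + b) / 2))) *
      ((1 + (ENNReal.ofReal (a / n / 2) • consOp p + ENNReal.ofReal (b / n / 2) • consOp q)) ^ n)
        Ψ 0
      ≤ expect (poissonLaw (a / 2)) fun L => expect (poissonLaw (b / 2)) fun M =>
          expect (iidMultiset p L) fun C => expect (iidMultiset q M) fun D => Ψ (C + D) := by
  set T : ℕ × ℕ → ℝ≥0∞ := fun ij => expect (iidMultiset p ij.1) fun C =>
    expect (iidMultiset q ij.2) fun D => Ψ (C + D) with hT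
  set u := ENNReal.ofReal (a / n / 2)
  set w := ENNReal.ofReal (b / n / 2)
  have hcomm : Commute (u • consOp p) (w • consOp q) :=
    ((consOp_commute p q).smul_left u).smul_right w
  have hpow : ∀ i j : ℕ, (((u • consOp p) ^ i * (w • consOp q) ^ j) Ψ) 0
      = u ^ i * w ^ j * T (i, j) := by
    intro i j
    rw [smul_pow, smul_pow, smul_mul_smul_comm, LinearMap.smul_apply, Pi.smul_apply, smul_eq_mul,
      Module.End.mul_apply, consOp_pow_apply]
    congr 2
    funext C
    rw [consOp_pow_apply]
    congr 1
    funext D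
    rw [add_zero, add_comm]
  -- Two binomial expansions: first the number `k` of names in use, then the split of `k` between
  -- the two label types.
  have hexp : ((1 + (u • consOp p + w • consOp q)) ^ n) Ψ 0
      = ∑ k ∈ Finset.range (n + 1), ∑ ij ∈ Finset.HasAntidiagonal.antidiagonal k,
        ((n.choose k : ℝ≥0∞) * ((k.choose ij.1 : ℝ≥0∞) * (u ^ ij.1 * w ^ ij.2))) * T ij := by
    rw [add_comm 1, (Commute.one_right _).add_pow]
    simp only [one_pow, mul_one, LinearMap.coe_sum, Finset.sum_apply]
    refine Finset.sum_congr rfl fun k _ => ?_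
    rw [hcomm.add_pow', ← Nat.cast_commute, ← nsmul_eq_mul, LinearMap.smul_apply,
      Pi.smul_apply, nsmul_eq_mul]
    simp only [LinearMap.coe_sum, Finset.sum_apply]
    rw [Finset.mul_sum]
    refine Finset.sum_congr rfl fun ij _ => ?_
    rw [LinearMap.smul_apply, Pi.smul_apply, nsmul_eq_mul, hpow]
    ring
  rw [hexp, Finset.mul_sum]
  calc _ ≤ ∑ k ∈ Finset.range (n + 1), ∑ ij ∈ Finset.HasAntidiagonal.antidiagonal k,
        poissonLaw (a / 2) ij.1 * poissonLaw (b / 2) ij.2 * T ij := by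
        refine Finset.sum_le_sum fun k _ => ?_
        rw [Finset.mul_sum]
        refine Finset.sum_le_sum fun ij hij => ?_
        rw [← mul_assoc]
        refine mul_le_mul_left ?_ _
        obtain ⟨i, j⟩ := ij
        rw [Finset.HasAntidiagonal.mem_antidiagonal] at hij
        subst hij
        exact binomial_coeff_le_poisson hn ha hb i j
    _ ≤ ∑' k, ∑ ij ∈ Finset.HasAntidiagonal.antidiagonal k,
        poissonLaw (a / 2) ij.1 * poissonLaw (b / 2) ij.2 * T ij := ENNReal.sum_le_tsum _
    _ = ∑' ij : ℕ × ℕ, poissonLaw (a / 2) ij.1 * poissonLaw (b / 2) ij.2 * T ij := by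
        rw [← Finset.HasAntidiagonal.sigmaAntidiagonalEquivProd.tsum_eq, ENNReal.tsum_sigma']
        refine tsum_congr fun k => ?_
        rw [tsum_fintype, Finset.univ_eq_attach]
        exact (Finset.sum_attach (Finset.HasAntidiagonal.antidiagonal k) fun ij =>
          poissonLaw (a / 2) ij.1 * poissonLaw (b / 2) ij.2 * T ij).symm
    _ = _ := by
        rw [ENNReal.tsum_prod']
        simp only [expect, hT, ← ENNReal.tsum_mul_left, mul_assoc]

end ConsOp

/-! ### Forgetting the names -/

/-- The labelled tree without names. -/
def forgetNames {n : ℕ} : (t : ℕ) → LNamedTree n t → LabelledTree t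
  | 0, x => x
  | t + 1, x => (x.1, imageMultiset (forgetNames t) x.2)

lemma noiseLaw_apply (α : unitInterval) (x y : Bool) :
    noiseLaw α x y = ENNReal.ofReal (noiseProb α x y) := rfl

/-- The weight of named trees is dominated by the law of the tree. -/
lemma weight_le_treeLaw {n : ℕ} (hn : 0 < n) {a b : ℝ} (ha : 0 ≤ a) (hb : 0 ≤ b)
    (α : unitInterval) : ∀ (t h : ℕ) (x : Bool) (Φ : LabelledTree t → ℝ≥0∞),
    ∑ s, (if rootLabel t s = x then
        ENNReal.ofReal (treeWeight n a b α t h s) * Φ (forgetNames t s) else 0)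
      ≤ expect (treeLaw a b α t x) Φ
  | t, 0, x, Φ => by simp [treeWeight_zero_fuel]
  | 0, h + 1, x, Φ => by
    have h1 := Fintype.sum_prod_type (f := fun s : Bool × Bool =>
      if rootLabel (n := n) 0 s = x then
        ENNReal.ofReal (treeWeight n a b α 0 (h + 1) s) * Φ (forgetNames (n := n) 0 s) else 0)
    refine (h1.trans ?_).le
    have h2 := expect_map (noiseLaw α x) (fun y => ((x, y) : Bool × Bool)) Φ
    rw [expect, tsum_fintype] at h2
    rw [Finset.sum_comm]
    refine Eq.trans ?_ h2.symm
    refine Finset.sum_congr rfl fun y _ => ?_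
    exact (Finset.sum_ite_eq' Finset.univ x
      fun z => ENNReal.ofReal (noiseProb α z y) * Φ (z, y)).trans
      (if_pos (Finset.mem_univ _))
  | t + 1, h + 1, x, Φ => by
    have hφ : ∀ s, 0 ≤ childWeight n a b α t h x s := childWeight_nonneg ha hb t h x
    have h1 : ∑ s, (if rootLabel (t + 1) s = x then
        ENNReal.ofReal (treeWeight n a b α (t + 1) (h + 1) s) * Φ (forgetNames (t + 1) s) else 0)
        = ∑ y, ENNReal.ofReal (noiseProb α x y) * (ENNReal.ofReal (Real.exp (-((a + b) / 2))) *
          ((1 + finConsOp (fun s => ENNReal.ofReal (childWeight n a b α t h x s))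
            (forgetNames t)) ^ n) (fun m => Φ ((x, y), m)) 0) := by
      refine (Fintype.sum_prod_type (f := fun s : (Bool × Bool) × (Fin n → Option
        (LNamedTree n t)) => if rootLabel (t + 1) s = x then
        ENNReal.ofReal (treeWeight n a b α (t + 1) (h + 1) s) * Φ (forgetNames (t + 1) s)
        else 0)).trans ?_
      rw [Fintype.sum_prod_type, Finset.sum_comm]
      refine Finset.sum_congr rfl fun y _ => ?_
      rw [Finset.sum_comm, ← sum_pi_option_image, Finset.mul_sum, Finset.mul_sum]
      refine Finset.sum_congr rfl fun c _ => ?_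
      refine (Finset.sum_ite_eq' Finset.univ x fun z =>
        ENNReal.ofReal (treeWeight n a b α (t + 1) (h + 1) ((z, y), c)) *
          Φ (forgetNames (t + 1) ((z, y), c))).trans
        ((if_pos (Finset.mem_univ _)).trans ?_)
      have h2 : ENNReal.ofReal (treeWeight n a b α (t + 1) (h + 1) ((x, y), c))
          = ENNReal.ofReal (noiseProb α x y) * (ENNReal.ofReal (Real.exp (-((a + b) / 2))) *
            ∏ v, (c v).elim 1 fun s => ENNReal.ofReal (childWeight n a b α t h x s)) := by
        change ENNReal.ofReal (noiseProb α x y * Real.exp (-((a + b) / 2)) *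
          ∏ v, (c v).elim 1 (childWeight n a b α t h x)) = _
        have h3 : ∀ v, 0 ≤ (c v).elim 1 (childWeight n a b α t h x) := by
          intro v
          cases c v with
          | none => exact zero_le_one
          | some s => exact hφ s
        rw [ENNReal.ofReal_mul (mul_nonneg (noiseProb_nonneg _ _ _) (Real.exp_pos _).le),
          ENNReal.ofReal_mul (noiseProb_nonneg _ _ _), mul_assoc,
          ENNReal.ofReal_prod_of_nonneg fun v _ => h3 v]
        congr 2
        refine Finset.prod_congr rfl fun v _ => ?_
        cases c v <;> simp
      rw [h2, add_zero, mul_assoc, mul_assoc]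
      rfl
    rw [h1, treeLaw, expect_bind]
    conv_rhs => rw [expect, tsum_fintype]
    refine Finset.sum_le_sum fun y _ => ?_
    rw [noiseLaw_apply]
    refine mul_le_mul_right ?_ _
    have hR : ∀ Φ : (Bool × Bool) × Multiset (LabelledTree t) → ℝ≥0∞, (expect (poissonLaw (a / 2)) fun L => expect (poissonLaw (b / 2)) fun M =>
          expect (iidMultiset (treeLaw a b α t x) L) fun C =>
            expect (iidMultiset (treeLaw a b α t (!x)) M) fun D => Φ ((x, y), C + D))
        = expect ((poissonLaw (a / 2)).bind fun L => (poissonLaw (b / 2)).bind fun M =>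
            (iidMultiset (treeLaw a b α t x) L).bind fun C =>
            (iidMultiset (treeLaw a b α t (!x)) M).map fun D =>
              (((x, y), C + D) : (Bool × Bool) × Multiset (LabelledTree t))) Φ := by
      intro Φ
      simp only [expect_bind, expect_map]
    refine le_trans ?_ ((binomial_le_poisson hn ha hb (treeLaw a b α t x)
      (treeLaw a b α t (!x)) fun m => Φ ((x, y), m)).trans (hR Φ).le)
    refine mul_le_mul_right ?_ _
    -- It suffices to compare the operators of one name. A child with a given label is dominated by
    -- the tree law of that label, by induction; monotonicity of the larger operator carries this to
    -- the `n`-th power.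
    refine pow_apply_le_pow_apply ?_ ?_ _ n 0
    · intro Ψ m
      simp only [LinearMap.add_apply, Pi.add_apply, LinearMap.smul_apply, Pi.smul_apply,
        smul_eq_mul, Module.End.one_apply, consOp_apply]
      refine add_le_add_right ?_ _
      have h4 : ∀ y', ∑ s, (if rootLabel t s = y' then
          ENNReal.ofReal (treeWeight n a b α t h s) * Ψ (forgetNames t s ::ₘ m) else 0)
          ≤ expect (treeLaw a b α t y') fun τ => Ψ (τ ::ₘ m) :=
        fun y' => weight_le_treeLaw hn ha hb α t h y' fun τ => Ψ (τ ::ₘ m)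
      have h5 : finConsOp (fun s => ENNReal.ofReal (childWeight n a b α t h x s))
          (forgetNames t) Ψ m = ∑ y', ENNReal.ofReal (edgeProb n a b x y' / 2) *
            ∑ s, (if rootLabel t s = y' then
              ENNReal.ofReal (treeWeight n a b α t h s) * Ψ (forgetNames t s ::ₘ m) else 0) := by
        change ∑ s, ENNReal.ofReal (childWeight n a b α t h x s) * _ = _
        simp only [Finset.mul_sum]
        rw [Finset.sum_comm]
        refine Finset.sum_congr rfl fun s _ => ?_
        simp only [mul_ite, mul_zero]
        rw [Finset.sum_ite_eq, if_pos (Finset.mem_univ _), childWeight,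
          ENNReal.ofReal_mul (div_nonneg (edgeProb_nonneg n ha hb _ _) zero_le_two), mul_assoc]
      rw [h5]
      refine (Finset.sum_le_sum fun y' _ => mul_le_mul_right (h4 y') _).trans ?_
      cases x <;> simp [edgeProb, add_comm]
    · intro Ψ Ψ' hΨ m
      simp only [LinearMap.add_apply, Pi.add_apply, LinearMap.smul_apply, Pi.smul_apply,
        smul_eq_mul, Module.End.one_apply, consOp_apply]
      gcongr
      · exact hΨ m
      · exact expect_mono _ fun τ => hΨ _
      · exact expect_mono _ fun τ => hΨ _

end SideInfo

end

noncomputable section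

namespace SideInfo

open NamedTree
open Classical

/-! ### The accuracy on the tree and the weight of named trees -/

section TreeAccuracy

variable {n : ℕ} {a b : ℝ} {α : unitInterval}

lemma weightSum_le_map_treeLaw (hn : 0 < n) (ha : 0 ≤ a) (hb : 0 ≤ b) (t h : ℕ) (x y : Bool)
    (e : LabelledTree t → Bool) :
    weightSum n a b α t h x (fun s => if e (forgetNames t s) = y then 1 else 0)
      ≤ (((treeLaw a b α t x).map e) y).toReal := by
  have h1 : ((treeLaw a b α t x).map e) y
      = expect (treeLaw a b α t x) fun T => if e T = y then 1 else 0 := by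
    have h2 := expect_map (treeLaw a b α t x) e fun z => if z = y then 1 else 0
    rw [← h2, expect, tsum_eq_single y]
    · simp
    · intro z hz
      simp [hz]
  have h3 := weight_le_treeLaw hn ha hb α t h x fun T => if e T = y then 1 else 0
  rw [← h1] at h3
  rw [← ENNReal.ofReal_le_iff_le_toReal (PMF.apply_ne_top _ _)]
  refine le_trans (le_of_eq ?_) h3
  unfold weightSum
  rw [ENNReal.ofReal_sum_of_nonneg]
  · refine Finset.sum_congr rfl fun s _ => ?_
    by_cases h5 : rootLabel t s = x <;> by_cases h6 : e (forgetNames t s) = y <;> simp [h5, h6]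
  · intro s _
    have := treeWeight_nonneg (n := n) (α := α) ha hb t h s
    by_cases h5 : rootLabel t s = x <;> by_cases h6 : e (forgetNames t s) = y <;>
      simp [h5, h6, this]

/-- Total weight of a function when the label of the root is uniform. -/
def totalWeight (n : ℕ) (a b : ℝ) (α : unitInterval) (t h : ℕ) (g : LNamedTree n t → ℝ) : ℝ :=
  ∑ s, 1 / 2 * (treeWeight n a b α t h s * g s)

lemma totalWeight_eq (t h : ℕ) (g : LNamedTree n t → ℝ) :
    totalWeight n a b α t h g
      = 1 / 2 * weightSum n a b α t h true g + 1 / 2 * weightSum n a b α t h false g := by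
  unfold totalWeight weightSum
  rw [Finset.mul_sum, Finset.mul_sum, ← Finset.sum_add_distrib]
  refine Finset.sum_congr rfl fun s _ => ?_
  cases rootLabel t s <;> simp

/-- Used together with `totalWeight_error_le`: the correct and the wrong decisions are both
dominated by the tree law. As the total weight is almost 1, both inequalities are almost equalities.
-/
lemma totalWeight_correct_le (hn : 0 < n) (ha : 0 ≤ a) (hb : 0 ≤ b) (t h : ℕ) {Y : Type}
    (obs : LabelledTree t → Y) (est : Y → Bool) :
    totalWeight n a b α t h
        (fun s => if est (obs (forgetNames t s)) = rootLabel t s then 1 else 0)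
      ≤ treeAccuracy a b α t obs est := by
  have h1 : ∀ x, weightSum n a b α t h x
      (fun s => if est (obs (forgetNames t s)) = rootLabel t s then 1 else 0)
      = weightSum n a b α t h x (fun s => if est (obs (forgetNames t s)) = x then 1 else 0) := by
    intro x
    refine Finset.sum_congr rfl fun s _ => ?_
    by_cases hs : rootLabel t s = x <;> simp [hs]
  have h2 := fun x => weightSum_le_map_treeLaw (α := α) hn ha hb t h x x fun T => est (obs T)
  rw [totalWeight_eq, h1, h1, treeAccuracy]
  linarith [h2 true, h2 false]

lemma totalWeight_error_le (hn : 0 < n) (ha : 0 ≤ a) (hb : 0 ≤ b) (t h : ℕ) {Y : Type}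
    (obs : LabelledTree t → Y) (est : Y → Bool) :
    totalWeight n a b α t h
        (fun s => if est (obs (forgetNames t s)) ≠ rootLabel t s then 1 else 0)
      ≤ 1 - treeAccuracy a b α t obs est := by
  have h1 : ∀ x, weightSum n a b α t h x
      (fun s => if est (obs (forgetNames t s)) ≠ rootLabel t s then 1 else 0)
      = weightSum n a b α t h x
        (fun s => if est (obs (forgetNames t s)) = !x then 1 else 0) := by
    intro x
    refine Finset.sum_congr rfl fun s _ => ?_
    by_cases hs : rootLabel t s = x
    · simp only [hs, if_true]
      cases est (obs (forgetNames t s)) <;> cases x <;> simp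
    · simp [hs]
  have h2 := fun x => weightSum_le_map_treeLaw (α := α) hn ha hb t h x (!x)
    fun T => est (obs T)
  have h3 : ∀ p : PMF Bool, (p true).toReal + (p false).toReal = 1 := by
    intro p
    have h4 := p.tsum_coe
    rw [tsum_fintype, Fintype.sum_bool] at h4
    rw [← ENNReal.toReal_add (p.apply_ne_top _) (p.apply_ne_top _), h4]
    simp
  rw [totalWeight_eq, h1, h1, treeAccuracy]
  have h5 := h3 ((treeLaw a b α t true).map fun T => est (obs T))
  have h6 := h3 ((treeLaw a b α t false).map fun T => est (obs T))
  have h7 := h2 true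
  have h8 := h2 false
  simp only [Bool.not_true, Bool.not_false] at h7 h8 ⊢
  linarith

lemma treeAccuracy_le_one (t : ℕ) {Y : Type} (obs : LabelledTree t → Y) (est : Y → Bool) :
    treeAccuracy a b α t obs est ≤ 1 := by
  have h : ∀ (p : PMF Bool) (x : Bool), (p x).toReal ≤ 1 := fun p x =>
    ENNReal.toReal_le_of_le_ofReal zero_le_one (by simpa using p.coe_le_one x)
  have h1 := h ((treeLaw a b α t true).map fun T => est (obs T)) true
  have h2 := h ((treeLaw a b α t false).map fun T => est (obs T)) false
  unfold treeAccuracy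
  linarith

end TreeAccuracy

/-! ### The weight of an observation -/

section Observation

variable {n : ℕ} {a b : ℝ} {α : unitInterval} {L : Type}

/-- The weight of the named trees with root label `x` and observation `o`. -/
def obsWeight (n : ℕ) (a b : ℝ) (α : unitInterval) (g : Bool × Bool → L) (t h : ℕ) (x : Bool)
    (o : NamedTree n Bool L t) : ℝ :=
  weightSum n a b α t h x fun s => if map Prod.snd g t s = o then 1 else 0

lemma obsWeight_nonneg (ha : 0 ≤ a) (hb : 0 ≤ b) (g : Bool × Bool → L) (t h : ℕ) (x : Bool)
    (o : NamedTree n Bool L t) : 0 ≤ obsWeight n a b α g t h x o :=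
  weightSum_nonneg ha hb fun s => by split_ifs <;> norm_num

lemma obsWeight_zero_fuel (g : Bool × Bool → L) (t : ℕ) (x : Bool) (o : NamedTree n Bool L t) :
    obsWeight n a b α g t 0 x o = 0 :=
  weightSum_zero_fuel _ _ _

lemma obsWeight_zero (g : Bool × Bool → L) (h : ℕ) (x : Bool) (o : L) :
    obsWeight n a b α g 0 (h + 1) x o
      = ∑ y, noiseProb α x y * (if g (x, y) = o then 1 else 0) :=
  weightSum_zero _ _ _

/-- Given the label of a vertex, what is observed below different names is independent, so the
likelihood factors over the names. This is the recursion that underlies belief propagation. -/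
lemma obsWeight_succ (g : Bool × Bool → L) (t h : ℕ) (x y : Bool)
    (c : Fin n → Option (NamedTree n Bool L t)) :
    obsWeight n a b α g (t + 1) (h + 1) x ((y, c) : Bool × _) = noiseProb α x y *
      (Real.exp (-((a + b) / 2)) * ∏ v, (c v).elim 1 fun o =>
        ∑ x', edgeProb n a b x x' / 2 * obsWeight n a b α g t h x' o) := by
  unfold obsWeight
  rw [weightSum_succ]
  have h1 : ∀ (y' : Bool) (c' : Fin n → Option (LNamedTree n t)),
      (if map Prod.snd g (t + 1) (((x, y'), c') : (Bool × Bool) × _)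
        = ((y, c) : Bool × (Fin n → Option (NamedTree n Bool L t))) then (1 : ℝ) else 0)
      = (if y' = y then 1 else 0) *
        ∏ v, if (c' v).map (map Prod.snd g t) = c v then 1 else 0 := by
    intro y' c'
    have h2 : (map Prod.snd g (t + 1) (((x, y'), c') : (Bool × Bool) × _)
        = ((y, c) : Bool × (Fin n → Option (NamedTree n Bool L t))))
        ↔ y' = y ∧ ∀ v, (c' v).map (map Prod.snd g t) = c v := by
      change ((y', fun v => (c' v).map (map Prod.snd g t)) :
        Bool × (Fin n → Option (NamedTree n Bool L t))) = (y, c) ↔ _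
      rw [Prod.mk.injEq, funext_iff]
    by_cases hy : y' = y
    · by_cases hc : ∀ v, (c' v).map (map Prod.snd g t) = c v
      · rw [if_pos (h2.mpr ⟨hy, hc⟩), if_pos hy, one_mul]
        exact (Finset.prod_eq_one fun v _ => if_pos (hc v)).symm
      · rw [if_neg fun e => hc (h2.mp e).2, if_pos hy, one_mul]
        push Not at hc
        obtain ⟨v, hv⟩ := hc
        exact (Finset.prod_eq_zero (Finset.mem_univ v) (if_neg hv)).symm
    · rw [if_neg fun e => hy (h2.mp e).1, if_neg hy, zero_mul]
  simp_rw [h1]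
  rw [Finset.sum_eq_single y]
  · simp only [if_true, one_mul, ← Finset.prod_mul_distrib]
    congr 2
    rw [sum_pi_option_prod fun v o => o.elim 1 (childWeight n a b α t h x) *
      (if o.map (map Prod.snd g t) = c v then 1 else 0)]
    refine Finset.prod_congr rfl fun v _ => ?_
    cases hv : c v with
    | none => simp
    | some o =>
      simp only [Option.map_none, Option.map_some, Option.elim, Option.some_inj]
      rw [if_neg (by simp), mul_zero, zero_add]
      exact sum_childWeight_mul t h x _
  · intro y' _ hy
    simp [hy]
  · simp

lemma totalWeight_observation [Fintype L] (g : Bool × Bool → L) (t h : ℕ)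
    (F : NamedTree n Bool L t → Bool → ℝ) :
    totalWeight n a b α t h (fun s => F (map Prod.snd g t s) (rootLabel t s))
      = 1 / 2 * ∑ o, (obsWeight n a b α g t h true o * F o true
          + obsWeight n a b α g t h false o * F o false) := by
  have h1 : ∀ x, weightSum n a b α t h x (fun s => F (map Prod.snd g t s) (rootLabel t s))
      = ∑ o, obsWeight n a b α g t h x o * F o x := by
    intro x
    simp only [obsWeight, weightSum, Finset.sum_mul]
    rw [Finset.sum_comm]
    refine Finset.sum_congr rfl fun s _ => ?_
    by_cases hs : rootLabel t s = x
    · simp [hs]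
    · simp [hs]
  rw [totalWeight_eq, h1, h1, Finset.sum_add_distrib, mul_add]

/-- A likelihood decision is at least as good as any other one. -/
lemma totalWeight_correct_le_of_optimal [Fintype L] (g : Bool × Bool → L)
    (t h : ℕ) (D e : NamedTree n Bool L t → Bool)
    (hD : ∀ o, obsWeight n a b α g t h (!D o) o ≤ obsWeight n a b α g t h (D o) o) :
    totalWeight n a b α t h (fun s => if e (map Prod.snd g t s) = rootLabel t s then 1 else 0)
      ≤ totalWeight n a b α t h
          (fun s => if D (map Prod.snd g t s) = rootLabel t s then 1 else 0) := by
  rw [totalWeight_observation g t h fun o x => if e o = x then 1 else 0,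
    totalWeight_observation g t h fun o x => if D o = x then 1 else 0]
  refine mul_le_mul_of_nonneg_left (Finset.sum_le_sum fun o _ => ?_) (by norm_num)
  have := hD o
  cases hd : D o <;> cases e o <;> simp [hd] at this ⊢ <;> exact this

/-- The error of a randomized decision is at least the one of the likelihood decision. -/
lemma totalWeight_error_ge_of_optimal [Fintype L] (ha : 0 ≤ a) (hb : 0 ≤ b) (g : Bool × Bool → L)
    (t h : ℕ) (D : NamedTree n Bool L t → Bool)
    (hD : ∀ o, obsWeight n a b α g t h (!D o) o ≤ obsWeight n a b α g t h (D o) o)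
    (good : NamedTree n Bool L t → Prop) (κ : NamedTree n Bool L t → Bool → ℝ) (δ : ℝ)
    (hκ0 : ∀ o y, 0 ≤ κ o y) (hκ : ∀ o, good o → 1 - δ ≤ κ o true + κ o false) :
    (1 - δ) * totalWeight n a b α t h (fun s => if good (map Prod.snd g t s) then
        (if D (map Prod.snd g t s) ≠ rootLabel t s then 1 else 0) else 0)
      ≤ totalWeight n a b α t h (fun s => if good (map Prod.snd g t s) then
          κ (map Prod.snd g t s) (!rootLabel t s) else 0) := by
  rw [totalWeight_observation g t h fun o x => if good o then (if D o ≠ x then 1 else 0) else 0,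
    totalWeight_observation g t h fun o x => if good o then κ o (!x) else 0,
    mul_left_comm, Finset.mul_sum]
  refine mul_le_mul_of_nonneg_left (Finset.sum_le_sum fun o _ => ?_) (by norm_num)
  by_cases hg : good o
  · have h1 := hD o
    have h2 := hκ o hg
    have h3 := hκ0 o true
    have h4 := hκ0 o false
    have h5 := obsWeight_nonneg (α := α) ha hb g t h true o
    have h6 := obsWeight_nonneg (α := α) ha hb g t h false o
    -- Both labels weigh at least as much as the one rejected by `D`. Hence the randomized error is
    -- at least that weight times κ(+) + κ(-), which is at least 1 - δ.
    cases hd : D o <;> simp [hd, hg] at h1 ⊢ <;> nlinarith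
  · simp [hg]

end Observation

/-! ### Exact boundary labels -/

section Exact

variable {n : ℕ} {a b : ℝ} {α : unitInterval}

/-- Remove the names. -/
def forgetExact : (t : ℕ) → NamedTree n Bool (Bool × Bool) t → ExactBoundaryTree t
  | 0, x => x
  | t + 1, x => (x.1, imageMultiset (forgetExact t) x.2)

lemma map_imageMultiset {ι X Y Z : Type} [Fintype ι] (f : X → Y) (k : Y → Z)
    (c : ι → Option X) :
    Multiset.map k (imageMultiset f c) = imageMultiset (fun s => k (f s)) c := by
  unfold imageMultiset
  rw [← Multiset.coe_mapAddMonoidHom, map_sum]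
  refine Finset.sum_congr rfl fun v _ => ?_
  cases c v <;> simp

lemma imageMultiset_map {ι X Y Z : Type} [Fintype ι] (f : X → Y) (k : Y → Z)
    (c : ι → Option X) :
    imageMultiset k (fun v => (c v).map f) = imageMultiset (fun s => k (f s)) c := by
  unfold imageMultiset
  refine Finset.sum_congr rfl fun v _ => ?_
  dsimp only
  cases c v <;> rfl

lemma prod_map_imageMultiset {ι X Y : Type} [Fintype ι] (f : X → Y) (k : Y → ℝ)
    (c : ι → Option X) :
    (Multiset.map k (imageMultiset f c)).prod = ∏ v, (c v).elim 1 fun s => k (f s) := by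
  rw [map_imageMultiset]
  unfold imageMultiset
  rw [Multiset.prod_sum]
  refine Finset.prod_congr rfl fun v _ => ?_
  cases c v <;> simp

lemma sum_map_imageMultiset {ι X Y : Type} [Fintype ι] (f : X → Y) (k : Y → ℝ)
    (c : ι → Option X) :
    (Multiset.map k (imageMultiset f c)).sum = ∑ v, (c v).elim 0 fun s => k (f s) := by
  rw [map_imageMultiset]
  unfold imageMultiset
  rw [Multiset.sum_sum]
  refine Finset.sum_congr rfl fun v _ => ?_
  cases c v <;> simp

lemma forgetExact_map : ∀ (t : ℕ) (s : LNamedTree n t),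
    forgetExact t (map Prod.snd id t s) = LabelledTree.observeExact t (forgetNames t s)
  | 0, _ => rfl
  | t + 1, s => by
    refine Prod.ext rfl ?_
    change imageMultiset (forgetExact t) (fun v => (s.2 v).map (map Prod.snd id t))
      = Multiset.map (LabelledTree.observeExact t) (imageMultiset (forgetNames t) s.2)
    rw [imageMultiset_map, map_imageMultiset]
    congr 1
    funext s
    exact forgetExact_map t s

/-- The likelihood of a tree with exact boundary labels. -/
def exactLikelihood (n : ℕ) (a b : ℝ) (α : unitInterval) :
    (t h : ℕ) → Bool → ExactBoundaryTree t → ℝ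
  | _, 0, _, _ => 0
  | 0, _ + 1, x, l => if l.1 = x then noiseProb α x l.2 else 0
  | t + 1, h + 1, x, l => noiseProb α x l.1 * (Real.exp (-((a + b) / 2)) *
      (Multiset.map (fun o => ∑ x', edgeProb n a b x x' / 2 * exactLikelihood n a b α t h x' o)
        l.2).prod)

/-- The likelihood does not see the names. The best decision from a named observation is therefore a
legitimate estimator on the unnamed tree. -/
lemma obsWeight_exact : ∀ (t h : ℕ) (x : Bool) (o : NamedTree n Bool (Bool × Bool) t),
    obsWeight n a b α id t h x o = exactLikelihood n a b α t h x (forgetExact t o)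
  | t, 0, x, o => by
    rw [obsWeight_zero_fuel]
    cases t <;> rfl
  | 0, h + 1, x, o => by
    refine (obsWeight_zero id h x o).trans ?_
    obtain ⟨p, q⟩ := (o : Bool × Bool)
    change _ = if p = x then noiseProb α x q else 0
    cases p <;> cases q <;> cases x <;> simp
  | t + 1, h + 1, x, o => by
    refine (obsWeight_succ id t h x o.1 o.2).trans ?_
    change _ = noiseProb α x o.1 * (Real.exp (-((a + b) / 2)) *
      (Multiset.map (fun o => ∑ x', edgeProb n a b x x' / 2 * exactLikelihood n a b α t h x' o)
        (imageMultiset (forgetExact t) o.2)).prod)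
    rw [prod_map_imageMultiset]
    simp only [obsWeight_exact t h]

/-- The likelihood decision from exact boundary labels. -/
def exactDecision (n : ℕ) (a b : ℝ) (α : unitInterval) (t h : ℕ) (l : ExactBoundaryTree t) :
    Bool :=
  decide (exactLikelihood n a b α t h false l ≤ exactLikelihood n a b α t h true l)

lemma exactDecision_optimal (t h : ℕ) (o : NamedTree n Bool (Bool × Bool) t) :
    obsWeight n a b α id t h (!exactDecision n a b α t h (forgetExact t o)) o
      ≤ obsWeight n a b α id t h (exactDecision n a b α t h (forgetExact t o)) o := by
  rw [obsWeight_exact, obsWeight_exact]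
  unfold exactDecision
  by_cases hle : exactLikelihood n a b α t h false (forgetExact t o)
      ≤ exactLikelihood n a b α t h true (forgetExact t o)
  · simp [hle]
  · simpa [hle] using (not_le.mp hle).le

end Exact

/-! ### Belief propagation on the tree -/

section Noisy

variable {n : ℕ} {a b : ℝ} {α : unitInterval}

/-- Remove the names. -/
def forgetNoisy : (t : ℕ) → NamedTree n Bool Bool t → NoisyTree t
  | 0, x => x
  | t + 1, x => (x.1, imageMultiset (forgetNoisy t) x.2)

lemma forgetNoisy_map : ∀ (t : ℕ) (s : LNamedTree n t),
    forgetNoisy t (map Prod.snd Prod.snd t s) = LabelledTree.observeNoisy t (forgetNames t s)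
  | 0, _ => rfl
  | t + 1, s => by
    refine Prod.ext rfl ?_
    change imageMultiset (forgetNoisy t) (fun v => (s.2 v).map (map Prod.snd Prod.snd t))
      = Multiset.map (LabelledTree.observeNoisy t) (imageMultiset (forgetNames t) s.2)
    rw [imageMultiset_map, map_imageMultiset]
    congr 1
    funext s
    exact forgetNoisy_map t s

/-- The belief at the root of a tree. -/
def treeBelief (a b : ℝ) (α : unitInterval) : (t : ℕ) → NoisyTree t → EReal
  | 0, y => extField α y
  | t + 1, l => extField α l.1 +
      (((Multiset.map (fun o => bpF a b (treeBelief a b α t o)) l.2).sum : ℝ) : EReal)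

lemma tanhE_top : tanhE ⊤ = 1 := rfl

lemma tanhE_bot : tanhE ⊥ = -1 := rfl

lemma tanhE_abs_le (x : EReal) : |tanhE x| ≤ 1 := by
  induction x with
  | bot => simp [tanhE_bot]
  | top => simp [tanhE_top]
  | coe x => exact (Real.abs_tanh_lt_one x).le

lemma tanh_half_log (ha : 0 < a) (hb : 0 < b) :
    Real.tanh (1 / 2 * Real.log (a / b)) = (a - b) / (a + b) := by
  have h1 : Real.exp (1 / 2 * Real.log (a / b)) * Real.exp (1 / 2 * Real.log (a / b)) = a / b := by
    rw [← Real.exp_add, ← two_mul, ← mul_assoc, mul_one_div_cancel two_ne_zero, one_mul,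
      Real.exp_log (by positivity)]
  have h2 := Real.exp_pos (1 / 2 * Real.log (a / b))
  rw [Real.tanh_eq, Real.exp_neg]
  set E := Real.exp (1 / 2 * Real.log (a / b))
  have h3 : (E - E⁻¹) / (E + E⁻¹) = (E * E - 1) / (E * E + 1) := by field_simp
  rw [h3, h1]
  field_simp

lemma tanh_bpF (x : EReal) :
    Real.tanh (bpF a b x) = Real.tanh (1 / 2 * Real.log (a / b)) * tanhE x := by
  have h1 : |Real.tanh (1 / 2 * Real.log (a / b)) * tanhE x| < 1 := by
    rw [abs_mul]
    have h2 := Real.abs_tanh_lt_one (1 / 2 * Real.log (a / b))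
    have h3 := tanhE_abs_le x
    have h4 := abs_nonneg (Real.tanh (1 / 2 * Real.log (a / b)))
    nlinarith
  unfold bpF
  exact Real.tanh_artanh (abs_lt.mp h1)

/-- Writes two likelihoods as k·e^{±F} with a common factor k. Products over children then add their
values of F, also when p = q = 0. -/
lemma eq_exp_of_tanh {p q F : ℝ} (h : p - q = Real.tanh F * (p + q)) :
    p = (p + q) / (2 * Real.cosh F) * Real.exp F ∧
      q = (p + q) / (2 * Real.cosh F) * Real.exp (-F) := by
  have hc := Real.cosh_pos F
  rw [Real.tanh_eq_sinh_div_cosh] at h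
  have h1 : (p - q) * Real.cosh F = Real.sinh F * (p + q) := by
    rw [h]; field_simp
  rw [← Real.cosh_add_sinh, ← Real.cosh_sub_sinh]
  constructor
  · field_simp
    linarith
  · field_simp
    linarith

/-- The noisy label multiplies the likelihoods by a factor proportional to e^{±γ}, which shifts the
exponent `s` by the external field. For α = 0 one of the two terms vanishes, in accordance with
tanh(±∞) = ±1. -/
lemma extField_ratio (hα : (α : ℝ) < 1 / 2) (y : Bool) (k s : ℝ) :
    noiseProb α true y * (k * Real.exp s) - noiseProb α false y * (k * Real.exp (-s))
      = tanhE (extField α y + (s : EReal)) *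
        (noiseProb α true y * (k * Real.exp s) + noiseProb α false y * (k * Real.exp (-s))) := by
  by_cases h0 : (α : ℝ) = 0
  · cases y
    · simp [noiseProb, extField, gammaField, h0, tanhE_bot]
    · simp [noiseProb, extField, gammaField, h0, tanhE_top]
  · have hα0 : 0 < (α : ℝ) := lt_of_le_of_ne α.2.1 (Ne.symm h0)
    have hα1 : 0 < 1 - (α : ℝ) := by linarith
    set γ := 1 / 2 * Real.log ((1 - (α : ℝ)) / α) with hγ
    have h1 : Real.tanh γ = 1 - 2 * (α : ℝ) := by
      rw [hγ, tanh_half_log hα1 hα0]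
      field_simp
      ring
    obtain ⟨h2, h3⟩ := eq_exp_of_tanh (p := 1 - (α : ℝ)) (q := α) (F := γ) (by rw [h1]; ring)
    set κ := (1 - (α : ℝ) + α) / (2 * Real.cosh γ)
    have key : ∀ r m : ℝ, m * Real.exp r - m * Real.exp (-r)
        = Real.tanh r * (m * Real.exp r + m * Real.exp (-r)) := by
      intro r m
      have hc := Real.cosh_pos r
      rw [Real.tanh_eq_sinh_div_cosh, ← Real.cosh_add_sinh, ← Real.cosh_sub_sinh]
      field_simp
      ring
    cases y
    · have h4 : extField α false + (s : EReal) = ((-γ + s : ℝ) : EReal) := by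
        simp [extField, gammaField, h0, hγ]
      rw [h4]
      change _ = Real.tanh (-γ + s) * _
      have h5 := key (-γ + s) (κ * k)
      have h6 : Real.exp (-γ + s) = Real.exp (-γ) * Real.exp s := Real.exp_add _ _
      have h7 : Real.exp (-(-γ + s)) = Real.exp γ * Real.exp (-s) := by
        rw [← Real.exp_add]; congr 1; ring
      have h8 : noiseProb α true false = α := by simp [noiseProb]
      have h9 : noiseProb α false false = 1 - α := by simp [noiseProb]
      rw [h6, h7] at h5
      rw [h8, h9, h2, h3]
      convert h5 using 2 <;> ring
    · have h4 : extField α true + (s : EReal) = ((γ + s : ℝ) : EReal) := by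
        simp [extField, gammaField, h0, hγ]
      rw [h4]
      change _ = Real.tanh (γ + s) * _
      have h5 := key (γ + s) (κ * k)
      have h6 : Real.exp (γ + s) = Real.exp γ * Real.exp s := Real.exp_add _ _
      have h7 : Real.exp (-(γ + s)) = Real.exp (-γ) * Real.exp (-s) := by
        rw [← Real.exp_add]; congr 1; ring
      have h8 : noiseProb α true true = 1 - α := by simp [noiseProb]
      have h9 : noiseProb α false true = α := by simp [noiseProb]
      rw [h6, h7] at h5
      rw [h8, h9, h2, h3]
      convert h5 using 2 <;> ring

/-- The belief determines the likelihood ratio. -/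
lemma obsWeight_sub_eq (ha : 0 < a) (hb : 0 < b) (hα : (α : ℝ) < 1 / 2) :
    ∀ (t h : ℕ) (o : NamedTree n Bool Bool t),
    obsWeight n a b α Prod.snd t h true o - obsWeight n a b α Prod.snd t h false o
      = tanhE (treeBelief a b α t (forgetNoisy t o)) *
        (obsWeight n a b α Prod.snd t h true o + obsWeight n a b α Prod.snd t h false o)
  | t, 0, o => by simp [obsWeight_zero_fuel]
  | 0, h + 1, o => by
    have h1 : ∀ x, obsWeight n a b α Prod.snd 0 (h + 1) x o = noiseProb α x o := by
      intro x
      refine (obsWeight_zero Prod.snd h x o).trans ?_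
      have h2 : ∀ p : Bool, ∑ y, noiseProb α x y * (@ite _ (y = p) (propDecidable _) 1 0)
          = noiseProb α x p := by
        intro p
        cases p <;> simp
      exact h2 o
    rw [h1, h1]
    have h2 := extField_ratio hα o 1 0
    simp only [neg_zero, Real.exp_zero, mul_one, EReal.coe_zero, add_zero] at h2
    exact h2
  | t + 1, h + 1, o => by
    have h1 : ∀ x, obsWeight n a b α Prod.snd (t + 1) (h + 1) x o = noiseProb α x o.1 *
      (Real.exp (-((a + b) / 2)) * ∏ v, (o.2 v).elim 1 fun o' =>
        ∑ x', edgeProb n a b x x' / 2 * obsWeight n a b α Prod.snd t h x' o') :=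
      fun x => obsWeight_succ Prod.snd t h x o.1 o.2
    set E : Bool → NamedTree n Bool Bool t → ℝ := fun x o' =>
      ∑ x', edgeProb n a b x x' / 2 * obsWeight n a b α Prod.snd t h x' o' with hE
    set F : NamedTree n Bool Bool t → ℝ := fun o' => bpF a b (treeBelief a b α t (forgetNoisy t o'))
      with hF
    set K : NamedTree n Bool Bool t → ℝ := fun o' =>
      (E true o' + E false o') / (2 * Real.cosh (F o')) with hK
    -- Crossing an edge mixes the two labels in proportions a and b. The normalized difference is
    -- multiplied by (a-b)/(a+b) = tanh β, which is the effect of `bpF`.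
    have h2 : ∀ o', E true o' - E false o' = Real.tanh (F o') * (E true o' + E false o') := by
      intro o'
      rw [hF, tanh_bpF, tanh_half_log ha hb]
      simp only [hE, Fintype.sum_bool, edgeProb]
      simp only [if_true, Bool.true_eq_false, if_false, Bool.false_eq_true]
      have h3 := obsWeight_sub_eq ha hb hα t h o'
      set A := obsWeight n a b α Prod.snd t h true o'
      set B := obsWeight n a b α Prod.snd t h false o'
      set τ := tanhE (treeBelief a b α t (forgetNoisy t o'))
      have h4 : a / n / 2 * A + b / n / 2 * B - (b / n / 2 * A + a / n / 2 * B)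
          = (a - b) / n / 2 * (A - B) := by ring
      have h5 : a / n / 2 * A + b / n / 2 * B + (b / n / 2 * A + a / n / 2 * B)
          = (a + b) / n / 2 * (A + B) := by ring
      rw [h4, h5, h3]
      field_simp
    have h3 : ∏ v, (o.2 v).elim 1 (E true)
        = (∏ v, (o.2 v).elim 1 K) * Real.exp (∑ v, (o.2 v).elim 0 F) := by
      rw [Real.exp_sum, ← Finset.prod_mul_distrib]
      refine Finset.prod_congr rfl fun v _ => ?_
      cases o.2 v with
      | none => simp
      | some o' => exact (eq_exp_of_tanh (h2 o')).1
    have h4 : ∏ v, (o.2 v).elim 1 (E false)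
        = (∏ v, (o.2 v).elim 1 K) * Real.exp (-∑ v, (o.2 v).elim 0 F) := by
      rw [← Finset.sum_neg_distrib, Real.exp_sum, ← Finset.prod_mul_distrib]
      refine Finset.prod_congr rfl fun v _ => ?_
      cases o.2 v with
      | none => simp
      | some o' => exact (eq_exp_of_tanh (h2 o')).2
    rw [h1, h1, h3, h4, ← mul_assoc (Real.exp _), ← mul_assoc (Real.exp _)]
    have h5 : treeBelief a b α (t + 1) (forgetNoisy (t + 1) o)
        = extField α o.1 + ((∑ v, (o.2 v).elim 0 F : ℝ) : EReal) := by
      change extField α o.1 + (((Multiset.map (fun o => bpF a b (treeBelief a b α t o))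
        (imageMultiset (forgetNoisy t) o.2)).sum : ℝ) : EReal) = _
      rw [sum_map_imageMultiset]
    rw [h5]
    exact extField_ratio hα _ _ _

/-- The decision of belief propagation. -/
def beliefDecision (a b : ℝ) (α : unitInterval) (t : ℕ) (l : NoisyTree t) : Bool :=
  decide (0 ≤ treeBelief a b α t l)

lemma tanhE_nonneg {x : EReal} (hx : 0 ≤ x) : 0 ≤ tanhE x := by
  induction x with
  | bot => simp at hx
  | top => simp [tanhE_top]
  | coe x =>
    change 0 ≤ Real.tanh x
    rw [Real.tanh_eq_sinh_div_cosh]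
    exact div_nonneg (Real.sinh_nonneg_iff.mpr (by exact_mod_cast hx)) (Real.cosh_pos x).le

lemma tanhE_nonpos {x : EReal} (hx : x ≤ 0) : tanhE x ≤ 0 := by
  induction x with
  | bot => simp [tanhE_bot]
  | top => simp at hx
  | coe x =>
    change Real.tanh x ≤ 0
    rw [Real.tanh_eq_sinh_div_cosh]
    exact div_nonpos_of_nonpos_of_nonneg (Real.sinh_nonpos_iff.mpr (by exact_mod_cast hx))
      (Real.cosh_pos x).le

/-- The sign of the belief is the sign of the difference of the likelihoods, whatever the cut-off
`h`: `obsWeight_sub_eq` holds for every amount of fuel, although the belief does not depend on it.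
-/
lemma beliefDecision_optimal (ha : 0 < a) (hb : 0 < b) (hα : (α : ℝ) < 1 / 2) (t h : ℕ)
    (o : NamedTree n Bool Bool t) :
    obsWeight n a b α Prod.snd t h (!beliefDecision a b α t (forgetNoisy t o)) o
      ≤ obsWeight n a b α Prod.snd t h (beliefDecision a b α t (forgetNoisy t o)) o := by
  have h1 := obsWeight_sub_eq (n := n) ha hb hα t h o
  have h2 := obsWeight_nonneg (n := n) (α := α) ha.le hb.le Prod.snd t h true o
  have h3 := obsWeight_nonneg (n := n) (α := α) ha.le hb.le Prod.snd t h false o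
  unfold beliefDecision
  by_cases hle : 0 ≤ treeBelief a b α t (forgetNoisy t o)
  · have h4 := mul_nonneg (tanhE_nonneg hle) (add_nonneg h2 h3)
    simp only [hle, decide_true, Bool.not_true]
    linarith
  · have h4 := mul_nonpos_of_nonpos_of_nonneg (tanhE_nonpos (not_le.mp hle).le)
      (add_nonneg h2 h3)
    simp only [hle, decide_false, Bool.not_false]
    linarith

end Noisy

end SideInfo

end

noncomputable section

namespace SideInfo

open NamedTree
open Classical

/-! ### The computation tree of a graph -/

section Unfolding

variable {n : ℕ}

/-- The non-backtracking walks of length at most `t` from `i` whose first step avoids `p`. -/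
def unfolding (G : SimpleGraph (Fin n)) (σ σ' : Fin n → Bool) :
    (t : ℕ) → Fin n → Option (Fin n) → LNamedTree n t
  | 0, i, _ => (σ i, σ' i)
  | t + 1, i, p => ((σ i, σ' i), fun l =>
      if G.Adj i l ∧ some l ≠ p then some (unfolding G σ σ' t l (some i)) else none)

lemma treeBelief_unfolding_succ (a b : ℝ) (α : unitInterval) (G : SimpleGraph (Fin n))
    (σ σ' : Fin n → Bool) (t : ℕ) (i : Fin n) (p : Option (Fin n)) :
    treeBelief a b α (t + 1)
        (forgetNoisy (t + 1) (map Prod.snd Prod.snd (t + 1) (unfolding G σ σ' (t + 1) i p)))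
      = extField α (σ' i) + ((∑ l ∈ Finset.univ.filter fun l => G.Adj i l ∧ some l ≠ p,
        bpF a b (treeBelief a b α t
          (forgetNoisy t (map Prod.snd Prod.snd t (unfolding G σ σ' t l (some i))))) : ℝ) :
            EReal) := by
  change extField α (σ' i) + (((Multiset.map (fun o => bpF a b (treeBelief a b α t o))
    (imageMultiset (forgetNoisy t) fun l => ((if G.Adj i l ∧ some l ≠ p then
      some (unfolding G σ σ' t l (some i)) else none).map (map Prod.snd Prod.snd t)))).sum : ℝ) :
        EReal) = _
  rw [sum_map_imageMultiset, Finset.sum_filter]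
  congr 2
  refine Finset.sum_congr rfl fun l _ => ?_
  split_ifs <;> simp

/-- Valid on every graph, cycles included: excluding the recipient of a message amounts to
forbidding the walk to backtrack. -/
lemma bpMessage_eq (a b : ℝ) (α : unitInterval) (G : SimpleGraph (Fin n))
    (σ σ' : Fin n → Bool) : ∀ (t : ℕ) (i j : Fin n),
    bpMessage a b α G σ' t i j = treeBelief a b α t
      (forgetNoisy t (map Prod.snd Prod.snd t (unfolding G σ σ' t i (some j))))
  | 0, _, _ => rfl
  | t + 1, i, j => by
    rw [treeBelief_unfolding_succ, bpMessage]
    congr 2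
    refine Finset.sum_congr ?_ fun l _ => by rw [bpMessage_eq a b α G σ σ' t l i]
    ext l
    simp

lemma bpBelief_eq (a b : ℝ) (α : unitInterval) (G : SimpleGraph (Fin n))
    (σ σ' : Fin n → Bool) : ∀ (t : ℕ) (u : Fin n),
    bpBelief a b α G σ' t u = treeBelief a b α t
      (forgetNoisy t (map Prod.snd Prod.snd t (unfolding G σ σ' t u none)))
  | 0, _ => rfl
  | t + 1, u => by
    rw [treeBelief_unfolding_succ, bpBelief]
    congr 2
    refine Finset.sum_congr ?_ fun l _ => by rw [bpMessage_eq a b α G σ σ' t l u]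
    ext l
    simp

lemma bpEstimator_eq (a b : ℝ) (α : unitInterval) (G : SimpleGraph (Fin n))
    (σ σ' : Fin n → Bool) (t : ℕ) (u : Fin n) :
    bpEstimator n a b α t G σ' u = beliefDecision a b α t
      (forgetNoisy t (map Prod.snd Prod.snd t (unfolding G σ σ' t u none))) := by
  unfold bpEstimator beliefDecision
  rw [bpBelief_eq a b α G σ σ']

/-- The labels of the tree are those of its names. -/
def Agrees (σ σ' : Fin n → Bool) : (t : ℕ) → LNamedTree n t → Fin n → Prop
  | 0, x, r => x = (σ r, σ' r)
  | t + 1, x, r => x.1 = (σ r, σ' r) ∧ ∀ v s, x.2 v = some s → Agrees σ σ' t s v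

lemma Agrees.rootLabel_eq {σ σ' : Fin n → Bool} {t : ℕ} {s : LNamedTree n t} {r : Fin n}
    (h : Agrees σ σ' t s r) : rootLabel t s = σ r := by
  cases t with
  | zero => exact congrArg Prod.fst h
  | succ t => exact congrArg Prod.fst h.1

lemma sortedPair_comm (u w : Fin n) : sortedPair u w = sortedPair w u := by
  unfold sortedPair
  split_ifs with h1 h2 h2
  · exact absurd h2 h1.not_gt
  · rfl
  · rfl
  · have : u = w := le_antisymm (not_lt.mp h2) (not_lt.mp h1)
    rw [this]

lemma sortedPair_eq_iff {u w r v : Fin n} :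
    sortedPair u w = sortedPair r v ↔ (u = r ∧ w = v) ∨ (u = v ∧ w = r) := by
  constructor
  · intro h
    unfold sortedPair at h
    split_ifs at h <;> rw [Prod.mk.injEq] at h
    · exact Or.inl h
    · exact Or.inr h
    · exact Or.inr ⟨h.2, h.1⟩
    · exact Or.inl ⟨h.2, h.1⟩
  · rintro (⟨rfl, rfl⟩ | ⟨rfl, rfl⟩)
    · rfl
    · exact sortedPair_comm _ _

lemma sortedPair_mem_iff {u w : Fin n} {S : Finset (Fin n)} :
    ((sortedPair u w).1 ∈ S ∧ (sortedPair u w).2 ∈ S) ↔ u ∈ S ∧ w ∈ S := by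
  unfold sortedPair
  split_ifs
  · rfl
  · exact and_comm

/-! ### Trees with distinct names as neighbourhoods in a graph -/

variable {I L : Type}

lemma mem_verts_of_mem_edges : ∀ (t : ℕ) (x : NamedTree n I L t) (r : Fin n)
    {e : Fin n × Fin n}, e ∈ edges t x r → e.1 ∈ verts t x r ∧ e.2 ∈ verts t x r
  | 0, x, r, e, he => by simp [edges] at he
  | t + 1, x, r, e, he => by
    obtain ⟨v, s, hs, rfl | he⟩ := mem_edges_succ.mp he
    · rw [sortedPair_mem_iff]
      exact ⟨root_mem_verts _ _ _, mem_verts_succ.mpr (Or.inr ⟨v, s, hs, root_mem_verts _ _ _⟩)⟩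
    · obtain ⟨h1, h2⟩ := mem_verts_of_mem_edges t s v he
      exact ⟨mem_verts_succ.mpr (Or.inr ⟨v, s, hs, h1⟩),
        mem_verts_succ.mpr (Or.inr ⟨v, s, hs, h2⟩)⟩

lemma touches_of_mem_edges : ∀ (t : ℕ) (x : NamedTree n I L t) (r : Fin n)
    {e : Fin n × Fin n}, e ∈ edges t x r → e.1 ∈ interior t x r ∨ e.2 ∈ interior t x r
  | 0, x, r, e, he => by simp [edges] at he
  | t + 1, x, r, e, he => by
    obtain ⟨v, s, hs, rfl | he⟩ := mem_edges_succ.mp he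
    · have : r ∈ interior (t + 1) x r := mem_interior_succ.mpr (Or.inl rfl)
      unfold sortedPair
      split_ifs
      · exact Or.inl this
      · exact Or.inr this
    · exact (touches_of_mem_edges t s v he).imp
        (fun h => mem_interior_succ.mpr (Or.inr ⟨v, s, hs, h⟩))
        (fun h => mem_interior_succ.mpr (Or.inr ⟨v, s, hs, h⟩))

lemma lt_of_mem_edges : ∀ (t : ℕ) (x : NamedTree n I L t) (r : Fin n) (_ : Distinct t x r)
    {e : Fin n × Fin n}, e ∈ edges t x r → e.1 < e.2
  | 0, x, r, _, e, he => by simp [edges] at he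
  | t + 1, x, r, hD, e, he => by
    obtain ⟨v, s, hs, rfl | he⟩ := mem_edges_succ.mp he
    · have hrv : r ≠ v := fun h => (hD.1 v s hs).2 (h ▸ root_mem_verts t s v)
      unfold sortedPair
      split_ifs with h
      · exact h
      · exact lt_of_le_of_ne (not_lt.mp h) hrv.symm
    · exact lt_of_mem_edges t s v (hD.1 v s hs).1 he

/-- If the edges at the interior of a tree are those of the graph, then the tree is the
computation tree of the graph. -/
lemma unfolding_eq (G : SimpleGraph (Fin n)) (σ σ' : Fin n → Bool) :
    ∀ (t : ℕ) (x : LNamedTree n t) (r : Fin n) (p : Option (Fin n)),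
    Distinct t x r → Agrees σ σ' t x r →
    (∀ u ∈ interior t x r, ∀ w, u ≠ w →
      (G.Adj u w ↔ sortedPair u w ∈ edges t x r ∨ (u = r ∧ some w = p))) →
    (∀ w ∈ verts t x r, some w ≠ p) → unfolding G σ σ' t r p = x
  | 0, x, r, p, _, hA, _, _ => hA.symm
  | t + 1, x, r, p, hD, hA, hloc, hp => by
    refine Prod.ext hA.1.symm (funext fun l => ?_)
    change (if G.Adj r l ∧ some l ≠ p then some (unfolding G σ σ' t l (some r)) else none) = x.2 l
    have hr : r ∈ interior (t + 1) x r := mem_interior_succ.mpr (Or.inl rfl)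
    cases hl : x.2 l with
    | some s =>
      have hlv : l ∈ verts (t + 1) x r :=
        mem_verts_succ.mpr (Or.inr ⟨l, s, hl, root_mem_verts t s l⟩)
      have hrl : r ≠ l := fun h => (hD.1 l s hl).2 (h ▸ root_mem_verts t s l)
      have hadj : G.Adj r l := (hloc r hr l hrl).mpr
        (Or.inl (mem_edges_succ.mpr ⟨l, s, hl, Or.inl rfl⟩))
      rw [if_pos ⟨hadj, hp l hlv⟩]
      congr 1
      refine unfolding_eq G σ σ' t s l (some r) (hD.1 l s hl).1 (hA.2 l s hl) ?_ ?_
      · intro u hu w huw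
        have huv := interior_subset_verts t s l hu
        have hur : u ≠ r := fun h => (hD.1 l s hl).2 (h ▸ huv)
        -- Disjointness of the child subtrees ensures that an edge at `u` lies in the subtree of
        -- `l`, or else joins `l` to its parent `r`; the parent is excluded in the recursive call.
        have hdis : ∀ v s'', x.2 v = some s'' → u ∈ verts t s'' v → v = l := by
          intro v s'' hv hu''
          by_contra hne
          exact Finset.disjoint_left.mp (hD.2 v l s'' s hne hv hl) hu'' huv
        rw [hloc u (mem_interior_succ.mpr (Or.inr ⟨l, s, hl, hu⟩)) w huw, mem_edges_succ]
        constructor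
        · rintro (⟨v, s'', hv, h | h⟩ | ⟨h, _⟩)
          · rcases sortedPair_eq_iff.mp h with ⟨h1, _⟩ | ⟨h1, h2⟩
            · exact absurd h1 hur
            · have := hdis v s'' hv (h1 ▸ root_mem_verts t s'' v)
              exact Or.inr ⟨h1.trans this, by rw [h2]⟩
          · have h1 := (sortedPair_mem_iff.mp (mem_verts_of_mem_edges t s'' v h)).1
            obtain rfl := hdis v s'' hv h1
            rw [hl, Option.some_inj] at hv
            rw [hv]
            exact Or.inl h
          · exact absurd h hur
        · rintro (h | ⟨h1, h2⟩)
          · exact Or.inl ⟨l, s, hl, Or.inr h⟩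
          · rw [Option.some_inj] at h2
            rw [h1, h2, sortedPair_comm]
            exact Or.inl ⟨l, s, hl, Or.inl rfl⟩
      · intro w hw h
        rw [Option.some_inj] at h
        exact (hD.1 l s hl).2 (h ▸ hw)
    | none =>
      rw [if_neg]
      rintro ⟨hadj, hlp⟩
      rcases (hloc r hr l hadj.ne).mp hadj with h | ⟨_, h⟩
      · obtain ⟨v, s, hv, h | h⟩ := mem_edges_succ.mp h
        · rcases sortedPair_eq_iff.mp h with ⟨_, h1⟩ | ⟨h1, h2⟩
          · rw [h1, hv] at hl
            exact absurd hl (by simp)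
          · exact hadj.ne h2.symm
        · exact (hD.1 v s hv).2 (sortedPair_mem_iff.mp (mem_verts_of_mem_edges t s v h)).1
      · exact hlp h

/-- The labels of a tree with distinct names. -/
lemma exists_labels : ∀ (t : ℕ) (x : LNamedTree n t) (r : Fin n), Distinct t x r →
    ∃ τ τ' : Fin n → Bool, ∀ σ σ' : Fin n → Bool,
      Agrees σ σ' t x r ↔ ∀ u ∈ verts t x r, σ u = τ u ∧ σ' u = τ' u
  | 0, x, r, _ => by
    refine ⟨fun _ => Prod.fst (x : Bool × Bool), fun _ => Prod.snd (x : Bool × Bool),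
      fun σ σ' => ?_⟩
    simp only [verts, Finset.mem_singleton, forall_eq]
    have h : ∀ p q : Bool × Bool, p = q ↔ q.1 = p.1 ∧ q.2 = p.2 := fun p q => by
      rw [Prod.ext_iff, eq_comm, @eq_comm _ p.2]
    exact h x (σ r, σ' r)
  | t + 1, x, r, hD => by
    have ih : ∀ v s, x.2 v = some s → ∃ τ : (Fin n → Bool) × (Fin n → Bool),
        ∀ σ σ' : Fin n → Bool,
        Agrees σ σ' t s v ↔ ∀ u ∈ verts t s v, σ u = τ.1 u ∧ σ' u = τ.2 u := fun v s hs => by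
      obtain ⟨τ, τ', h⟩ := exists_labels t s v (hD.1 v s hs).1
      exact ⟨(τ, τ'), h⟩
    choose T hT using ih
    have hex : ∃ τ : Fin n → Bool × Bool, τ r = x.1 ∧ ∀ v s (hs : x.2 v = some s),
        ∀ u ∈ verts t s v, τ u = ((T v s hs).1 u, (T v s hs).2 u) := by
      -- The labellings of the child subtrees are glued. Disjointness makes the selected subtree
      -- unique, and names outside all of them, among which is `r`, receive the root data.
      refine ⟨fun u => if h : ∃ v s, ∃ hs : x.2 v = some s, u ∈ verts t s v then
        ((T h.choose h.choose_spec.choose h.choose_spec.choose_spec.choose).1 u,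
          (T h.choose h.choose_spec.choose h.choose_spec.choose_spec.choose).2 u) else x.1,
        ?_, ?_⟩
      · dsimp only
        rw [dif_neg]
        rintro ⟨v, s, hs, hr⟩
        exact (hD.1 v s hs).2 hr
      · intro v s hs u hu
        have h : ∃ v s, ∃ hs : x.2 v = some s, u ∈ verts t s v := ⟨v, s, hs, hu⟩
        dsimp only
        rw [dif_pos h]
        have hv : h.choose = v := by
          by_contra hne
          exact Finset.disjoint_left.mp (hD.2 _ _ _ _ hne h.choose_spec.choose_spec.choose hs)
            h.choose_spec.choose_spec.choose_spec hu
        have key : ∀ v' s' (hs' : x.2 v' = some s'), v' = v → T v' s' hs' = T v s hs := by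
          intro v' s' hs' he
          subst he
          have : s' = s := by rw [hs'] at hs; exact Option.some_inj.mp hs
          subst this
          rfl
        rw [key _ _ _ hv]
    obtain ⟨τ, hτr, hτ⟩ := hex
    refine ⟨fun u => (τ u).1, fun u => (τ u).2, fun σ σ' => ?_⟩
    dsimp only
    constructor
    · rintro ⟨h1, h2⟩ u hu
      rcases mem_verts_succ.mp hu with rfl | ⟨v, s, hs, hu⟩
      · rw [hτr, h1]
        exact ⟨rfl, rfl⟩
      · rw [hτ v s hs u hu]
        exact (hT v s hs σ σ').mp (h2 v s hs) u hu
    · intro h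
      refine ⟨?_, fun v s hs => (hT v s hs σ σ').mpr fun u hu => ?_⟩
      · obtain ⟨h1, h2⟩ := h r (root_mem_verts _ _ _)
        exact hτr.symm.trans (Prod.ext h1.symm h2.symm)
      · have h1 := h u (mem_verts_succ.mpr (Or.inr ⟨v, s, hs, hu⟩))
        rw [hτ v s hs u hu] at h1
        exact h1

/-- Trees with the same observation have the same noisy labels, and the same true labels at
the boundary. -/
lemma labels_eq_of_observation_eq {σ₁ σ₁' σ₂ σ₂' : Fin n → Bool} : ∀ (t : ℕ)
    (x₁ x₂ : LNamedTree n t) (r : Fin n), map Prod.snd id t x₁ = map Prod.snd id t x₂ →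
    Agrees σ₁ σ₁' t x₁ r → Agrees σ₂ σ₂' t x₂ r → ∀ u ∈ verts t x₁ r,
      σ₁' u = σ₂' u ∧ (u ∉ interior t x₁ r → σ₁ u = σ₂ u)
  | 0, x₁, x₂, r, h, h1, h2, u, hu => by
    obtain rfl := Finset.mem_singleton.mp hu
    have h3 : ((σ₁ u, σ₁' u) : Bool × Bool) = (σ₂ u, σ₂' u) := h1.symm.trans (h.trans h2)
    rw [Prod.mk.injEq] at h3
    exact ⟨h3.2, fun _ => h3.1⟩
  | t + 1, x₁, x₂, r, h, h1, h2, u, hu => by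
    have hfst : x₁.1.2 = x₂.1.2 := congrArg Prod.fst h
    have hsnd : ∀ v, (x₁.2 v).map (map Prod.snd id t) = (x₂.2 v).map (map Prod.snd id t) :=
      fun v => congrFun (congrArg Prod.snd h) v
    rcases mem_verts_succ.mp hu with rfl | ⟨v, s, hs, hu⟩
    · refine ⟨?_, fun hu' => absurd (mem_interior_succ.mpr (Or.inl rfl)) hu'⟩
      rw [h1.1, h2.1] at hfst
      exact hfst
    · have h3 := hsnd v
      rw [hs, Option.map_some, eq_comm, Option.map_eq_some_iff] at h3
      obtain ⟨s₂, hs₂, h3⟩ := h3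
      obtain ⟨h4, h5⟩ := labels_eq_of_observation_eq t s s₂ v h3.symm (h1.2 v s hs)
        (h2.2 v s₂ hs₂) u hu
      exact ⟨h4, fun hu' => h5 fun hu'' =>
        hu' (mem_interior_succ.mpr (Or.inr ⟨v, s, hs, hu''⟩))⟩

lemma prod_biUnion_elim {β X : Type} [DecidableEq β] (c : Fin n → Option X) (f : Fin n → X → Finset β)
    (k : β → ℝ)
    (hdis : ∀ v v' s s', v ≠ v' → c v = some s → c v' = some s' → Disjoint (f v s) (f v' s')) :
    ∏ e ∈ Finset.univ.biUnion fun v => (c v).elim ∅ (f v), k e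
      = ∏ v, (c v).elim 1 fun s => ∏ e ∈ f v s, k e := by
  rw [Finset.prod_biUnion]
  · refine Finset.prod_congr rfl fun v _ => ?_
    cases c v <;> simp
  · intro v _ v' _ hv
    change Disjoint ((c v).elim ∅ (f v)) ((c v').elim ∅ (f v'))
    cases h : c v with
    | none => simp
    | some s =>
      cases h' : c v' with
      | none => simp
      | some s' => exact hdis v v' s s' hv h h'

/-- The weight of a tree as a product over its vertices and edges. -/
lemma treeWeight_le_prod {a b : ℝ} (ha : 0 ≤ a) (hb : 0 ≤ b) (α : unitInterval)
    (σ σ' : Fin n → Bool) : ∀ (t h : ℕ) (x : LNamedTree n t) (r : Fin n),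
    Distinct t x r → Agrees σ σ' t x r →
    treeWeight n a b α t h x ≤ 2 * (∏ u ∈ verts t x r, 1 / 2 * noiseProb α (σ u) (σ' u)) *
      (∏ _u ∈ interior t x r, Real.exp (-((a + b) / 2))) *
      ∏ e ∈ edges t x r, edgeProb n a b (σ e.1) (σ e.2)
  | t, 0, x, r, _, _ => by
    rw [treeWeight_zero_fuel]
    have h1 : ∀ u, 0 ≤ 1 / 2 * noiseProb α (σ u) (σ' u) := fun u =>
      mul_nonneg (by norm_num) (noiseProb_nonneg _ _ _)
    exact mul_nonneg (mul_nonneg (mul_nonneg zero_le_two (Finset.prod_nonneg fun u _ => h1 u))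
      (Finset.prod_nonneg fun u _ => (Real.exp_pos _).le))
      (Finset.prod_nonneg fun e _ => edgeProb_nonneg n ha hb _ _)
  | 0, h + 1, x, r, _, hA => by
    have hA' : (x : Bool × Bool) = (σ r, σ' r) := hA
    change noiseProb α (Prod.fst (x : Bool × Bool)) (Prod.snd (x : Bool × Bool)) ≤ _
    rw [hA']
    simp [verts, NamedTree.interior, edges]
  | t + 1, h + 1, x, r, hD, hA => by
    obtain ⟨i, c⟩ := x
    have hD : (∀ v s, c v = some s → Distinct t s v ∧ r ∉ verts t s v) ∧
      ∀ v v' s s', v ≠ v' → c v = some s → c v' = some s' →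
        Disjoint (verts t s v) (verts t s' v') := hD
    have hA : i = (σ r, σ' r) ∧ ∀ v s, c v = some s → Agrees σ σ' t s v := hA
    change noiseProb α i.1 i.2 * Real.exp (-((a + b) / 2)) * (∏ v, (c v).elim 1 fun s =>
        edgeProb n a b i.1 (rootLabel t s) / 2 * treeWeight n a b α t h s) ≤
      2 * (∏ u ∈ insert r (Finset.univ.biUnion fun v => (c v).elim ∅ fun s => verts t s v),
        1 / 2 * noiseProb α (σ u) (σ' u)) *
      (∏ _u ∈ insert r (Finset.univ.biUnion fun v => (c v).elim ∅
        fun s => NamedTree.interior t s v), Real.exp (-((a + b) / 2))) *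
      ∏ e ∈ Finset.univ.biUnion fun v =>
        (c v).elim ∅ fun s => insert (sortedPair r v) (edges t s v),
        edgeProb n a b (σ e.1) (σ e.2)
    set ℓ : Fin n → ℝ := fun u => 1 / 2 * noiseProb α (σ u) (σ' u) with hℓ
    set k : Fin n × Fin n → ℝ := fun e => edgeProb n a b (σ e.1) (σ e.2) with hk
    have hk0 : ∀ e, 0 ≤ k e := fun e => edgeProb_nonneg n ha hb _ _
    have hksym : ∀ u w, k (sortedPair u w) = edgeProb n a b (σ u) (σ w) := by
      intro u w
      simp only [hk, sortedPair]
      split_ifs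
      · rfl
      · simp only [edgeProb, eq_comm]
    have hvert : ∏ u ∈ insert r (Finset.univ.biUnion fun v => (c v).elim ∅ fun s => verts t s v), ℓ u
        = ℓ r * ∏ v, (c v).elim 1 fun s => ∏ u ∈ verts t s v, ℓ u := by
      rw [Finset.prod_insert, prod_biUnion_elim c (fun v s => verts t s v) ℓ hD.2]
      rw [Finset.mem_biUnion]
      rintro ⟨v, _, hv⟩
      cases hs : c v with
      | none => simp [hs] at hv
      | some s =>
        rw [hs] at hv
        exact (hD.1 v s hs).2 hv
    have hint : ∏ _u ∈ insert r (Finset.univ.biUnion fun v => (c v).elim ∅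
        fun s => NamedTree.interior t s v), Real.exp (-((a + b) / 2))
        = Real.exp (-((a + b) / 2)) *
          ∏ v, (c v).elim 1 fun s => ∏ _u ∈ NamedTree.interior t s v, Real.exp (-((a + b) / 2)) := by
      rw [Finset.prod_insert, prod_biUnion_elim c (fun v s => NamedTree.interior t s v)
        (fun _ => Real.exp (-((a + b) / 2)))]
      · intro v v' s s' hv hs hs'
        exact Finset.disjoint_of_subset_left (interior_subset_verts t s v)
          (Finset.disjoint_of_subset_right (interior_subset_verts t s' v')
            (hD.2 v v' s s' hv hs hs'))
      rw [Finset.mem_biUnion]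
      rintro ⟨v, _, hv⟩
      cases hs : c v with
      | none => simp [hs] at hv
      | some s =>
        rw [hs] at hv
        exact (hD.1 v s hs).2 (interior_subset_verts t s v hv)
    have hedge : ∏ e ∈ Finset.univ.biUnion fun v =>
        (c v).elim ∅ fun s => insert (sortedPair r v) (edges t s v), k e
        = ∏ v, (c v).elim 1 fun s =>
          edgeProb n a b (σ r) (σ v) * ∏ e ∈ edges t s v, k e := by
      rw [prod_biUnion_elim c (fun v s => insert (sortedPair r v) (edges t s v)) k]
      · refine Finset.prod_congr rfl fun v _ => ?_
        cases hs : c v with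
        | none => rfl
        | some s =>
          simp only [Option.elim]
          rw [Finset.prod_insert, hksym]
          intro hmem
          exact (hD.1 v s hs).2 (sortedPair_mem_iff.mp (mem_verts_of_mem_edges t s v hmem)).1
      · intro v v' s s' hv hs hs'
        have hall : ∀ v s, c v = some s → ∀ e ∈ insert (sortedPair r v) (edges t s v),
            (e.1 ∈ verts t s v ∨ e.2 ∈ verts t s v) ∧
            (e.1 = r ∨ e.1 ∈ verts t s v) ∧ (e.2 = r ∨ e.2 ∈ verts t s v) := by
          intro v s hs e he
          rcases Finset.mem_insert.mp he with rfl | he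
          · have hvv := root_mem_verts t s v
            unfold sortedPair
            split_ifs
            · exact ⟨Or.inr hvv, Or.inl rfl, Or.inr hvv⟩
            · exact ⟨Or.inl hvv, Or.inr hvv, Or.inl rfl⟩
          · obtain ⟨h1, h2⟩ := mem_verts_of_mem_edges t s v he
            exact ⟨Or.inl h1, Or.inr h1, Or.inr h2⟩
        rw [Finset.disjoint_left]
        intro e he he'
        obtain ⟨h1, -, -⟩ := hall v s hs e he
        obtain ⟨-, h2, h3⟩ := hall v' s' hs' e he'
        have hdis := Finset.disjoint_left.mp (hD.2 v v' s s' hv hs hs')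
        rcases h1 with h1 | h1
        · rcases h2 with h2 | h2
          · exact (hD.1 v s hs).2 (h2 ▸ h1)
          · exact hdis h1 h2
        · rcases h3 with h3 | h3
          · exact (hD.1 v s hs).2 (h3 ▸ h1)
          · exact hdis h1 h3
    rw [hvert, hint, hedge, hA.1]
    -- Each child has a factor 1/2 from the edge to its parent, which cancels the leading 2 of the
    -- inductive bound for its subtree. The root has no parent, hence the 2 that remains. The
    -- truncation makes this an inequality.
    have hstep : ∏ v, ((c v).elim 1 fun s =>
          edgeProb n a b (σ r) (rootLabel t s) / 2 * treeWeight n a b α t h s)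
        ≤ ∏ v, (((c v).elim 1 fun s => ∏ u ∈ verts t s v, ℓ u) *
          ((c v).elim 1 fun s => ∏ _u ∈ NamedTree.interior t s v, Real.exp (-((a + b) / 2))) *
          ((c v).elim 1 fun s => edgeProb n a b (σ r) (σ v) * ∏ e ∈ edges t s v, k e)) := by
      refine Finset.prod_le_prod (fun v _ => ?_) (fun v _ => ?_)
      · cases c v with
        | none => exact zero_le_one
        | some s =>
          simp only [Option.elim]
          exact mul_nonneg (div_nonneg (edgeProb_nonneg n ha hb _ _) zero_le_two)
            (treeWeight_nonneg ha hb t h s)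
      · cases hs : c v with
        | none => simp
        | some s =>
          simp only [Option.elim]
          have h1 := treeWeight_le_prod ha hb α σ σ' t h s v (hD.1 v s hs).1 (hA.2 v s hs)
          rw [(hA.2 v s hs).rootLabel_eq]
          have h2 : 0 ≤ edgeProb n a b (σ r) (σ v) / 2 :=
            div_nonneg (edgeProb_nonneg n ha hb _ _) zero_le_two
          calc _ ≤ edgeProb n a b (σ r) (σ v) / 2 * _ := mul_le_mul_of_nonneg_left h1 h2
            _ = _ := by ring
    rw [Finset.prod_mul_distrib, Finset.prod_mul_distrib] at hstep
    have h3 : 0 ≤ noiseProb α (σ r) (σ' r) * Real.exp (-((a + b) / 2)) :=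
      mul_nonneg (noiseProb_nonneg _ _ _) (Real.exp_pos _).le
    calc _ ≤ _ := mul_le_mul_of_nonneg_left hstep h3
      _ = _ := by
        simp only [hℓ]
        ring

end Unfolding

end SideInfo

end

noncomputable section

namespace SideInfo

open NamedTree
open Classical

/-! ### The block model as a product over pairs -/

section Pairs

variable {n : ℕ} {a b : ℝ} {α : unitInterval}

/-- The increasing pairs of vertices. -/
def pairs (n : ℕ) : Finset (Fin n × Fin n) := Finset.univ.filter fun e => e.1 < e.2

/-- The pairs that meet `I`. -/
def touching (I : Finset (Fin n)) : Finset (Fin n × Fin n) :=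
  (pairs n).filter fun e => e.1 ∈ I ∨ e.2 ∈ I

/-- The pairs that do not meet `I`. -/
def away (I : Finset (Fin n)) : Finset (Fin n × Fin n) :=
  (pairs n).filter fun e => ¬ (e.1 ∈ I ∨ e.2 ∈ I)

/-- The contribution of a pair of vertices to the probability of a graph. -/
def pairFactor (a b : ℝ) (σ : Fin n → Bool) (G : SimpleGraph (Fin n)) (e : Fin n × Fin n) : ℝ :=
  if G.Adj e.1 e.2 then edgeProb n a b (σ e.1) (σ e.2) else 1 - edgeProb n a b (σ e.1) (σ e.2)

/-- The contribution of a vertex to the probability of the labels. -/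
def labelFactor (α : unitInterval) (σ σ' : Fin n → Bool) (u : Fin n) : ℝ :=
  1 / 2 * noiseProb α (σ u) (σ' u)

lemma labelFactor_nonneg (σ σ' : Fin n → Bool) (u : Fin n) : 0 ≤ labelFactor α σ σ' u :=
  mul_nonneg (by norm_num) (noiseProb_nonneg _ _ _)

lemma edgeProb_le {M : ℝ} (haM : a ≤ M) (hbM : b ≤ M) (x y : Bool) :
    edgeProb n a b x y ≤ M / n := by
  unfold edgeProb
  split_ifs
  · exact div_le_div_of_nonneg_right haM (Nat.cast_nonneg n)
  · exact div_le_div_of_nonneg_right hbM (Nat.cast_nonneg n)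

lemma pairFactor_nonneg (ha : 0 ≤ a) (hb : 0 ≤ b) (h1 : ∀ x y, edgeProb n a b x y ≤ 1)
    (σ : Fin n → Bool) (G : SimpleGraph (Fin n)) (e : Fin n × Fin n) :
    0 ≤ pairFactor a b σ G e := by
  unfold pairFactor
  split_ifs
  · exact edgeProb_nonneg n ha hb _ _
  · linarith [h1 (σ e.1) (σ e.2)]

lemma sbmProb_eq (σ : Fin n → Bool) (G : SimpleGraph (Fin n)) (σ' : Fin n → Bool) :
    sbmProb n a b α σ G σ'
      = (∏ u, labelFactor α σ σ' u) * ∏ e ∈ pairs n, pairFactor a b σ G e := by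
  have h1 : ∏ u, labelFactor α σ σ' u = (1 / 2 : ℝ) ^ n * ∏ u, noiseProb α (σ u) (σ' u) := by
    unfold labelFactor
    rw [Finset.prod_mul_distrib, Finset.prod_const, Finset.card_univ, Fintype.card_fin]
  have h2 : ∏ e ∈ pairs n, pairFactor a b σ G e
      = ∏ i : Fin n, ∏ j ∈ Finset.Ioi i, pairFactor a b σ G (i, j) := by
    rw [pairs, Finset.prod_filter, Fintype.prod_prod_type]
    refine Finset.prod_congr rfl fun i _ => ?_
    rw [← Finset.prod_filter]
    refine Finset.prod_congr ?_ fun _ _ => rfl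
    ext j
    simp
  rw [h1, h2]
  unfold sbmProb pairFactor
  ring

lemma prod_touching_mul_prod_away (I : Finset (Fin n)) (k : Fin n × Fin n → ℝ) :
    (∏ e ∈ touching I, k e) * ∏ e ∈ away I, k e = ∏ e ∈ pairs n, k e :=
  Finset.prod_filter_mul_prod_filter_not _ _ _

/-- Sums over all graphs of products over pairs. -/
lemma sum_graph_prod (k : Fin n × Fin n → Bool → ℝ) :
    ∑ G : SimpleGraph (Fin n), ∏ e ∈ pairs n, k e (decide (G.Adj e.1 e.2))
      = ∏ e ∈ pairs n, (k e true + k e false) := by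
  rw [Finset.prod_add]
  refine Finset.sum_bij' (fun G _ => (pairs n).filter fun e => G.Adj e.1 e.2)
    (fun S _ => SimpleGraph.fromRel fun u w => (u, w) ∈ S) ?_ ?_ ?_ ?_ ?_
  · intro G _
    exact Finset.mem_powerset.mpr (Finset.filter_subset _ _)
  · intro S _
    exact Finset.mem_univ _
  · intro G _
    ext u w
    simp only [SimpleGraph.fromRel_adj, Finset.mem_filter, pairs, Finset.mem_univ, true_and]
    constructor
    · rintro ⟨_, ⟨_, h⟩ | ⟨_, h⟩⟩
      · exact h
      · exact h.symm
    · intro h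
      refine ⟨h.ne, ?_⟩
      rcases lt_or_gt_of_ne h.ne with h' | h'
      · exact Or.inl ⟨h', h⟩
      · exact Or.inr ⟨h', h.symm⟩
  · intro S hS
    have hS' := Finset.mem_powerset.mp hS
    ext ⟨u, w⟩
    have hlt : ∀ {u w : Fin n}, (u, w) ∈ S → u < w := fun h =>
      (Finset.mem_filter.mp (hS' h)).2
    simp only [SimpleGraph.fromRel_adj, Finset.mem_filter]
    constructor
    · rintro ⟨h1, _, h | h⟩
      · exact h
      · exact absurd (hlt h) (Finset.mem_filter.mp h1).2.not_gt
    · intro h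
      exact ⟨hS' h, (hlt h).ne, Or.inl h⟩
  · intro G _
    rw [← Finset.prod_filter_mul_prod_filter_not (pairs n) fun e => G.Adj e.1 e.2,
      ← Finset.filter_not]
    congr 1
    · refine Finset.prod_congr rfl fun e he => ?_
      rw [decide_eq_true (Finset.mem_filter.mp he).2]
    · refine Finset.prod_congr rfl fun e he => ?_
      rw [decide_eq_false (Finset.mem_filter.mp he).2]

/-- Among the pairs that meet `I`, the edges of `G` are those in `E`. -/
def LocalEdges (I : Finset (Fin n)) (E : Finset (Fin n × Fin n)) (G : SimpleGraph (Fin n)) :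
    Prop :=
  ∀ e ∈ touching I, (G.Adj e.1 e.2 ↔ e ∈ E)

/-- The pairs meeting `I` are prescribed and the others are free; the two options for a free pair
have probabilities adding up to 1. -/
lemma sum_localEdges (a b : ℝ) (I : Finset (Fin n)) (E : Finset (Fin n × Fin n))
    (σ : Fin n → Bool) :
    ∑ G : SimpleGraph (Fin n),
      (if LocalEdges I E G then ∏ e ∈ away I, pairFactor a b σ G e else 0) = 1 := by
  set k : Fin n × Fin n → Bool → ℝ := fun e y => if e.1 ∈ I ∨ e.2 ∈ I then
      (if (y = true ↔ e ∈ E) then 1 else 0) else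
      (if y = true then edgeProb n a b (σ e.1) (σ e.2) else 1 - edgeProb n a b (σ e.1) (σ e.2))
    with hk
  have h1 : ∀ G : SimpleGraph (Fin n),
      (if LocalEdges I E G then ∏ e ∈ away I, pairFactor a b σ G e else 0)
      = ∏ e ∈ pairs n, k e (decide (G.Adj e.1 e.2)) := by
    intro G
    rw [← prod_touching_mul_prod_away I]
    have h2 : ∏ e ∈ away I, k e (decide (G.Adj e.1 e.2)) = ∏ e ∈ away I, pairFactor a b σ G e := by
      refine Finset.prod_congr rfl fun e he => ?_
      simp only [hk, if_neg (Finset.mem_filter.mp he).2, pairFactor, decide_eq_true_eq]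
    have h3 : ∀ e ∈ touching I, k e (decide (G.Adj e.1 e.2))
        = if (G.Adj e.1 e.2 ↔ e ∈ E) then 1 else 0 := by
      intro e he
      simp only [hk, if_pos (Finset.mem_filter.mp he).2, decide_eq_true_eq]
    rw [h2, Finset.prod_congr rfl h3]
    split_ifs with hloc
    · rw [Finset.prod_eq_one fun e he => if_pos (hloc e he), one_mul]
    · unfold LocalEdges at hloc
      push Not at hloc
      obtain ⟨e, he, hloc⟩ := hloc
      rw [Finset.prod_eq_zero he, zero_mul]
      rw [if_neg]
      intro h
      rcases hloc with h' | h'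
      · exact h'.2 (h.mp h'.1)
      · exact h'.1 (h.mpr h'.2)
  simp_rw [h1]
  rw [sum_graph_prod]
  refine Finset.prod_eq_one fun e _ => ?_
  simp only [hk]
  by_cases h : e.1 ∈ I ∨ e.2 ∈ I
  · by_cases h' : e ∈ E <;> simp [h, h']
  · simp [h]

/-! ### Labels outside a fixed set, and their imbalance -/

lemma sum_pi_bool_prod (k : Fin n → Bool → ℝ) :
    ∑ σ : Fin n → Bool, ∏ u, k u (σ u) = ∏ u, (k u true + k u false) := by
  have h := Finset.prod_univ_sum (fun _ : Fin n => (Finset.univ : Finset Bool)) k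
  rw [Fintype.piFinset_univ] at h
  rw [← h]
  exact Finset.prod_congr rfl fun v _ => Fintype.sum_bool _

lemma ite_forall_eq_prod (B : Finset (Fin n)) (τ σ : Fin n → Bool) (k : Fin n → ℝ) :
    (if ∀ u ∈ B, σ u = τ u then ∏ u ∈ Bᶜ, k u else 0)
      = ∏ u, if u ∈ B then (if σ u = τ u then 1 else 0) else k u := by
  have h1 := Finset.prod_mul_prod_compl B
    fun u => if u ∈ B then (if σ u = τ u then 1 else 0) else k u
  have h2 : ∏ u ∈ Bᶜ, (if u ∈ B then (if σ u = τ u then 1 else 0) else k u) = ∏ u ∈ Bᶜ, k u :=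
    Finset.prod_congr rfl fun u hu => if_neg (Finset.mem_compl.mp hu)
  rw [← h1, h2]
  by_cases h : ∀ u ∈ B, σ u = τ u
  · have h3 : ∏ u ∈ B, (if u ∈ B then (if σ u = τ u then 1 else 0) else k u) = 1 :=
      Finset.prod_eq_one fun u hu => by rw [if_pos hu, if_pos (h u hu)]
    rw [if_pos h, h3, one_mul]
  · rw [if_neg h]
    push Not at h
    obtain ⟨u, hu, hne⟩ := h
    rw [Finset.prod_eq_zero hu (by rw [if_pos hu, if_neg hne]), zero_mul]

lemma sum_noisy_labels (B : Finset (Fin n)) (τ' σ : Fin n → Bool) :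
    ∑ σ' : Fin n → Bool,
      (if ∀ u ∈ B, σ' u = τ' u then ∏ u ∈ Bᶜ, labelFactor α σ σ' u else 0)
      = ∏ _u ∈ Bᶜ, (1 / 2 : ℝ) := by
  simp_rw [ite_forall_eq_prod]
  simp only [labelFactor]
  rw [sum_pi_bool_prod fun u y => if u ∈ B then (if y = τ' u then 1 else 0) else
    1 / 2 * noiseProb α (σ u) y, ← Finset.prod_mul_prod_compl B]
  rw [Finset.prod_eq_one, one_mul]
  · refine Finset.prod_congr rfl fun u hu => ?_
    have h := sum_noiseProb α (σ u)
    rw [Fintype.sum_bool] at h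
    rw [if_neg (Finset.mem_compl.mp hu), if_neg (Finset.mem_compl.mp hu), ← mul_add, h, mul_one]
  · intro u hu
    rw [if_pos hu, if_pos hu]
    cases τ' u <;> simp

/-- The law of the labels, uniform outside `B` and equal to `τ` on `B`. -/
def pinnedProb (B : Finset (Fin n)) (τ σ : Fin n → Bool) : ℝ :=
  if ∀ u ∈ B, σ u = τ u then ∏ _u ∈ Bᶜ, (1 / 2 : ℝ) else 0

lemma pinnedProb_nonneg (B : Finset (Fin n)) (τ σ : Fin n → Bool) : 0 ≤ pinnedProb B τ σ := by
  unfold pinnedProb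
  split_ifs
  · exact Finset.prod_nonneg fun _ _ => by norm_num
  · exact le_rfl

lemma sum_pinnedProb (B : Finset (Fin n)) (τ : Fin n → Bool) : ∑ σ, pinnedProb B τ σ = 1 := by
  unfold pinnedProb
  simp_rw [ite_forall_eq_prod]
  rw [sum_pi_bool_prod fun u y => if u ∈ B then (if y = τ u then 1 else 0) else 1 / 2]
  refine Finset.prod_eq_one fun u _ => ?_
  by_cases hu : u ∈ B
  · rw [if_pos hu, if_pos hu]
    cases τ u <;> simp
  · rw [if_neg hu, if_neg hu]
    norm_num

/-- The label as a sign. -/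
def sgn (y : Bool) : ℝ := if y then 1 else -1

/-- The imbalance of the labels outside `B`. -/
def imbalance (B : Finset (Fin n)) (σ : Fin n → Bool) : ℝ := ∑ u ∈ Bᶜ, sgn (σ u)

/-- Outside `B` the signs are independent and centred, so only the diagonal of the squared sum
survives. -/
lemma sum_pinnedProb_mul_imbalance_sq (B : Finset (Fin n)) (τ : Fin n → Bool) :
    ∑ σ, pinnedProb B τ σ * imbalance B σ ^ 2 ≤ n := by
  have key : ∀ u ∈ Bᶜ, ∀ w ∈ Bᶜ, ∑ σ, pinnedProb B τ σ * (sgn (σ u) * sgn (σ w))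
      = if u = w then 1 else 0 := by
    intro u hu w hw
    have hu' := Finset.mem_compl.mp hu
    have h1 : ∀ σ, pinnedProb B τ σ * (sgn (σ u) * sgn (σ w))
        = ∏ v, (if v ∈ B then (if σ v = τ v then 1 else 0) else 1 / 2) *
          ((if v = u then sgn (σ v) else 1) * (if v = w then sgn (σ v) else 1)) := by
      intro σ
      rw [Finset.prod_mul_distrib, Finset.prod_mul_distrib, Finset.prod_ite_eq',
        Finset.prod_ite_eq', pinnedProb, ite_forall_eq_prod]
      simp
    simp_rw [h1]
    rw [sum_pi_bool_prod fun v y => (if v ∈ B then (if y = τ v then 1 else 0) else 1 / 2) *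
          ((if v = u then sgn y else 1) * (if v = w then sgn y else 1))]
    split_ifs with huw
    · subst huw
      refine Finset.prod_eq_one fun v _ => ?_
      by_cases hv : v = u
      · subst hv
        simp only [if_neg hu', if_true, sgn]
        norm_num
      · simp only [if_neg hv, mul_one]
        by_cases hvB : v ∈ B
        · simp only [if_pos hvB]
          cases τ v <;> simp
        · simp only [if_neg hvB]
          norm_num
    · refine Finset.prod_eq_zero (Finset.mem_univ u) ?_
      simp only [if_neg hu', if_true, if_neg huw, sgn]
      norm_num
  calc _ = ∑ u ∈ Bᶜ, ∑ w ∈ Bᶜ, ∑ σ, pinnedProb B τ σ * (sgn (σ u) * sgn (σ w)) := by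
        have h : ∀ σ, imbalance B σ ^ 2 = ∑ u ∈ Bᶜ, ∑ w ∈ Bᶜ, sgn (σ u) * sgn (σ w) := fun σ => by
          rw [sq, imbalance, Finset.sum_mul_sum]
        simp only [h, Finset.mul_sum]
        rw [Finset.sum_comm]
        refine Finset.sum_congr rfl fun u _ => Finset.sum_comm
    _ = ∑ u ∈ Bᶜ, ∑ w ∈ Bᶜ, if u = w then 1 else 0 :=
        Finset.sum_congr rfl fun u hu => Finset.sum_congr rfl fun w hw => key u hu w hw
    _ = (Bᶜ.card : ℝ) := by
        rw [Finset.card_eq_sum_ones, Nat.cast_sum]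
        refine Finset.sum_congr rfl fun u hu => ?_
        rw [Finset.sum_ite_eq, if_pos hu, Nat.cast_one]
    _ ≤ n := by
        have := Finset.card_le_univ Bᶜ
        rw [Fintype.card_fin] at this
        exact_mod_cast this

lemma sum_pinnedProb_mul_abs_imbalance (hn : 0 < n) (B : Finset (Fin n)) (τ : Fin n → Bool) :
    ∑ σ, pinnedProb B τ σ * |imbalance B σ| ≤ Real.sqrt n := by
  have hn' : (0 : ℝ) < n := by exact_mod_cast hn
  have hs := Real.sqrt_pos.mpr hn'
  have hss := Real.mul_self_sqrt hn'.le
  have h1 : ∀ σ, pinnedProb B τ σ * |imbalance B σ|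
      ≤ 1 / (2 * Real.sqrt n) * (pinnedProb B τ σ * imbalance B σ ^ 2)
        + Real.sqrt n / 2 * pinnedProb B τ σ := by
    intro σ
    -- The inequality of arithmetic and geometric means at scale √n, in place of Cauchy-Schwarz.
    have h2 : |imbalance B σ| ≤ 1 / (2 * Real.sqrt n) * imbalance B σ ^ 2 + Real.sqrt n / 2 := by
      rw [← sq_abs, div_mul_eq_mul_div, one_mul, ← sub_le_iff_le_add, le_div_iff₀ (by positivity)]
      nlinarith [sq_nonneg (|imbalance B σ| - Real.sqrt n)]
    have h3 := mul_le_mul_of_nonneg_left h2 (pinnedProb_nonneg B τ σ)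
    linarith
  calc _ ≤ _ := Finset.sum_le_sum fun σ _ => h1 σ
    _ = 1 / (2 * Real.sqrt n) * (∑ σ, pinnedProb B τ σ * imbalance B σ ^ 2)
        + Real.sqrt n / 2 := by
        rw [Finset.sum_add_distrib, ← Finset.mul_sum, ← Finset.mul_sum, sum_pinnedProb, mul_one]
    _ ≤ 1 / (2 * Real.sqrt n) * n + Real.sqrt n / 2 := by
        have := sum_pinnedProb_mul_imbalance_sq B τ
        gcongr
    _ = Real.sqrt n := by
        have : (n : ℝ) = Real.sqrt n * Real.sqrt n := hss.symm
        rw [div_mul_eq_mul_div, one_mul]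
        nth_rewrite 1 [this]
        field_simp
        ring

/-- A lower bound for the effect of the pairs that are not edges. -/
def slack (n : ℕ) (M K : ℝ) (B : Finset (Fin n)) (σ : Fin n → Bool) : ℝ :=
  -- The imbalance is taken outside `B` only, so that this factor does not depend on the labels of
  -- the tree. The labels in `B` are accounted for by the summand `K`.
  max 0 (1 - K * ((M * (|imbalance B σ| + K) + 2 * M ^ 2) / n))

lemma sum_pinnedProb_mul_slack_ge (hn : 0 < n) {M K : ℝ} (hM : 0 ≤ M) (hK : 0 ≤ K)
    (B : Finset (Fin n)) (τ : Fin n → Bool) :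
    1 - K * ((M * (Real.sqrt n + K) + 2 * M ^ 2) / n)
      ≤ ∑ σ, pinnedProb B τ σ * slack n M K B σ := by
  have hn' : (0 : ℝ) < n := by exact_mod_cast hn
  have h1 : ∀ σ, (1 - K * ((M * K + 2 * M ^ 2) / n)) * pinnedProb B τ σ
      - K * M / n * (pinnedProb B τ σ * |imbalance B σ|)
      ≤ pinnedProb B τ σ * slack n M K B σ := by
    intro σ
    have h2 := mul_le_mul_of_nonneg_left
      (le_max_right 0 (1 - K * ((M * (|imbalance B σ| + K) + 2 * M ^ 2) / n)))
      (pinnedProb_nonneg B τ σ)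
    refine le_trans (le_of_eq ?_) h2
    ring
  refine le_trans ?_ (Finset.sum_le_sum fun σ _ => h1 σ)
  rw [Finset.sum_sub_distrib, ← Finset.mul_sum, ← Finset.mul_sum, sum_pinnedProb, mul_one]
  have h3 := sum_pinnedProb_mul_abs_imbalance hn B τ
  have h4 : 0 ≤ K * M / n := by positivity
  have h5 := mul_le_mul_of_nonneg_left h3 h4
  have h6 : K * ((M * (Real.sqrt n + K) + 2 * M ^ 2) / n)
      = K * ((M * K + 2 * M ^ 2) / n) + K * M / n * Real.sqrt n := by ring
  linarith

/-! ### Probability that the remaining pairs are non-edges -/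

lemma one_sub_ge_exp {p : ℝ} (hp : p ≤ 1 / 2) :
    Real.exp (-(p + 2 * p ^ 2)) ≤ 1 - p := by
  have h1 : 0 < 1 - p := by linarith
  rw [← Real.le_log_iff_exp_le h1]
  refine le_trans ?_ (Real.one_sub_inv_le_log_of_pos h1)
  rw [le_sub_comm, inv_le_iff_one_le_mul₀ h1]
  nlinarith [mul_nonneg (sq_nonneg p) (by linarith : 0 ≤ 1 - 2 * p)]

/-- The non-edges at a vertex. -/
lemma prod_nonedges_ge (hn : 0 < n) (ha : 0 ≤ a) (hb : 0 ≤ b) {M : ℝ} (haM : a ≤ M)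
    (hbM : b ≤ M) (hMn : M / n ≤ 1 / 2) (σ : Fin n → Bool) (x : Bool) :
    Real.exp (-((a + b) / 2 + (M * |∑ w, sgn (σ w)| + 2 * M ^ 2) / n))
      ≤ ∏ w, (1 - edgeProb n a b x (σ w)) := by
  have hn' : (0 : ℝ) < n := by exact_mod_cast hn
  have hM : 0 ≤ M := ha.trans haM
  have hp0 : ∀ w, 0 ≤ edgeProb n a b x (σ w) := fun w => edgeProb_nonneg n ha hb _ _
  have hpM : ∀ w, edgeProb n a b x (σ w) ≤ M / n := fun w => edgeProb_le haM hbM _ _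
  calc _ ≤ Real.exp (∑ w, -(edgeProb n a b x (σ w) + 2 * edgeProb n a b x (σ w) ^ 2)) := by
        rw [Real.exp_le_exp, Finset.sum_neg_distrib, neg_le_neg_iff, Finset.sum_add_distrib]
        -- Splits the edge probability into its mean over the two labels and a signed part. Summed
        -- over `w`, the first gives (a+b)/2 and the second is proportional to the total imbalance.
        have h1 : ∀ w, edgeProb n a b x (σ w)
            = (a + b) / 2 / n + sgn x * (a - b) / 2 / n * sgn (σ w) := by
          intro w
          cases x <;> cases σ w <;> simp [edgeProb, sgn] <;> ring
        have h2 : ∑ w, edgeProb n a b x (σ w)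
            = (a + b) / 2 + sgn x * (a - b) / 2 / n * ∑ w, sgn (σ w) := by
          rw [Finset.sum_congr rfl fun w _ => h1 w, Finset.sum_add_distrib, ← Finset.mul_sum,
            Finset.sum_const, Finset.card_univ, Fintype.card_fin, nsmul_eq_mul]
          field_simp
        have h3 : |sgn x * (a - b) / 2 / n| ≤ M / n := by
          rw [abs_div, Nat.abs_cast, abs_div, abs_mul]
          have h4 : |sgn x| = 1 := by cases x <;> simp [sgn]
          have h5 : |a - b| ≤ M := abs_le.mpr ⟨by linarith, by linarith⟩
          rw [h4, one_mul, abs_two]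
          refine div_le_div_of_nonneg_right ?_ hn'.le
          linarith
        have h4 : sgn x * (a - b) / 2 / n * ∑ w, sgn (σ w) ≤ M / n * |∑ w, sgn (σ w)| := by
          refine (le_abs_self _).trans ?_
          rw [abs_mul]
          exact mul_le_mul_of_nonneg_right h3 (abs_nonneg _)
        have h5 : ∑ w, 2 * edgeProb n a b x (σ w) ^ 2 ≤ 2 * M ^ 2 / n := by
          calc _ ≤ ∑ _w : Fin n, 2 * (M / n) ^ 2 := Finset.sum_le_sum fun w _ =>
                mul_le_mul_of_nonneg_left (pow_le_pow_left₀ (hp0 w) (hpM w) 2) zero_le_two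
            _ = _ := by
                rw [Finset.sum_const, Finset.card_univ, Fintype.card_fin, nsmul_eq_mul]
                field_simp
        have h6 : (M * |∑ w, sgn (σ w)| + 2 * M ^ 2) / n
            = M / n * |∑ w, sgn (σ w)| + 2 * M ^ 2 / n := by ring
        rw [h2, h6]
        linarith
    _ ≤ _ := by
        rw [Real.exp_sum]
        exact Finset.prod_le_prod (fun w _ => (Real.exp_pos _).le)
          fun w _ => one_sub_ge_exp ((hpM w).trans hMn)

/-- Orienting each pair so that it starts in `I` embeds `X` into the ordered pairs on the left. The
surplus factors, such as diagonal pairs, are at most 1. -/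
lemma prod_nonedges_touching_ge (h0 : ∀ x y, 0 ≤ edgeProb n a b x y)
    (h1 : ∀ x y, edgeProb n a b x y ≤ 1) (I : Finset (Fin n)) (X : Finset (Fin n × Fin n))
    (hX : X ⊆ touching I) (σ : Fin n → Bool) :
    ∏ u ∈ I, ∏ w, (1 - edgeProb n a b (σ u) (σ w))
      ≤ ∏ e ∈ X, (1 - edgeProb n a b (σ e.1) (σ e.2)) := by
  set k : Fin n × Fin n → ℝ := fun e => 1 - edgeProb n a b (σ e.1) (σ e.2) with hk
  have hk0 : ∀ e, 0 ≤ k e := fun e => by simp only [hk]; linarith [h1 (σ e.1) (σ e.2)]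
  have hk1 : ∀ e, k e ≤ 1 := fun e => by simp only [hk]; linarith [h0 (σ e.1) (σ e.2)]
  set ι : Fin n × Fin n → Fin n × Fin n := fun e => if e.1 ∈ I then e else (e.2, e.1) with hι
  have hι_inj : Set.InjOn ι X := by
    intro e he e' he' h
    have hlt := (Finset.mem_filter.mp (Finset.mem_filter.mp (hX he)).1).2
    have hlt' := (Finset.mem_filter.mp (Finset.mem_filter.mp (hX he')).1).2
    simp only [hι] at h
    split_ifs at h with h2 h3 h3
    · exact h
    · rw [h] at hlt
      exact absurd hlt hlt'.not_gt
    · rw [← h] at hlt'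
      exact absurd hlt' hlt.not_gt
    · rw [Prod.mk.injEq] at h
      exact Prod.ext h.2 h.1
  have hιk : ∀ e, k (ι e) = k e := by
    intro e
    simp only [hk, hι]
    split_ifs
    · rfl
    · simp only [edgeProb, eq_comm]
  have hsub : X.image ι ⊆ I ×ˢ Finset.univ := by
    intro e he
    obtain ⟨e', he', rfl⟩ := Finset.mem_image.mp he
    rw [Finset.mem_product]
    refine ⟨?_, Finset.mem_univ _⟩
    simp only [hι]
    split_ifs with h2
    · exact h2
    · exact (Finset.mem_filter.mp (hX he')).2.resolve_left h2
  calc _ = ∏ e ∈ I ×ˢ Finset.univ, k e := by rw [Finset.prod_product]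
    _ ≤ ∏ e ∈ X.image ι, k e := by
        rw [← Finset.prod_sdiff hsub]
        exact mul_le_of_le_one_left (Finset.prod_nonneg fun e _ => hk0 e)
          (Finset.prod_le_one (fun e _ => hk0 e) fun e _ => hk1 e)
    _ = ∏ e ∈ X, k e := by
        rw [Finset.prod_image hι_inj]
        exact Finset.prod_congr rfl fun e _ => hιk e

/-- Each interior vertex contributes at least e^{-(a+b)/2}·e^{-λ}, with λ governed by the sum of all
signs, which differs from the imbalance by at most K. The `slack` is a linear lower bound for the
product of the at most K factors e^{-λ}. -/
lemma slack_mul_le (hn : 0 < n) (ha : 0 ≤ a) (hb : 0 ≤ b) {M : ℝ} (haM : a ≤ M)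
    (hbM : b ≤ M) (hMn : M / n ≤ 1 / 2) {K : ℕ} (σ : Fin n → Bool) (B I : Finset (Fin n))
    (hIB : I ⊆ B) (hBK : B.card ≤ K) (X : Finset (Fin n × Fin n)) (hX : X ⊆ touching I) :
    (∏ _u ∈ I, Real.exp (-((a + b) / 2))) * slack n M K B σ
      ≤ ∏ e ∈ X, (1 - edgeProb n a b (σ e.1) (σ e.2)) := by
  have hn' : (0 : ℝ) < n := by exact_mod_cast hn
  have hM : 0 ≤ M := ha.trans haM
  have hp1 : ∀ x y, edgeProb n a b x y ≤ 1 := fun x y =>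
    (edgeProb_le haM hbM x y).trans (hMn.trans (by norm_num))
  have hBK' : (B.card : ℝ) ≤ K := by exact_mod_cast hBK
  have hIK' : (I.card : ℝ) ≤ K := le_trans (by exact_mod_cast Finset.card_le_card hIB) hBK'
  set S := ∑ w, sgn (σ w)
  have hS : |S| ≤ |imbalance B σ| + K := by
    have h1 : S = ∑ w ∈ B, sgn (σ w) + imbalance B σ :=
      (Finset.sum_add_sum_compl B _).symm
    have h2 : |∑ w ∈ B, sgn (σ w)| ≤ B.card := by
      refine (Finset.abs_sum_le_sum_abs _ _).trans ?_
      rw [Finset.card_eq_sum_ones, Nat.cast_sum]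
      refine Finset.sum_le_sum fun w _ => ?_
      cases σ w <;> simp [sgn]
    rw [h1]
    have := abs_add_le (∑ w ∈ B, sgn (σ w)) (imbalance B σ)
    linarith
  set lam := (M * |S| + 2 * M ^ 2) / n with hlam
  have hlam0 : 0 ≤ lam := by positivity
  have hlamle : lam ≤ (M * (|imbalance B σ| + K) + 2 * M ^ 2) / n := by
    refine div_le_div_of_nonneg_right ?_ hn'.le
    have := mul_le_mul_of_nonneg_left hS hM
    linarith
  refine le_trans ?_ (prod_nonedges_touching_ge (fun x y => edgeProb_nonneg n ha hb x y)
    hp1 I X hX σ)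
  calc (∏ _u ∈ I, Real.exp (-((a + b) / 2))) * slack n M K B σ
      ≤ (∏ _u ∈ I, Real.exp (-((a + b) / 2))) * ∏ _u ∈ I, Real.exp (-lam) := by
        refine mul_le_mul_of_nonneg_left ?_ (Finset.prod_nonneg fun _ _ => (Real.exp_pos _).le)
        rw [Finset.prod_const, ← Real.exp_nat_mul]
        refine max_le (Real.exp_pos _).le ?_
        refine le_trans ?_ (Real.add_one_le_exp _)
        have h1 : (I.card : ℝ) * lam ≤ K * ((M * (|imbalance B σ| + K) + 2 * M ^ 2) / n) :=
          mul_le_mul hIK' hlamle hlam0 (Nat.cast_nonneg _)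
        linarith
    _ = ∏ _u ∈ I, Real.exp (-((a + b) / 2 + lam)) := by
        rw [← Finset.prod_mul_distrib]
        refine Finset.prod_congr rfl fun u _ => ?_
        rw [← Real.exp_add, neg_add]
    _ ≤ _ := Finset.prod_le_prod (fun _ _ => (Real.exp_pos _).le)
        fun u _ => prod_nonedges_ge hn ha hb haM hbM hMn σ (σ u)

end Pairs

end SideInfo

end

noncomputable section

namespace SideInfo

open NamedTree
open Classical

/-! ### Comparison of the neighbourhoods with the named trees -/

section Local

variable {n : ℕ} {a b : ℝ} {α : unitInterval}

/-- An outcome of the block model: labels, graph, noisy labels. -/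
abbrev Outcome (n : ℕ) : Type := (Fin n → Bool) × SimpleGraph (Fin n) × (Fin n → Bool)

/-- The probability of an outcome. -/
def outcomeProb (n : ℕ) (a b : ℝ) (α : unitInterval) (ω : Outcome n) : ℝ :=
  sbmProb n a b α ω.1 ω.2.1 ω.2.2

lemma sum_outcome (k : Outcome n → ℝ) :
    ∑ ω, k ω = ∑ σ : Fin n → Bool, ∑ G : SimpleGraph (Fin n), ∑ σ' : Fin n → Bool,
      k (σ, G, σ') := by
  rw [Fintype.sum_prod_type]
  exact Finset.sum_congr rfl fun σ _ => Fintype.sum_prod_type _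

lemma outcomeProb_nonneg (ha : 0 ≤ a) (hb : 0 ≤ b) (h1 : ∀ x y, edgeProb n a b x y ≤ 1)
    (ω : Outcome n) : 0 ≤ outcomeProb n a b α ω := by
  unfold outcomeProb
  rw [sbmProb_eq]
  exact mul_nonneg (Finset.prod_nonneg fun _ _ => labelFactor_nonneg _ _ _)
    (Finset.prod_nonneg fun _ _ => pairFactor_nonneg ha hb h1 _ _ _)

lemma sum_outcomeProb : ∑ ω, outcomeProb n a b α ω = 1 := by
  rw [sum_outcome]
  have h1 : ∀ σ G, ∑ σ', outcomeProb n a b α (σ, G, σ')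
      = (∏ _u : Fin n, (1 / 2 : ℝ)) * ∏ e ∈ pairs n, pairFactor a b σ G e := by
    intro σ G
    have h2 := sum_noisy_labels (α := α) ∅ (fun _ => true) σ
    simp only [Finset.notMem_empty, false_imp_iff, implies_true, if_true, Finset.compl_empty] at h2
    unfold outcomeProb
    simp only [sbmProb_eq]
    rw [← Finset.sum_mul, h2]
  have h3 : ∀ σ, ∑ G, ∏ e ∈ pairs n, pairFactor a b σ G e = 1 := by
    intro σ
    have h4 := sum_localEdges a b ∅ ∅ σ
    have h5 : away (∅ : Finset (Fin n)) = pairs n := by simp [away]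
    have h6 : ∀ G : SimpleGraph (Fin n), LocalEdges ∅ ∅ G := by
      intro G e he
      simp [touching] at he
    simp only [h6, if_true, h5] at h4
    exact h4
  simp only [h1, ← Finset.mul_sum, h3, mul_one]
  simp

/-- The outcome has the tree `x` as its neighbourhood of `r`. -/
def Matches (t : ℕ) (x : LNamedTree n t) (r : Fin n) (ω : Outcome n) : Prop :=
  Agrees ω.1 ω.2.2 t x r ∧ LocalEdges (NamedTree.interior t x r) (edges t x r) ω.2.1

/-- The conditional weight of an outcome outside of the vertices `B` and of the pairs that
meet `I`. -/
def residual (a b : ℝ) (α : unitInterval) (M K : ℝ) (I B : Finset (Fin n)) (ω : Outcome n) : ℝ :=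
  (∏ e ∈ away I, pairFactor a b ω.1 ω.2.1 e) * (∏ u ∈ Bᶜ, labelFactor α ω.1 ω.2.2 u) *
    slack n M K B ω.1

lemma residual_nonneg (ha : 0 ≤ a) (hb : 0 ≤ b) (h1 : ∀ x y, edgeProb n a b x y ≤ 1) {M K : ℝ}
    (I B : Finset (Fin n)) (ω : Outcome n) : 0 ≤ residual a b α M K I B ω :=
  mul_nonneg (mul_nonneg (Finset.prod_nonneg fun _ _ => pairFactor_nonneg ha hb h1 _ _ _)
    (Finset.prod_nonneg fun _ _ => labelFactor_nonneg _ _ _)) (le_max_left _ _)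

lemma unfolding_eq_of_matches {t : ℕ} {x : LNamedTree n t} {r : Fin n} {ω : Outcome n}
    (hD : Distinct t x r) (hm : Matches t x r ω) : unfolding ω.2.1 ω.1 ω.2.2 t r none = x := by
  refine unfolding_eq _ _ _ t x r none hD hm.1 ?_ (fun _ _ => by simp)
  intro u hu w huw
  simp only [reduceCtorEq, and_false, or_false]
  have hp : sortedPair u w ∈ touching (NamedTree.interior t x r) := by
    unfold sortedPair touching pairs
    rcases lt_or_gt_of_ne huw with h | h
    · simp [h, hu]
    · simp [h, h.not_gt, hu]
  rw [← hm.2 _ hp]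
  unfold sortedPair
  split_ifs
  · rfl
  · exact SimpleGraph.adj_comm _ _ _

/-- The probability of a matching outcome splits into the labels and edges of the tree, the
non-edges at its interior, and everything else. The tree weight covers the first group and
`slack_mul_le` the second; the third belongs to the residual weight. -/
lemma treeWeight_mul_residual_le (hn : 0 < n) (ha : 0 ≤ a) (hb : 0 ≤ b) {M : ℝ} (haM : a ≤ M)
    (hbM : b ≤ M) (hMn : M / n ≤ 1 / 2) {K : ℕ} (t h : ℕ) {x : LNamedTree n t} {r : Fin n}
    {ω : Outcome n} (hD : Distinct t x r) (hK : (verts t x r).card ≤ K)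
    (hm : Matches t x r ω) :
    1 / 2 * treeWeight n a b α t h x *
        residual a b α M K (NamedTree.interior t x r) (verts t x r) ω
      ≤ outcomeProb n a b α ω := by
  obtain ⟨σ, G, σ'⟩ := ω
  obtain ⟨hA, hE⟩ := hm
  have hp1 : ∀ x y, edgeProb n a b x y ≤ 1 := fun x y =>
    (edgeProb_le haM hbM x y).trans (hMn.trans (by norm_num))
  set I := NamedTree.interior t x r with hI
  set B := verts t x r with hB
  set E := edges t x r with hEdef
  have hW := treeWeight_le_prod ha hb α σ σ' t h x r hD hA
  have hsub : E ⊆ touching I := by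
    intro e he
    refine Finset.mem_filter.mpr ⟨Finset.mem_filter.mpr ⟨Finset.mem_univ _, ?_⟩, ?_⟩
    · exact lt_of_mem_edges t x r hD he
    · exact touches_of_mem_edges t x r he
  have hs := slack_mul_le hn ha hb haM hbM hMn σ B I (interior_subset_verts t x r) hK
    (touching I \ E) Finset.sdiff_subset
  have h1 : ∏ e ∈ touching I, pairFactor a b σ G e
      = (∏ e ∈ touching I \ E, (1 - edgeProb n a b (σ e.1) (σ e.2))) *
        ∏ e ∈ E, edgeProb n a b (σ e.1) (σ e.2) := by
    rw [← Finset.prod_sdiff hsub]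
    congr 1
    · refine Finset.prod_congr rfl fun e he => if_neg fun hadj => ?_
      rw [Finset.mem_sdiff] at he
      exact he.2 ((hE e he.1).mp hadj)
    · exact Finset.prod_congr rfl fun e he => if_pos ((hE e (hsub he)).mpr he)
  unfold outcomeProb residual
  rw [sbmProb_eq, ← prod_touching_mul_prod_away I, h1, ← Finset.prod_mul_prod_compl B]
  have hA0 : 0 ≤ ∏ e ∈ away I, pairFactor a b σ G e :=
    Finset.prod_nonneg fun _ _ => pairFactor_nonneg ha hb hp1 _ _ _
  have hL0 : 0 ≤ ∏ u ∈ Bᶜ, labelFactor α σ σ' u :=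
    Finset.prod_nonneg fun _ _ => labelFactor_nonneg _ _ _
  have hB0 : 0 ≤ ∏ u ∈ B, labelFactor α σ σ' u :=
    Finset.prod_nonneg fun _ _ => labelFactor_nonneg _ _ _
  have hE0 : 0 ≤ ∏ e ∈ E, edgeProb n a b (σ e.1) (σ e.2) :=
    Finset.prod_nonneg fun _ _ => edgeProb_nonneg n ha hb _ _
  have hS0 : 0 ≤ slack n M K B σ := le_max_left _ _
  have hW' : treeWeight n a b α t h x ≤ 2 * (∏ u ∈ B, labelFactor α σ σ' u) *
      (∏ _u ∈ I, Real.exp (-((a + b) / 2))) * ∏ e ∈ E, edgeProb n a b (σ e.1) (σ e.2) := hW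
  dsimp only
  generalize (∏ e ∈ away I, pairFactor a b σ G e) = A at *
  generalize (∏ u ∈ Bᶜ, labelFactor α σ σ' u) = L at *
  generalize (∏ u ∈ B, labelFactor α σ σ' u) = L' at *
  generalize (∏ e ∈ E, edgeProb n a b (σ e.1) (σ e.2)) = E' at *
  generalize slack n M K B σ = S at *
  generalize (∏ e ∈ touching I \ E, (1 - edgeProb n a b (σ e.1) (σ e.2))) = X at *
  generalize (∏ _u ∈ I, Real.exp (-((a + b) / 2))) = D at *
  calc _ ≤ 1 / 2 * (2 * L' * D * E') * (A * L * S) := by gcongr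
    _ = (L' * L * E' * A) * (D * S) := by ring
    _ ≤ (L' * L * E' * A) * X := by gcongr
    _ = _ := by ring

/-- The mass of the outcomes that match `x` and where `f` has the value `y`. -/
def matchMass (a b : ℝ) (α : unitInterval) (M K : ℝ) (f : SimpleGraph (Fin n) → (Fin n → Bool) → Bool)
    (t : ℕ) (x : LNamedTree n t) (r : Fin n) (y : Bool) : ℝ :=
  ∑ ω : Outcome n, if Matches t x r ω then
    residual a b α M K (NamedTree.interior t x r) (verts t x r) ω *
      (if f ω.2.1 ω.2.2 = y then 1 else 0) else 0

/-- Apart from the slack, the residual weight is a probability law on the outcomes that match `x`: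
the graph away from the interior and the noisy labels sum out. What remains is the mean slack under
uniform labels outside the tree. -/
lemma sum_residual_ge (hn : 0 < n) {M K : ℝ} (hM : 0 ≤ M) (hK : 0 ≤ K)
    (t : ℕ) (x : LNamedTree n t) (r : Fin n) (hD : Distinct t x r) :
    1 - K * ((M * (Real.sqrt n + K) + 2 * M ^ 2) / n)
      ≤ ∑ ω : Outcome n, if Matches t x r ω then
        residual a b α M K (NamedTree.interior t x r) (verts t x r) ω else 0 := by
  obtain ⟨τ, τ', hτ⟩ := exists_labels t x r hD
  refine (sum_pinnedProb_mul_slack_ge hn hM hK (verts t x r) τ).trans (le_of_eq ?_)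
  rw [sum_outcome]
  refine Finset.sum_congr rfl fun σ _ => ?_
  set I := NamedTree.interior t x r
  set B := verts t x r
  have h1 : ∀ (G : SimpleGraph (Fin n)) (σ' : Fin n → Bool),
      (if Matches t x r (σ, G, σ') then residual a b α M K I B (σ, G, σ') else 0)
      = (if ∀ u ∈ B, σ u = τ u then slack n M K B σ else 0) *
        ((if LocalEdges I (edges t x r) G then ∏ e ∈ away I, pairFactor a b σ G e else 0) *
          (if ∀ u ∈ B, σ' u = τ' u then ∏ u ∈ Bᶜ, labelFactor α σ σ' u else 0)) := by
    intro G σ'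
    have h2 : Matches t x r (σ, G, σ') ↔ (∀ u ∈ B, σ u = τ u) ∧ LocalEdges I (edges t x r) G ∧
        ∀ u ∈ B, σ' u = τ' u := by
      unfold Matches
      dsimp only
      rw [hτ]
      constructor
      · rintro ⟨h, h'⟩
        exact ⟨fun u hu => (h u hu).1, h', fun u hu => (h u hu).2⟩
      · rintro ⟨h, h', h''⟩
        exact ⟨fun u hu => ⟨h u hu, h'' u hu⟩, h'⟩
    simp only [h2]
    by_cases p1 : ∀ u ∈ B, σ u = τ u
    · by_cases p2 : LocalEdges I (edges t x r) G
      · by_cases p3 : ∀ u ∈ B, σ' u = τ' u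
        · rw [if_pos ⟨p1, p2, p3⟩, if_pos p1, if_pos p2, if_pos p3]
          unfold residual
          ring
        · rw [if_neg fun h => p3 h.2.2, if_neg p3, mul_zero, mul_zero]
      · rw [if_neg fun h => p2 h.2.1, if_neg p2, zero_mul, mul_zero]
    · rw [if_neg fun h => p1 h.1, if_neg p1, zero_mul]
  simp only [h1, ← Finset.mul_sum]
  rw [sum_noisy_labels, ← Finset.sum_mul, sum_localEdges, one_mul, pinnedProb]
  by_cases p1 : ∀ u ∈ B, σ u = τ u
  · rw [if_pos p1, if_pos p1, mul_comm]
  · rw [if_neg p1, if_neg p1, zero_mul, zero_mul]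

lemma matchMass_nonneg (ha : 0 ≤ a) (hb : 0 ≤ b) (h1 : ∀ x y, edgeProb n a b x y ≤ 1) (M K : ℝ)
    (f : SimpleGraph (Fin n) → (Fin n → Bool) → Bool) (t : ℕ) (x : LNamedTree n t) (r : Fin n)
    (y : Bool) : 0 ≤ matchMass a b α M K f t x r y := by
  refine Finset.sum_nonneg fun ω _ => ?_
  split_ifs
  · simpa using residual_nonneg ha hb h1 _ _ ω
  · simp
  · exact le_rfl

lemma matchMass_add (M K : ℝ) (f : SimpleGraph (Fin n) → (Fin n → Bool) → Bool)
    (t : ℕ) (x : LNamedTree n t) (r : Fin n) :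
    matchMass a b α M K f t x r true + matchMass a b α M K f t x r false
      = ∑ ω : Outcome n, if Matches t x r ω then
        residual a b α M K (NamedTree.interior t x r) (verts t x r) ω else 0 := by
  unfold matchMass
  rw [← Finset.sum_add_distrib]
  refine Finset.sum_congr rfl fun ω _ => ?_
  by_cases hm : Matches t x r ω
  · simp only [if_pos hm]
    cases f ω.2.1 ω.2.2 <;> simp
  · simp only [if_neg hm, add_zero]

/-- The mass of the outcomes depends on the tree only through the observation. -/
lemma matchMass_eq_of_observation_eq (M K : ℝ)
    (f : SimpleGraph (Fin n) → (Fin n → Bool) → Bool) (t : ℕ) (x₁ x₂ : LNamedTree n t) (r : Fin n)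
    (h1 : Distinct t x₁ r) (h2 : Distinct t x₂ r)
    (h : map Prod.snd id t x₁ = map Prod.snd id t x₂) (y : Bool) :
    matchMass a b α M K f t x₁ r y = matchMass a b α M K f t x₂ r y := by
  obtain ⟨τ₁, τ₁', hτ₁⟩ := exists_labels t x₁ r h1
  obtain ⟨τ₂, τ₂', hτ₂⟩ := exists_labels t x₂ r h2
  have hlab := labels_eq_of_observation_eq t x₁ x₂ r h
    ((hτ₁ τ₁ τ₁').mpr fun u _ => ⟨rfl, rfl⟩) ((hτ₂ τ₂ τ₂').mpr fun u _ => ⟨rfl, rfl⟩)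
  have hI : NamedTree.interior t x₂ r = NamedTree.interior t x₁ r := by
    rw [← interior_map Prod.snd id t x₂, ← h, interior_map]
  have hB : verts t x₂ r = verts t x₁ r := by
    rw [← verts_map Prod.snd id t x₂, ← h, verts_map]
  have hE : edges t x₂ r = edges t x₁ r := by
    rw [← edges_map Prod.snd id t x₂, ← h, edges_map]
  have hIB := interior_subset_verts t x₁ r
  unfold matchMass Matches
  rw [hI, hB, hE]
  simp only [hτ₁, hτ₂, hB]
  set I := NamedTree.interior t x₁ r
  set B := verts t x₁ r
  -- The involution flips the interior labels on which the two trees differ. It exchanges the label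
  -- conditions of the two trees and leaves the graph and the noisy labels, hence the answer of `f`,
  -- unchanged.
  set φ : (Fin n → Bool) → Fin n → Bool := fun σ u =>
    if u ∈ I then xor (σ u) (xor (τ₁ u) (τ₂ u)) else σ u with hφ
  have hinv : Function.Involutive φ := by
    intro σ
    funext u
    simp only [hφ]
    split_ifs
    · cases σ u <;> cases τ₁ u <;> cases τ₂ u <;> rfl
    · rfl
  have hout : ∀ σ u, u ∉ I → φ σ u = σ u := fun σ u hu => if_neg hu
  have houtB : ∀ σ u, u ∈ Bᶜ → φ σ u = σ u := fun σ u hu =>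
    hout σ u fun h => Finset.mem_compl.mp hu (hIB h)
  rw [sum_outcome, sum_outcome, ← Equiv.sum_comp hinv.toPerm]
  refine Finset.sum_congr rfl fun σ _ => Finset.sum_congr rfl fun G _ =>
    Finset.sum_congr rfl fun σ' _ => ?_
  change (if (∀ u ∈ B, φ σ u = τ₁ u ∧ σ' u = τ₁' u) ∧ LocalEdges I (edges t x₁ r) G then
      residual a b α M K I B (φ σ, G, σ') * (if f G σ' = y then 1 else 0) else 0)
    = if (∀ u ∈ B, σ u = τ₂ u ∧ σ' u = τ₂' u) ∧ LocalEdges I (edges t x₁ r) G then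
      residual a b α M K I B (σ, G, σ') * (if f G σ' = y then 1 else 0) else 0
  have hc : (∀ u ∈ B, φ σ u = τ₁ u ∧ σ' u = τ₁' u) ↔ ∀ u ∈ B, σ u = τ₂ u ∧ σ' u = τ₂' u := by
    refine forall₂_congr fun u hu => ?_
    obtain ⟨h3, h4⟩ := hlab u hu
    rw [h3]
    refine and_congr_left fun _ => ?_
    by_cases huI : u ∈ I
    · simp only [hφ, if_pos huI]
      cases σ u <;> cases τ₁ u <;> cases τ₂ u <;> simp
    · rw [hout σ u huI, h4 huI]
  -- The residual weight involves only labels outside the interior: the remaining pairs avoid `I`,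
  -- while label factors and slack live outside `B`.
  have hr : residual a b α M K I B (φ σ, G, σ') = residual a b α M K I B (σ, G, σ') := by
    unfold residual slack imbalance labelFactor pairFactor
    dsimp only
    have e1 : ∀ e ∈ away I, φ σ e.1 = σ e.1 ∧ φ σ e.2 = σ e.2 := by
      intro e he
      have h5 := (Finset.mem_filter.mp he).2
      push Not at h5
      exact ⟨hout σ _ h5.1, hout σ _ h5.2⟩
    congr 1
    · congr 1
      · exact Finset.prod_congr rfl fun e he => by rw [(e1 e he).1, (e1 e he).2]
      · exact Finset.prod_congr rfl fun u hu => by rw [houtB σ u hu]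
    · rw [Finset.sum_congr rfl fun u hu => by rw [houtB σ u hu]]
  simp only [hc, hr]

/-- A tree with distinct names and at most `K` vertices. -/
def Good {I L : Type} (t K : ℕ) (r : Fin n) (x : NamedTree n I L t) : Prop :=
  Distinct t x r ∧ (verts t x r).card ≤ K

/-- Each outcome matches at most one tree. -/
lemma sum_outcomeProb_mul_ge (hn : 0 < n) (ha : 0 ≤ a) (hb : 0 ≤ b) {M : ℝ} (haM : a ≤ M)
    (hbM : b ≤ M) (hMn : M / n ≤ 1 / 2) (K t h : ℕ) (r : Fin n) (Ψ : Outcome n → ℝ)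
    (hΨ : ∀ ω, 0 ≤ Ψ ω) :
    ∑ x : LNamedTree n t, (if Good t K r x then 1 / 2 * treeWeight n a b α t h x *
        ∑ ω : Outcome n, (if Matches t x r ω then
          residual a b α M K (NamedTree.interior t x r) (verts t x r) ω * Ψ ω else 0) else 0)
      ≤ ∑ ω, outcomeProb n a b α ω * Ψ ω := by
  have hp1 : ∀ x y, edgeProb n a b x y ≤ 1 := fun x y =>
    (edgeProb_le haM hbM x y).trans (hMn.trans (by norm_num))
  have h0 := fun ω => outcomeProb_nonneg (α := α) ha hb hp1 ω
  have h1 : ∀ x : LNamedTree n t, (if Good t K r x then 1 / 2 * treeWeight n a b α t h x *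
        ∑ ω : Outcome n, (if Matches t x r ω then
          residual a b α M K (NamedTree.interior t x r) (verts t x r) ω * Ψ ω else 0) else 0)
      ≤ ∑ ω, if unfolding ω.2.1 ω.1 ω.2.2 t r none = x then outcomeProb n a b α ω * Ψ ω else 0 := by
    intro x
    by_cases hg : Good t K r x
    · rw [if_pos hg, Finset.mul_sum]
      refine Finset.sum_le_sum fun ω _ => ?_
      by_cases hm : Matches t x r ω
      -- A matched good tree is recovered from the outcome as its walk tree, so the events for
      -- different trees are disjoint and their probabilities may be added.
      · rw [if_pos hm, if_pos (unfolding_eq_of_matches hg.1 hm), ← mul_assoc]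
        exact mul_le_mul_of_nonneg_right
          (treeWeight_mul_residual_le hn ha hb haM hbM hMn t h hg.1 hg.2 hm) (hΨ ω)
      · rw [if_neg hm, mul_zero]
        split_ifs
        · exact mul_nonneg (h0 ω) (hΨ ω)
        · exact le_rfl
    · rw [if_neg hg]
      refine Finset.sum_nonneg fun ω _ => ?_
      split_ifs
      · exact mul_nonneg (h0 ω) (hΨ ω)
      · exact le_rfl
  refine (Finset.sum_le_sum fun x _ => h1 x).trans (le_of_eq ?_)
  rw [Finset.sum_comm]
  refine Finset.sum_congr rfl fun ω _ => ?_
  rw [Finset.sum_ite_eq, if_pos (Finset.mem_univ _)]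

/-- The neighbourhood of `r` has almost the law of the tree. -/
lemma sum_outcomeProb_unfolding_ge (hn : 0 < n) (ha : 0 ≤ a) (hb : 0 ≤ b) {M : ℝ} (haM : a ≤ M)
    (hbM : b ≤ M) (hMn : M / n ≤ 1 / 2) (K t h : ℕ) (r : Fin n) (ψ : LNamedTree n t → ℝ)
    (hψ : ∀ s, 0 ≤ ψ s) :
    (1 - K * ((M * (Real.sqrt n + K) + 2 * M ^ 2) / n)) *
        totalWeight n a b α t h (fun s => if Good t K r s then ψ s else 0)
      ≤ ∑ ω : Outcome n, outcomeProb n a b α ω * ψ (unfolding ω.2.1 ω.1 ω.2.2 t r none) := by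
  refine le_trans ?_ (sum_outcomeProb_mul_ge hn ha hb haM hbM hMn K t h r
    (fun ω => ψ (unfolding ω.2.1 ω.1 ω.2.2 t r none)) fun ω => hψ _)
  unfold totalWeight
  rw [Finset.mul_sum]
  refine Finset.sum_le_sum fun x _ => ?_
  dsimp only
  by_cases hg : Good t K r x
  · rw [if_pos hg, if_pos hg]
    have h1 : ∑ ω : Outcome n, (if Matches t x r ω then
          residual a b α M K (NamedTree.interior t x r) (verts t x r) ω *
            ψ (unfolding ω.2.1 ω.1 ω.2.2 t r none) else 0)
        = (∑ ω : Outcome n, if Matches t x r ω then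
          residual a b α M K (NamedTree.interior t x r) (verts t x r) ω else 0) * ψ x := by
      rw [Finset.sum_mul]
      refine Finset.sum_congr rfl fun ω _ => ?_
      by_cases hm : Matches t x r ω
      · rw [if_pos hm, if_pos hm, unfolding_eq_of_matches hg.1 hm]
      · rw [if_neg hm, if_neg hm, zero_mul]
    rw [h1]
    have h2 := sum_residual_ge (a := a) (b := b) (α := α) hn (ha.trans haM)
      (Nat.cast_nonneg K) t x r hg.1
    have h3 := mul_le_mul_of_nonneg_right h2
      (mul_nonneg (mul_nonneg one_half_pos.le (treeWeight_nonneg (α := α) ha hb t h x)) (hψ x))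
    calc _ = _ := by ring
      _ ≤ _ := h3
      _ = _ := by ring
  · rw [if_neg hg, if_neg hg, mul_zero, mul_zero, mul_zero]

/-- No estimator does better on the graph than the optimal one on the named trees. -/
lemma sum_outcomeProb_error_ge (hn : 0 < n) (ha : 0 ≤ a) (hb : 0 ≤ b) {M : ℝ} (haM : a ≤ M)
    (hbM : b ≤ M) (hMn : M / n ≤ 1 / 2) (K t h : ℕ) (r : Fin n)
    (f : SimpleGraph (Fin n) → (Fin n → Bool) → Bool) :
    (1 - K * ((M * (Real.sqrt n + K) + 2 * M ^ 2) / n)) *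
        totalWeight n a b α t h (fun s => if Good t K r s then
          (if exactDecision n a b α t h (LabelledTree.observeExact t (forgetNames t s))
            ≠ rootLabel t s then 1 else 0) else 0)
      ≤ ∑ ω : Outcome n, outcomeProb n a b α ω * (if f ω.2.1 ω.2.2 ≠ ω.1 r then 1 else 0) := by
  have hp1 : ∀ x y, edgeProb n a b x y ≤ 1 := fun x y =>
    (edgeProb_le haM hbM x y).trans (hMn.trans (by norm_num))
  -- The answer of `f` as a randomized decision from the observation. By
  -- `matchMass_eq_of_observation_eq`, the good tree chosen to represent `o` does not matter.
  set κ : NamedTree n Bool (Bool × Bool) t → Bool → ℝ := fun o y =>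
    if hx : ∃ x : LNamedTree n t, Good t K r x ∧ map Prod.snd id t x = o then
      matchMass a b α M K f t hx.choose r y else 0 with hκ
  have hgood : ∀ x : LNamedTree n t, Good t K r (map Prod.snd id t x) ↔ Good t K r x := by
    intro x
    unfold Good
    rw [distinct_map, verts_map]
  have hκx : ∀ (x : LNamedTree n t) y, Good t K r x →
      κ (map Prod.snd id t x) y = matchMass a b α M K f t x r y := by
    intro x y hg
    have hx : ∃ x' : LNamedTree n t, Good t K r x' ∧ map Prod.snd id t x' = map Prod.snd id t x :=
      ⟨x, hg, rfl⟩
    simp only [hκ, dif_pos hx]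
    exact matchMass_eq_of_observation_eq M K f t _ x r hx.choose_spec.1.1 hg.1 hx.choose_spec.2 y
  have hopt := totalWeight_error_ge_of_optimal (n := n) (α := α) ha hb id t h
    (fun o => exactDecision n a b α t h (forgetExact t o)) (exactDecision_optimal t h)
    (fun o => Good t K r o ∧ ∃ x : LNamedTree n t, map Prod.snd id t x = o) κ
    (K * ((M * (Real.sqrt n + K) + 2 * M ^ 2) / n))
    (by
      intro o y
      simp only [hκ]
      split_ifs
      · exact matchMass_nonneg ha hb hp1 _ _ _ _ _ _ _
      · exact le_rfl)
    (by
      rintro o ⟨hg, x, rfl⟩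
      rw [hgood] at hg
      rw [hκx x true hg, hκx x false hg, matchMass_add]
      exact sum_residual_ge hn (ha.trans haM) (Nat.cast_nonneg K) t x r hg.1)
  have hgood' : ∀ x : LNamedTree n t, (Good t K r (map Prod.snd id t x) ∧
      ∃ x' : LNamedTree n t, map Prod.snd id t x' = map Prod.snd id t x) ↔ Good t K r x :=
    fun x => ⟨fun h => (hgood x).mp h.1, fun h => ⟨(hgood x).mpr h, x, rfl⟩⟩
  simp only [hgood', forgetExact_map] at hopt
  refine hopt.trans (le_trans (le_of_eq ?_) (sum_outcomeProb_mul_ge (α := α) hn ha hb haM hbM hMn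
    K t h r (fun ω => if f ω.2.1 ω.2.2 ≠ ω.1 r then 1 else 0) fun ω => by split_ifs <;> norm_num))
  unfold totalWeight
  refine Finset.sum_congr rfl fun x _ => ?_
  dsimp only
  by_cases hg : Good t K r x
  · rw [if_pos hg, if_pos hg, hκx x _ hg, mul_assoc]
    congr 2
    unfold matchMass
    refine Finset.sum_congr rfl fun ω _ => ?_
    by_cases hm : Matches t x r ω
    · rw [if_pos hm, if_pos hm, hm.1.rootLabel_eq]
      congr 1
      cases f ω.2.1 ω.2.2 <;> cases ω.1 r <;> simp
    · rw [if_neg hm, if_neg hm]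
  · rw [if_neg hg, if_neg hg, mul_zero, mul_zero]

end Local

end SideInfo

end

noncomputable section

namespace SideInfo

open NamedTree
open Classical

/-! ### Accuracies on the graph and on the tree -/

section Accuracy

variable {n : ℕ} {a b : ℝ} {α : unitInterval}

lemma vertexAccuracy_eq (est : Estimator n) (r : Fin n) :
    vertexAccuracy n a b α est r
      = ∑ ω : Outcome n, outcomeProb n a b α ω * (if est ω.2.1 ω.2.2 r = ω.1 r then 1 else 0) := by
  rw [sum_outcome]
  unfold vertexAccuracy outcomeProb
  simp only [mul_ite, mul_one, mul_zero]

lemma vertexAccuracy_add_error (est : Estimator n) (r : Fin n) :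
    vertexAccuracy n a b α est r
      + ∑ ω : Outcome n, outcomeProb n a b α ω * (if est ω.2.1 ω.2.2 r ≠ ω.1 r then 1 else 0)
      = 1 := by
  refine Eq.trans ?_ (sum_outcomeProb (n := n) (a := a) (b := b) (α := α))
  rw [vertexAccuracy_eq, ← Finset.sum_add_distrib]
  refine Finset.sum_congr rfl fun ω _ => ?_
  by_cases h : est ω.2.1 ω.2.2 r = ω.1 r <;> simp [h]

lemma rootLabel_unfolding (G : SimpleGraph (Fin n)) (σ σ' : Fin n → Bool) (t : ℕ) (i : Fin n)
    (p : Option (Fin n)) : rootLabel t (unfolding G σ σ' t i p) = σ i := by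
  cases t <;> rfl

lemma treeAccuracy_bddAbove (t : ℕ) {Y : Type} (obs : LabelledTree t → Y) :
    BddAbove (Set.range fun est : Y → Bool => treeAccuracy a b α t obs est) :=
  ⟨1, by rintro _ ⟨est, rfl⟩; exact treeAccuracy_le_one t obs est⟩

lemma totalWeight_mono (ha : 0 ≤ a) (hb : 0 ≤ b) (t h : ℕ) {g g' : LNamedTree n t → ℝ}
    (hg : ∀ s, g s ≤ g' s) : totalWeight n a b α t h g ≤ totalWeight n a b α t h g' :=
  Finset.sum_le_sum fun s _ => mul_le_mul_of_nonneg_left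
    (mul_le_mul_of_nonneg_left (hg s) (treeWeight_nonneg ha hb t h s)) one_half_pos.le

lemma totalWeight_add (t h : ℕ) (g g' : LNamedTree n t → ℝ) :
    totalWeight n a b α t h (fun s => g s + g' s)
      = totalWeight n a b α t h g + totalWeight n a b α t h g' := by
  unfold totalWeight
  rw [← Finset.sum_add_distrib]
  exact Finset.sum_congr rfl fun s _ => by ring

/-- Any estimator will do: its correct and wrong trees are dominated by complementary probabilities.
-/
lemma totalWeight_one_le (hn : 0 < n) (ha : 0 ≤ a) (hb : 0 ≤ b) (t h : ℕ) :
    totalWeight n a b α t h (fun _ => 1) ≤ 1 := by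
  have h1 := totalWeight_correct_le (α := α) hn ha hb t h id fun _ => true
  have h2 := totalWeight_error_le (α := α) hn ha hb t h id fun _ => true
  have h3 := totalWeight_add (n := n) (a := a) (b := b) (α := α) t h
    (fun s => if true = rootLabel t s then 1 else 0) fun s => if true ≠ rootLabel t s then 1 else 0
  have h4 : (fun s : LNamedTree n t => (if true = rootLabel t s then (1 : ℝ) else 0) +
      if true ≠ rootLabel t s then 1 else 0) = fun _ => 1 := by
    funext s
    by_cases h : true = rootLabel t s <;> simp [h]
  rw [h4] at h3
  linarith

/-- The good trees with a correct decision, and those with a wrong one. -/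
lemma totalWeight_good (t K h : ℕ) (r : Fin n) (e : LNamedTree n t → Bool) :
    totalWeight n a b α t h
        (fun s => if Good t K r s then (if e s = rootLabel t s then 1 else 0) else 0)
      + totalWeight n a b α t h
        (fun s => if Good t K r s then (if e s ≠ rootLabel t s then 1 else 0) else 0)
      = totalWeight n a b α t h fun s => if Good t K r s then 1 else 0 := by
  rw [← totalWeight_add]
  congr 1
  funext s
  by_cases hP : Good t K r s <;> by_cases hQ : e s = rootLabel t s <;> simp [hP, hQ]

lemma totalWeight_good_le (ha : 0 ≤ a) (hb : 0 ≤ b) (t K h : ℕ) (r : Fin n)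
    {g : LNamedTree n t → ℝ} (hg : ∀ s, 0 ≤ g s) :
    totalWeight n a b α t h (fun s => if Good t K r s then g s else 0)
      ≤ totalWeight n a b α t h g := by
  refine totalWeight_mono ha hb t h fun s => ?_
  split_ifs
  · exact le_rfl
  · exact hg s

lemma totalWeight_le_one (hn : 0 < n) (ha : 0 ≤ a) (hb : 0 ≤ b) (t h : ℕ)
    {g : LNamedTree n t → ℝ} (hg : ∀ s, g s ≤ 1) : totalWeight n a b α t h g ≤ 1 :=
  (totalWeight_mono ha hb t h hg).trans (totalWeight_one_le hn ha hb t h)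

lemma sub_le_one_sub_mul {x y T : ℝ} (hT : T ≤ 1) (hy : 0 ≤ y) (hx : x ≤ T) :
    x - y ≤ (1 - y) * T := by
  nlinarith [mul_nonneg hy (sub_nonneg.mpr hT)]

/-- The graph error is almost at least the weight of good trees decided wrongly. This is the weight
of all good trees, at least 1 - δ, minus that of those decided correctly, which is at most the
optimal tree accuracy. -/
lemma vertexAccuracy_le (hn : 0 < n) (ha : 0 ≤ a) (hb : 0 ≤ b) {M : ℝ} (haM : a ≤ M)
    (hbM : b ≤ M) (hMn : M / n ≤ 1 / 2) (K t h : ℕ) {δ : ℝ} (r : Fin n)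
    (hgood : 1 - δ ≤ totalWeight n a b α t h fun s => if Good t K r s then 1 else 0)
    (est : Estimator n) :
    vertexAccuracy n a b α est r ≤ optTreeAccuracyExact a b α t + δ
      + K * ((M * (Real.sqrt n + K) + 2 * M ^ 2) / n) := by
  have hM := ha.trans haM
  have h1 := sum_outcomeProb_error_ge (α := α) hn ha hb haM hbM hMn K t h r
    fun G σ' => est G σ' r
  have h2 := vertexAccuracy_add_error (a := a) (b := b) (α := α) est r
  set D := exactDecision n a b α t h
  have h3 := totalWeight_good (n := n) (a := a) (b := b) (α := α) t K h r
    fun s => D (LabelledTree.observeExact t (forgetNames t s))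
  have h4 := totalWeight_good_le (n := n) (α := α) ha hb t K h r
    (g := fun s => if D (LabelledTree.observeExact t (forgetNames t s)) = rootLabel t s
      then 1 else 0) fun s => by split_ifs <;> norm_num
  have h5 := totalWeight_correct_le (α := α) hn ha hb t h (LabelledTree.observeExact t) D
  have h6 : treeAccuracy a b α t (LabelledTree.observeExact t) D ≤ optTreeAccuracyExact a b α t :=
    le_ciSup (treeAccuracy_bddAbove t (LabelledTree.observeExact t)) D
  have h7 := totalWeight_le_one (n := n) (α := α) hn ha hb t h
    (g := fun s => if Good t K r s then
      (if D (LabelledTree.observeExact t (forgetNames t s)) ≠ rootLabel t s then 1 else 0) else 0)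
    fun s => by split_ifs <;> norm_num
  have h8 := sub_le_one_sub_mul h7
    (by positivity : 0 ≤ K * ((M * (Real.sqrt n + K) + 2 * M ^ 2) / n))
    (x := 1 - δ - optTreeAccuracyExact a b α t) (by linarith)
  linarith

lemma vertexAccuracy_bpEstimator_le (hn : 0 < n) (ha : 0 ≤ a) (hb : 0 ≤ b) {M : ℝ} (haM : a ≤ M)
    (hbM : b ≤ M) (hMn : M / n ≤ 1 / 2) (K t h : ℕ) {δ : ℝ} (r : Fin n)
    (hgood : 1 - δ ≤ totalWeight n a b α t h fun s => if Good t K r s then 1 else 0) :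
    vertexAccuracy n a b α (bpEstimator n a b α t) r ≤ optTreeAccuracyNoisy a b α t + δ
      + K * ((M * (Real.sqrt n + K) + 2 * M ^ 2) / n) := by
  have hM := ha.trans haM
  set D : LNamedTree n t → Bool :=
    fun s => beliefDecision a b α t (LabelledTree.observeNoisy t (forgetNames t s)) with hDdef
  have h1 := sum_outcomeProb_unfolding_ge (α := α) hn ha hb haM hbM hMn K t h r
    (fun s => if D s ≠ rootLabel t s then 1 else 0) fun s => by split_ifs <;> norm_num
  have h2 := vertexAccuracy_add_error (a := a) (b := b) (α := α) (bpEstimator n a b α t) r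
  have h0 : ∀ ω : Outcome n, bpEstimator n a b α t ω.2.1 ω.2.2 r
      = D (unfolding ω.2.1 ω.1 ω.2.2 t r none) := fun ω => by
    rw [bpEstimator_eq a b α ω.2.1 ω.1 ω.2.2, hDdef, forgetNoisy_map]
  simp only [h0] at h2
  simp only [rootLabel_unfolding] at h1
  have h3 := totalWeight_good (n := n) (a := a) (b := b) (α := α) t K h r D
  have h4 := totalWeight_good_le (n := n) (α := α) ha hb t K h r
    (g := fun s => if D s = rootLabel t s then 1 else 0) fun s => by split_ifs <;> norm_num
  have h5 := totalWeight_correct_le (α := α) hn ha hb t h (LabelledTree.observeNoisy t)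
    (beliefDecision a b α t)
  have h6 : treeAccuracy a b α t (LabelledTree.observeNoisy t) (beliefDecision a b α t)
      ≤ optTreeAccuracyNoisy a b α t :=
    le_ciSup (treeAccuracy_bddAbove t (LabelledTree.observeNoisy t)) (beliefDecision a b α t)
  have h7 := totalWeight_le_one (n := n) (α := α) hn ha hb t h
    (g := fun s => if Good t K r s then (if D s ≠ rootLabel t s then 1 else 0) else 0)
    fun s => by split_ifs <;> norm_num
  have h8 := sub_le_one_sub_mul h7
    (by positivity : 0 ≤ K * ((M * (Real.sqrt n + K) + 2 * M ^ 2) / n))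
    (x := 1 - δ - optTreeAccuracyNoisy a b α t) (by linarith)
  linarith

/-- Any tree estimator is correct with weight at least its accuracy minus δ, since its wrong trees
are dominated by the tree law. Belief propagation does no worse in weight, and restricting it to
good trees costs δ once more. -/
lemma le_vertexAccuracy_bpEstimator (hn : 0 < n) (ha : 0 < a) (hb : 0 < b)
    (hα : (α : ℝ) < 1 / 2) {M : ℝ} (haM : a ≤ M)
    (hbM : b ≤ M) (hMn : M / n ≤ 1 / 2) (K t h : ℕ) {δ : ℝ} (r : Fin n)
    (hgood : 1 - δ ≤ totalWeight n a b α t h fun s => if Good t K r s then 1 else 0) :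
    optTreeAccuracyNoisy a b α t - (2 * δ
      + K * ((M * (Real.sqrt n + K) + 2 * M ^ 2) / n))
      ≤ vertexAccuracy n a b α (bpEstimator n a b α t) r := by
  have hM := ha.le.trans haM
  rw [sub_le_iff_le_add]
  refine ciSup_le fun est => ?_
  set D : LNamedTree n t → Bool :=
    fun s => beliefDecision a b α t (LabelledTree.observeNoisy t (forgetNames t s)) with hDdef
  set e : LNamedTree n t → Bool :=
    fun s => est (LabelledTree.observeNoisy t (forgetNames t s)) with hedef
  have h1 := sum_outcomeProb_unfolding_ge (α := α) hn ha.le hb.le haM hbM hMn K t h r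
    (fun s => if D s = rootLabel t s then 1 else 0) fun s => by split_ifs <;> norm_num
  have h2 := vertexAccuracy_eq (a := a) (b := b) (α := α) (bpEstimator n a b α t) r
  have h0 : ∀ ω : Outcome n, bpEstimator n a b α t ω.2.1 ω.2.2 r
      = D (unfolding ω.2.1 ω.1 ω.2.2 t r none) := fun ω => by
    rw [bpEstimator_eq a b α ω.2.1 ω.1 ω.2.2, hDdef, forgetNoisy_map]
  simp only [h0] at h2
  simp only [rootLabel_unfolding] at h1
  have h3 := totalWeight_good (n := n) (a := a) (b := b) (α := α) t K h r D
  have h4 : totalWeight n a b α t h (fun s => if D s = rootLabel t s then 1 else 0)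
      + totalWeight n a b α t h (fun s => if D s ≠ rootLabel t s then 1 else 0) ≤ 1 := by
    rw [← totalWeight_add]
    refine totalWeight_le_one hn ha.le hb.le t h fun s => ?_
    by_cases hs : D s = rootLabel t s <;> simp [hs]
  have h5 : totalWeight n a b α t h (fun s => if Good t K r s then 1 else 0)
      ≤ totalWeight n a b α t h (fun s => if e s = rootLabel t s then 1 else 0)
      + totalWeight n a b α t h (fun s => if e s ≠ rootLabel t s then 1 else 0) := by
    rw [← totalWeight_add]
    refine totalWeight_mono ha.le hb.le t h fun s => ?_
    by_cases hs : e s = rootLabel t s <;> by_cases hg : Good t K r s <;> simp [hs, hg]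
  have h6 := totalWeight_error_le (α := α) hn ha.le hb.le t h (LabelledTree.observeNoisy t) est
  have h7 := totalWeight_correct_le_of_optimal (n := n) (a := a) (b := b) (α := α) Prod.snd t h
    (fun o => beliefDecision a b α t (forgetNoisy t o)) (fun o => est (forgetNoisy t o))
    (beliefDecision_optimal ha hb hα t h)
  simp only [forgetNoisy_map] at h7
  have h8 := totalWeight_good_le (n := n) (α := α) ha.le hb.le t K h r
    (g := fun s => if D s ≠ rootLabel t s then 1 else 0) fun s => by split_ifs <;> norm_num
  have h9 := totalWeight_le_one (n := n) (α := α) hn ha.le hb.le t h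
    (g := fun s => if Good t K r s then (if D s = rootLabel t s then 1 else 0) else 0)
    fun s => by split_ifs <;> norm_num
  have h10 := sub_le_one_sub_mul h9
    (by positivity : 0 ≤ K * ((M * (Real.sqrt n + K) + 2 * M ^ 2) / n))
    (x := treeAccuracy a b α t (LabelledTree.observeNoisy t) est - 2 * δ) (by linarith)
  linarith

lemma graphAccuracy_le (hn : 0 < n) (est : Estimator n) {p : ℝ}
    (h : ∀ r, vertexAccuracy n a b α est r ≤ p) : graphAccuracy n a b α est ≤ p := by
  have hn' : (0 : ℝ) < n := by exact_mod_cast hn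
  have h1 : ∑ r, vertexAccuracy n a b α est r ≤ n * p := by
    simpa using Finset.sum_le_sum fun r (_ : r ∈ Finset.univ) => h r
  unfold graphAccuracy
  rw [div_mul_eq_mul_div, one_mul, div_le_iff₀ hn']
  linarith

lemma le_graphAccuracy (hn : 0 < n) (est : Estimator n) {p : ℝ}
    (h : ∀ r, p ≤ vertexAccuracy n a b α est r) : p ≤ graphAccuracy n a b α est := by
  have hn' : (0 : ℝ) < n := by exact_mod_cast hn
  have h1 : n * p ≤ ∑ r, vertexAccuracy n a b α est r := by
    simpa using Finset.sum_le_sum fun r (_ : r ∈ Finset.univ) => h r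
  unfold graphAccuracy
  rw [div_mul_eq_mul_div, one_mul, le_div_iff₀ hn']
  linarith

/-- The accuracies on a graph of finite size compared with those on the tree. -/
theorem accuracy_bounds (hn : 0 < n) (ha : 0 < a) (hb : 0 < b) (hα : (α : ℝ) < 1 / 2) {M : ℝ}
    (haM : a ≤ M) (hbM : b ≤ M) (hMn : M / n ≤ 1 / 2) (K t h : ℕ) {δ : ℝ} (hδ : 0 ≤ δ)
    (hgood : ∀ r, 1 - δ ≤ totalWeight n a b α t h fun s => if Good t K r s then 1 else 0) :
    optGraphAccuracy n a b α - optTreeAccuracyExact a b α t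
        ≤ 2 * δ + K * ((M * (Real.sqrt n + K) + 2 * M ^ 2) / n) ∧
      |graphAccuracy n a b α (bpEstimator n a b α t) - optTreeAccuracyNoisy a b α t|
        ≤ 2 * δ + K * ((M * (Real.sqrt n + K) + 2 * M ^ 2) / n) := by
  refine ⟨?_, abs_le.mpr ⟨?_, ?_⟩⟩
  · rw [sub_le_iff_le_add]
    refine ciSup_le fun est => graphAccuracy_le hn est fun r => ?_
    have := vertexAccuracy_le (α := α) hn ha.le hb.le haM hbM hMn K t h r (hgood r) est
    linarith
  · rw [neg_le_sub_iff_le_add, add_comm, ← sub_le_iff_le_add']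
    refine le_graphAccuracy hn _ fun r => ?_
    have := le_vertexAccuracy_bpEstimator hn ha hb hα haM hbM hMn K t h r (hgood r)
    linarith
  · rw [sub_le_iff_le_add]
    refine graphAccuracy_le hn _ fun r => ?_
    have := vertexAccuracy_bpEstimator_le (α := α) hn ha.le hb.le haM hbM hMn K t h r (hgood r)
    linarith

end Accuracy

end SideInfo

end

noncomputable section

namespace SideInfo

open NamedTree
open Classical

/-! ### Asymptotics -/

section Asymptotics

variable {n : ℕ} {a b : ℝ} {α : unitInterval}

/-- The maximum with 1 covers M < 1, where the powers decrease and M^t says nothing about the first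
levels. -/
lemma geomSum_le {d M : ℝ} (hd : 0 ≤ d) (hdM : d ≤ M) (h t : ℕ) (hh : h ≤ t + 1) :
    geomSum d h ≤ h * max 1 (M ^ t) := by
  have h1 : ∀ s ∈ Finset.range h, d ^ s ≤ max 1 (M ^ t) := by
    intro s hs
    have hst : s ≤ t := by have := Finset.mem_range.mp hs; omega
    refine (pow_le_pow_left₀ hd hdM s).trans ?_
    rcases le_total M 1 with hM | hM
    · exact (pow_le_one₀ (hd.trans hdM) hM).trans (le_max_left _ _)
    · exact (pow_le_pow_right₀ hM hst).trans (le_max_right _ _)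
  simpa [geomSum] using Finset.sum_le_sum h1

lemma totalWeight_good_ge (hn : 0 < n) (ha : 0 ≤ a) (hb : 0 ≤ b) (t h K : ℕ) (hK : 0 < K)
    (r : Fin n) {μ : ℝ} (hμ : ∀ x, μ ≤ weightSum n a b α t h x fun _ => 1) :
    μ - geomSum ((a + b) / 2) h * ((a + b) / 2 / n * geomSum ((a + b) / 2) h
          + n * ((a + b) / 2 / n * geomSum ((a + b) / 2) h) ^ 2)
      - geomSum ((a + b) / 2) h / K
      ≤ totalWeight n a b α t h fun s => if Good t K r s then 1 else 0 := by
  have hg : ∀ x, _ ≤ weightSum n a b α t h x fun s => if Good t K r s then 1 else 0 := fun x => by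
    convert weightSum_good_ge (α := α) hn ha hb t h K hK x r using 4
    rfl
  rw [totalWeight_eq]
  linarith [hg true, hg false, hμ true, hμ false]

/-- In terms of `y = n ^ (1 / 100)`, trees of at most `y ^ 2` levels and `y ^ 10` vertices
carry almost all of the weight. -/
lemma weight_lower_bound (hn : 0 < n) (ha : 0 ≤ a) (hb : 0 ≤ b) (t : ℕ) {y δ : ℝ}
    (hy1 : 1 ≤ y) (hny : (n : ℝ) = y ^ 100) (hay : a ≤ y) (hby : b ≤ y)
    (hty : max a b ^ t ≤ y) (hδ : 0 < δ) (hδ1 : δ ≤ 1) (hyδ : 16 < y * δ ^ 2) (r : Fin n) :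
    1 - (δ + 39 / y) ≤ totalWeight n a b α t (min t ⌈y ^ 2⌉₊ + 1)
      fun s => if Good t ⌈y ^ 10⌉₊ r s then 1 else 0 := by
  have hn' : (0 : ℝ) < n := by exact_mod_cast hn
  have hy0 : 0 < y := by linarith
  set H := ⌈y ^ 2⌉₊ with hH
  set K := ⌈y ^ 10⌉₊ with hKdef
  -- For `t ≤ H` this exceeds `t` and nothing is truncated. Otherwise only trees reaching level `H +
  -- 1` are discarded.
  set h := min t H + 1 with hh
  have hH1 : y ^ 2 ≤ H := Nat.le_ceil _
  have hH2 : (H : ℝ) < y ^ 2 + 1 := Nat.ceil_lt_add_one (by positivity)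
  have hK1 : y ^ 10 ≤ K := Nat.le_ceil _
  have hK0 : 0 < K := Nat.ceil_pos.mpr (by positivity)
  set d := (a + b) / 2 with hd
  have hd0 : 0 ≤ d := by positivity
  have hdM : d ≤ max a b := by linarith [le_max_left a b, le_max_right a b]
  have hdy : d ≤ y := hdM.trans (max_le hay hby)
  set S := geomSum d h with hS
  have hS0 : 0 ≤ S := geomSum_nonneg hd0 h
  have hpow : ∀ k : ℕ, 1 ≤ y ^ k := fun k => one_le_pow₀ hy1
  have hS1 : S ≤ 3 * y ^ 3 := by
    have h1 := geomSum_le hd0 hdM h t (by omega)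
    have h2 : (h : ℝ) ≤ y ^ 2 + 2 := by
      have h3 : (h : ℝ) ≤ H + 1 := by exact_mod_cast (by omega : h ≤ H + 1)
      linarith
    calc S ≤ h * max 1 (max a b ^ t) := h1
      _ ≤ (y ^ 2 + 2) * y := mul_le_mul h2 (max_le hy1 hty) (by positivity) (by positivity)
      _ ≤ (y ^ 2 + 2 * y ^ 2) * y := by have := hpow 2; gcongr; linarith
      _ = 3 * y ^ 3 := by ring
  -- At most y² + 2 levels, with each power of d at most y, give S ≤ 3y³. The coincidences are then
  -- polynomial in y of low degree, against n = y^100.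
  have hcoll : S * (d / n * S + n * (d / n * S) ^ 2) ≤ 36 / y := by
    have h1 : S * (d / n * S + n * (d / n * S) ^ 2) = (d * S ^ 2 + d ^ 2 * S ^ 3) / n := by
      field_simp
    rw [h1, div_le_div_iff₀ hn' hy0, hny]
    calc (d * S ^ 2 + d ^ 2 * S ^ 3) * y
        ≤ (y * (3 * y ^ 3) ^ 2 + y ^ 2 * (3 * y ^ 3) ^ 3) * y := by gcongr
      _ = 9 * y ^ 8 + 27 * y ^ 12 := by ring
      _ ≤ 9 * y ^ 100 + 27 * y ^ 100 := by gcongr <;> first | exact hy1 | norm_num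
      _ = 36 * y ^ 100 := by ring
  have hsize : S / K ≤ 3 / y := by
    have hK' : (0 : ℝ) < K := by exact_mod_cast hK0
    rw [div_le_div_iff₀ hK' hy0]
    calc S * y ≤ 3 * y ^ 3 * y := by gcongr
      _ = 3 * y ^ 4 := by ring
      _ ≤ 3 * y ^ 10 := mul_le_mul_of_nonneg_left
          (pow_le_pow_right₀ hy1 (by norm_num)) (by norm_num)
      _ ≤ 3 * K := by gcongr
  have hmass : ∀ x, 1 - δ ≤ weightSum n a b α t h x fun _ => 1 := by
    intro x
    have hinv : 1 / y ≤ δ ^ 2 / 16 := by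
      rw [div_le_div_iff₀ hy0 (by norm_num)]
      linarith
    rcases le_or_gt t H with htH | htH
    · refine le_trans ?_ (mass_ge_of_lt (α := α) hn ha hb t h x (by omega))
      have h1 : d ^ 2 / (2 * n) * S ≤ 3 / y := by
        rw [div_mul_eq_mul_div, div_le_div_iff₀ (by positivity) hy0, hny]
        calc d ^ 2 * S * y ≤ y ^ 2 * (3 * y ^ 3) * y := by gcongr
          _ = 3 * y ^ 6 := by ring
          _ ≤ 3 * y ^ 100 := mul_le_mul_of_nonneg_left
              (pow_le_pow_right₀ hy1 (by norm_num)) (by norm_num)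
          _ ≤ 3 * (2 * y ^ 100) := by linarith [hpow 100]
      have h2 : 3 / y ≤ δ := by
        have h3 : 3 / y = 3 * (1 / y) := by ring
        nlinarith
      linarith
    · have hκ : d ^ 2 / (2 * n) ≤ δ ^ 2 / 16 := by
        refine le_trans ?_ hinv
        rw [div_le_div_iff₀ (by positivity) hy0, hny]
        calc d ^ 2 * y ≤ y ^ 2 * y := by gcongr
          _ = y ^ 3 := by ring
          _ ≤ y ^ 100 := pow_le_pow_right₀ hy1 (by norm_num)
          _ ≤ 1 * (2 * y ^ 100) := by linarith [hpow 100]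
      -- By Bernoulli's inequality, a larger d would give max(a,b)^t ≥ 1 + tδ²/16 with t ≥ y², which
      -- exceeds y.
      have hdη : d ≤ 1 + δ ^ 2 / 16 := by
        by_contra! hlt
        have h1 : (1 + δ ^ 2 / 16) ^ t ≤ y :=
          (pow_le_pow_left₀ (by positivity) (hlt.le.trans hdM) t).trans hty
        have h2 := one_add_mul_le_pow (a := δ ^ 2 / 16) (by linarith [sq_nonneg δ]) t
        have h3 : y ^ 2 ≤ t := hH1.trans (by exact_mod_cast htH.le)
        have h4 : y ^ 2 * (δ ^ 2 / 16) ≤ t * (δ ^ 2 / 16) := by gcongr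
        nlinarith
      refine le_trans ?_ (mass_ge_of_near_critical (α := α) hn ha hb hδ hδ1 le_rfl hdη hκ t h x)
      rw [sub_le_sub_iff_left]
      refine max_le le_rfl ?_
      have h1 : y ^ 2 ≤ (h : ℝ) := by
        have h2 : (h : ℝ) = H + 1 := by
          rw [hh, min_eq_right htH.le]
          push_cast
          rfl
        linarith
      have h3 : y ≤ y ^ 2 := by nlinarith
      have h4 : y * (δ ^ 2 / 8) ≤ h * (δ ^ 2 / 8) := by
        gcongr
        linarith
      linarith
  have hfinal := totalWeight_good_ge (α := α) hn ha hb t h K hK0 r hmass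
  have h39 : 39 / y = 36 / y + 3 / y := by ring
  linarith

/-- The dominant term is K·M·√n, of order y^61, while n = y^100. -/
lemma nonedge_error_le {y M : ℝ} (hy1 : 1 ≤ y) (hny : (n : ℝ) = y ^ 100) (hM : 0 ≤ M)
    (hMy : M ≤ y) :
    (⌈y ^ 10⌉₊ : ℝ) * ((M * (Real.sqrt n + ⌈y ^ 10⌉₊) + 2 * M ^ 2) / n) ≤ 10 / y := by
  have hy0 : 0 < y := by linarith
  have hpow : ∀ k : ℕ, 1 ≤ y ^ k := fun k => one_le_pow₀ hy1
  have hK : (⌈y ^ 10⌉₊ : ℝ) ≤ 2 * y ^ 10 := by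
    have h1 : (⌈y ^ 10⌉₊ : ℝ) < y ^ 10 + 1 := Nat.ceil_lt_add_one (by positivity)
    linarith [hpow 10]
  have hs : Real.sqrt n = y ^ 50 := by
    rw [hny, show y ^ 100 = (y ^ 50) ^ 2 by ring, Real.sqrt_sq (by positivity)]
  rw [← mul_div_assoc, div_le_div_iff₀ (by rw [hny]; positivity) hy0, hs, hny]
  calc (⌈y ^ 10⌉₊ : ℝ) * (M * (y ^ 50 + ⌈y ^ 10⌉₊) + 2 * M ^ 2) * y
      ≤ (2 * y ^ 10) * (y * (y ^ 50 + 2 * y ^ 10) + 2 * y ^ 2) * y := by gcongr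
    _ = 2 * y ^ 62 + 4 * y ^ 22 + 4 * y ^ 13 := by ring
    _ ≤ 2 * y ^ 100 + 4 * y ^ 100 + 4 * y ^ 100 := by gcongr <;> first | exact hy1 | norm_num
    _ = 10 * y ^ 100 := by ring

lemma accuracy_bounds_of_le (hn : 0 < n) (ha : 0 < a) (hb : 0 < b) (hα : (α : ℝ) < 1 / 2)
    (t : ℕ) {y ε : ℝ} (hny : (n : ℝ) = y ^ 100) (hay : a ≤ y) (hby : b ≤ y)
    (hty : max a b ^ t ≤ y) (hε : 0 < ε) (hε1 : ε ≤ 1) (hyε : 256 < y * ε ^ 2) :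
    optGraphAccuracy n a b α - optTreeAccuracyExact a b α t ≤ ε ∧
      |graphAccuracy n a b α (bpEstimator n a b α t) - optTreeAccuracyNoisy a b α t| ≤ ε := by
  have hεsq : ε ^ 2 ≤ ε := by nlinarith
  have hy256 : 256 < y := by
    by_contra! hle
    rcases le_total 0 y with h0 | h0
    · nlinarith
    · nlinarith [sq_nonneg ε]
  have hy0 : 0 < y := by linarith
  have hinv : 1 / y ≤ ε / 256 := by
    rw [div_le_div_iff₀ hy0 (by norm_num)]
    nlinarith
  have hMn : max a b / n ≤ 1 / 2 := by
    rw [div_le_div_iff₀ (by rw [hny]; positivity) (by norm_num), hny]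
    have h1 : y ^ 2 ≤ y ^ 100 := pow_le_pow_right₀ (by linarith) (by norm_num)
    have h2 := max_le hay hby
    nlinarith
  -- With δ = ε/4 the total error is 2(ε/4 + 39/y) + 10/y = ε/2 + 88/y, and 88/y ≤ 88ε/256 < ε/2.
  have hgood := weight_lower_bound (α := α) hn ha.le hb.le t (by linarith) hny hay hby hty
    (δ := ε / 4) (by positivity) (by linarith) (by nlinarith)
  have hbounds := accuracy_bounds hn ha hb hα (le_max_left a b) (le_max_right a b) hMn
    ⌈y ^ 10⌉₊ t _ (by positivity) hgood
  have herr := nonedge_error_le (by linarith) hny (ha.le.trans (le_max_left a b)) (max_le hay hby)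
  have h1 : 39 / y = 39 * (1 / y) := by ring
  have h2 : 10 / y = 10 * (1 / y) := by ring
  exact ⟨hbounds.1.trans (by linarith), hbounds.2.trans (by linarith)⟩

lemma eventually_accuracy_bounds {a b : ℕ → ℝ} {t : ℕ → ℕ} (ha : ∀ n, 0 < a n)
    (hb : ∀ n, 0 < b n) (hα : (α : ℝ) < 1 / 2)
    (hab : Asymptotics.IsTheta atTop (fun n => a n / b n) (fun _ => (1 : ℝ)))
    (ha_sub : IsSubpolynomial a) (ht_sub : IsSubpolynomial fun n => max (a n) (b n) ^ t n)
    {ε : ℝ} (hε : 0 < ε) :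
    ∀ᶠ n in atTop, optGraphAccuracy n (a n) (b n) α - optTreeAccuracyExact (a n) (b n) α (t n) ≤ ε ∧
      |graphAccuracy n (a n) (b n) α (bpEstimator n (a n) (b n) α (t n))
        - optTreeAccuracyNoisy (a n) (b n) α (t n)| ≤ ε := by
  obtain ⟨c, hc⟩ := hab.2.bound
  have hpow : Tendsto (fun n : ℕ => (n : ℝ) ^ (1 / 200 : ℝ)) atTop atTop :=
    (tendsto_rpow_atTop (by norm_num)).comp tendsto_natCast_atTop_atTop
  set ε' := min ε 1 with hε'
  have hε'0 : 0 < ε' := lt_min hε one_pos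
  filter_upwards [hc, hpow.eventually_ge_atTop (max c 1), hpow.eventually_gt_atTop (256 / ε' ^ 2),
    ha_sub (1 / 200) (by norm_num), ht_sub (1 / 100) (by norm_num), eventually_gt_atTop 0]
    with n h1 h2 h3 h4 h5 hn
  have hn0 : (0 : ℝ) ≤ n := Nat.cast_nonneg n
  have hc2 := (le_max_left c 1).trans h2
  have h12 := (le_max_right c 1).trans h2
  -- With y = w² = n^{1/100}: a ≤ w, and b ≤ c·a with c ≤ w for large n, so that b ≤ y as well. The
  -- square absorbs the constant comparing a and b.
  set w := (n : ℝ) ^ (1 / 200 : ℝ) with hw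
  have hy : (n : ℝ) ^ (1 / 100 : ℝ) = w * w := by
    rw [hw, ← Real.rpow_add (by exact_mod_cast hn)]
    norm_num
  have hwy : w ≤ w * w := by nlinarith
  have hny : (n : ℝ) = (w * w) ^ 100 := by
    rw [← hy, ← Real.rpow_natCast, ← Real.rpow_mul hn0]
    norm_num
  have hbc : b n ≤ c * a n := by
    rw [norm_one, Real.norm_of_nonneg (div_nonneg (ha n).le (hb n).le), ← mul_div_assoc,
      le_div_iff₀ (hb n), one_mul] at h1
    exact h1
  have hby : b n ≤ w * w := hbc.trans (mul_le_mul hc2 h4 (ha n).le (by linarith))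
  rw [div_lt_iff₀ (by positivity)] at h3
  have hres := accuracy_bounds_of_le (α := α) hn (ha n) (hb n) hα (t n) hny (h4.trans hwy) hby
    (h5.trans hy.le) hε'0 (min_le_right _ _)
    (h3.trans_le (mul_le_mul_of_nonneg_right hwy (by positivity)))
  exact ⟨hres.1.trans (min_le_left _ _), hres.2.trans (min_le_left _ _)⟩

/-- In `EReal` the limsup needs no boundedness. Two real numbers are inserted below an arbitrary `z`
above the right side, and their gap serves as ε. -/
lemma limsup_le_limsup_of_eventually_le_add {u v : ℕ → ℝ}
    (h : ∀ ε : ℝ, 0 < ε → ∀ᶠ n in atTop, u n ≤ v n + ε) :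
    limsup (fun n => (u n : EReal)) atTop ≤ limsup (fun n => (v n : EReal)) atTop := by
  refine le_of_forall_gt_imp_ge_of_dense fun z hz => ?_
  obtain ⟨c, hc1, hc2⟩ := EReal.lt_iff_exists_real_btwn.mp hz
  obtain ⟨c', hc'1, hc'2⟩ := EReal.lt_iff_exists_real_btwn.mp hc2
  have hcc : c < c' := by exact_mod_cast hc'1
  refine le_trans ?_ hc'2.le
  refine limsup_le_of_le (h := ?_)
  filter_upwards [eventually_lt_of_limsup_lt hc1, h (c' - c) (by linarith)] with n h1 h2
  have h3 : v n < c := by exact_mod_cast h1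
  exact_mod_cast (by linarith : u n ≤ c')

end Asymptotics

end SideInfo

end

/-! ### Passage to the limit -/

theorem mainTheorem6
    (a b : ℕ → ℝ) (α : unitInterval) (t : ℕ → ℕ)
    (ha : ∀ n, 0 < a n) (hb : ∀ n, 0 < b n)
    (hα : (α : ℝ) < 1 / 2)
    (hab : Asymptotics.IsTheta atTop (fun n => a n / b n) (fun _ => (1 : ℝ)))
    (ha_sub : SideInfo.IsSubpolynomial a)
    (ht_sub : SideInfo.IsSubpolynomial (fun n => max (a n) (b n) ^ t n)) :
    -- the optimal accuracy on the graph is at most the one on the tree with exact boundary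
    (limsup (fun n => ((SideInfo.optGraphAccuracy n (a n) (b n) α
        - SideInfo.optTreeAccuracyExact (a n) (b n) α (t n) : ℝ) : EReal)) atTop ≤ 0) ∧
    -- the accuracy of belief propagation
    (Tendsto (fun n => |SideInfo.graphAccuracy n (a n) (b n) α
          (SideInfo.bpEstimator n (a n) (b n) α (t n))
        - SideInfo.optTreeAccuracyNoisy (a n) (b n) α (t n)|) atTop (𝓝 0)) ∧
    -- the optimality gap of belief propagation
    (limsup (fun n => ((SideInfo.optGraphAccuracy n (a n) (b n) α
        - SideInfo.graphAccuracy n (a n) (b n) α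
            (SideInfo.bpEstimator n (a n) (b n) α (t n)) : ℝ) : EReal)) atTop
      ≤ limsup (fun n => ((SideInfo.optTreeAccuracyExact (a n) (b n) α (t n)
        - SideInfo.optTreeAccuracyNoisy (a n) (b n) α (t n) : ℝ) : EReal)) atTop) := by
  have key := fun (ε : ℝ) (hε : 0 < ε) =>
    SideInfo.eventually_accuracy_bounds ha hb hα hab ha_sub ht_sub hε
  refine ⟨?_, ?_, ?_⟩
  · have h := SideInfo.limsup_le_limsup_of_eventually_le_add
      (u := fun n => SideInfo.optGraphAccuracy n (a n) (b n) α
        - SideInfo.optTreeAccuracyExact (a n) (b n) α (t n)) (v := fun _ => 0) fun ε hε => by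
        filter_upwards [key ε hε] with n hn
        linarith [hn.1]
    simpa using h
  · rw [Metric.tendsto_nhds]
    intro ε hε
    filter_upwards [key (ε / 2) (by positivity)] with n hn
    rw [Real.dist_eq, sub_zero, abs_abs]
    linarith [hn.2]
  -- p*_G - p_BP = (p*_G - p*_T) + (p*_T - q*_T) + (q*_T - p_BP), where the first and the last term
  -- are eventually at most ε/2.
  · refine SideInfo.limsup_le_limsup_of_eventually_le_add fun ε hε => ?_
    filter_upwards [key (ε / 2) (by positivity)] with n hn
    linarith [hn.1, (abs_le.mp hn.2).1]
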